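/- **Inversion formulas for the $q$-Weyl transform.** Let $q\in(0,1)$ with $\frac{\log(1-q)}{\log q}\in\mathbb Z$ and let $\alpha>-\frac12$. Put $\mathbb R_q=\{\pm q^n:n\in\mathbb Z\}\cup\{0\}$, $(a;p)_\infty=\prod_{k\ge0}(1-ap^k)$, $\Gamma_{p}(x)=\frac{(p;p)_\infty}{(p^x;p)_\infty}(1-p)^{1-x}$, and use the Jackson integrals $\int_0^a f\,d_qt=(1-q)a\sum_{n\ge0}f(aq^n)q^n$, $\int_0^\infty f\,d_qt=(1-q)\sum_{n\in\mathbb Z}f(q^n)q^n$, $\int_a^\infty=\int_0^\infty-\int_0^a$. Let $D_qf(x)=\frac{f(x)-f(qx)}{(1-q)x}$ for $x\ne0$ and $D_qf(0)=f'(0)$. Let $\mathcal S_{*q}(\mathbb R_q)$ be the space of restrictions to $\mathbb R_q$ of even, infinitely $q$-differentiable functions $f:\mathbb R\to\mathbb C$ with $\sup_{x\in\mathbb R}|(1+x^2)^mD_q^kf(x)|<\infty$ for all $k,m\in\mathbb N$, and let $\mathcal S_{*q,-1/2}(\mathbb R_q)$ be the subspace of those $f$ with $\int_0^\infty f(x)x^{2k}\,d_qx=0$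 for $k=0,1,2,\dots$. Let $j_\alpha^{(3)}(z;q^2)=\sum_{n\ge0}\frac{(-1)^nq^{n(n-1)}(1-q)^{2n}z^{2n}}{\prod_{k=0}^{n-1}(1-q^{2k+2})(1-q^{2\alpha+2+2k})}$ be the normalized third Jackson $q$-Bessel function, and set $$\mathcal F_{\alpha,q}(f)(\lambda)=c_{\alpha,q}\int_0^\infty f(x)\,j_\alpha^{(3)}(\lambda x;q^2)\,x^{2\alpha+1}\,d_qx,\qquad c_{\alpha,q}=\frac{(1+q^{-1})^{-\alpha}}{\Gamma_{q^2}(\alpha+1)},\qquad \mathcal F_q=\mathcal F_{-1/2,q}.$$ Let $\mathcal F_q^{-1}$, $\mathcal F_{\alpha,q}^{-1}$ denote the inverses of these transforms on $\mathcal S_{*q}(\mathbb R_q)$. For $x\in\mathbb R_q$ define $$R_{\alpha,q}(f)(x)=\frac{(1+q)\Gamma_{q^2}(\alpha+1)}{\Gamma_{q^2}(\frac12)\Gamma_{q^2}(\alpha+\frac12)}\int_0^1\frac{(t^2q^2;q^2)_\infty}{(t^2q^{2\alpha+1};q^2)_\infty}f(xt)\,d_qt,$$ $$W_{\alpha,q}(f)(x)=\frac{q(1+q^{-1})^{-\alpha+\frac12}}{\Gamma_{q^2}(\alpha+\frac12)}\int_{q|x|}^\infty\frac{(q^2x^2/t^2;q^2)_\infty}{(q^{2\alpha+1}x^2/t^2;q^2)_\infty}f(t)\,t^{2\alpha}\,d_qt,$$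 $$K_{\alpha,q,1}(f)=\kappa\,\mathcal F_q^{-1}\big(|\lambda|^{2\alpha+1}\mathcal F_q(f)\big),\quad K_{\alpha,q,2}(f)=\kappa\,\mathcal F_{\alpha,q}^{-1}\big(|\lambda|^{2\alpha+1}\mathcal F_{\alpha,q}(f)\big),\quad \kappa=\frac{\Gamma_{q^2}(\frac12)}{q^{3\alpha+3/2}(1+q)^{\alpha+1/2}\Gamma_{q^2}(\alpha+1)}.$$ Then for every $f\in\mathcal S_{*q,-1/2}(\mathbb R_q)$, as functions on $\mathbb R_q$, $$f=W_{\alpha,q}\circ R_{\alpha,q}\circ K_{\alpha,q,1}(f)\qquad\text{and}\qquad f=W_{\alpha,q}\circ K_{\alpha,q,2}\circ R_{\alpha,q}(f).$$ -/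

import Mathlib

noncomputable section

namespace QBessel

/-- `(a; q)_n = ∏_{k < n} (1 - a q^k)`. -/
def qPoch (a q : ℝ) (n : ℕ) : ℝ := ∏ k ∈ Finset.range n, (1 - a * q ^ k)

/-- `(a; q)_∞ = ∏_{k ≥ 0} (1 - a q^k)`. -/
def qPochInf (a q : ℝ) : ℝ := ∏' k : ℕ, (1 - a * q ^ k)

/-- Jackson's `q`-Gamma function `Γ_q(x) = (q; q)_∞ / (q^x; q)_∞ (1 - q)^(1 - x)`. -/
def qGamma (q x : ℝ) : ℝ :=
  qPochInf q q / qPochInf (q ^ x) q * (1 - q) ^ (1 - x)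

/-- The basic hypergeometric series `₁φ₁(a; c; q, z)`. -/
def phi11 (a c q z : ℝ) : ℝ :=
  ∑' n : ℕ, qPoch a q n / (qPoch c q n * qPoch q q n) * (-1) ^ n * q ^ (n.choose 2) * z ^ n

/-- The normalized third Jackson (Hahn-Exton) `q`-Bessel function `j_α^{(3)}(z; q²)`.
After cancelling the factor `z^(-α) z^α` and the normalizing constants in
`(1 - q²)^α Γ_{q²}(α + 1) w^(-α) J_α^{(3)}(w; q²)`, `w = (1 - q) q⁻¹ z`, where
`J_α^{(3)}(w; q²) = w^α (q^(2α+2); q²)_∞ / (q²; q²)_∞ ₁φ₁(0; q^(2α+2); q², q² w²)`,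
it is `₁φ₁(0; q^(2α+2); q², (1 - q)² z²)`, which is even with value `1` at `0`. -/
def qBesselJ (q α z : ℝ) : ℝ :=
  phi11 0 (q ^ (2 * α + 2)) (q ^ 2) ((1 - q) ^ 2 * z ^ 2)

/-- The grid `ℝ_q = {± q^n : n ∈ ℤ} ∪ {0}`, which is closed under multiplication. -/
def Rq (q : ℝ) : Submonoid ℝ where
  carrier := {x | x = 0 ∨ ∃ n : ℤ, x = q ^ n ∨ x = -q ^ n}
  one_mem' := Or.inr ⟨0, Or.inl (zpow_zero q).symm⟩
  mul_mem' := by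
    intro a b ha hb
    rcases eq_or_ne q 0 with rfl | hq
    · rcases ha with rfl | ⟨m, ha⟩
      · exact Or.inl (zero_mul b)
      rcases hb with rfl | ⟨n, hb⟩
      · exact Or.inl (mul_zero a)
      by_cases hm : m = 0 <;> by_cases hn : n = 0
      · subst hm hn
        refine Or.inr ⟨0, ?_⟩
        rcases ha with rfl | rfl <;> rcases hb with rfl | rfl <;> simp
      all_goals
        refine Or.inl ?_
        rcases ha with rfl | rfl <;> rcases hb with rfl | rfl <;>
          simp [zero_zpow, *]
    · rcases ha with rfl | ⟨m, ha⟩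
      · exact Or.inl (zero_mul b)
      rcases hb with rfl | ⟨n, hb⟩
      · exact Or.inl (mul_zero a)
      refine Or.inr ⟨m + n, ?_⟩
      rw [zpow_add₀ hq]
      rcases ha with rfl | rfl <;> rcases hb with rfl | rfl <;> simp

/-- The point `q^n` of the grid. -/
def gridPt (q : ℝ) (n : ℤ) : Rq q := ⟨q ^ n, Or.inr ⟨n, Or.inl rfl⟩⟩

/-- The Jackson integral `∫_0^a φ(t) d_q t = (1 - q) a ∑_{n ≥ 0} φ(a q^n) q^n`. -/
def jackson0 (q : ℝ) (a : Rq q) (φ : Rq q → ℂ) : ℂ :=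
  ((1 - q : ℝ) : ℂ) * ((a : ℝ) : ℂ) * ∑' n : ℕ, φ (a * gridPt q n) * ((q ^ n : ℝ) : ℂ)

/-- The Jackson integral `∫_0^∞ φ(t) d_q t = (1 - q) ∑_{n ∈ ℤ} φ(q^n) q^n`. -/
def jacksonInf (q : ℝ) (φ : Rq q → ℂ) : ℂ :=
  ((1 - q : ℝ) : ℂ) * ∑' n : ℤ, φ (gridPt q n) * ((q ^ n : ℝ) : ℂ)

open Classical in
/-- The Jackson integral `∫_a^∞ φ(t) d_q t = ∫_0^∞ φ(t) d_q t - ∫_0^a φ(t) d_q t` for a lower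
limit `a ≥ 0` in `ℝ_q`: the part of `∫_0^∞` carried by the points `q^n > a`. -/
def jacksonFrom (q a : ℝ) (φ : Rq q → ℂ) : ℂ :=
  jacksonInf q (fun t => if a < (t : ℝ) then φ t else 0)

/-- The `q`-derivative, with `(D_q f)(0) = f'(0)`. -/
def qDeriv (q : ℝ) (f : ℝ → ℂ) (x : ℝ) : ℂ :=
  if x = 0 then deriv f 0 else (f x - f (q * x)) / (((1 - q) * x : ℝ) : ℂ)

/-- Infinite `q`-differentiability: away from `0` all `q`-derivatives exist, and at `0` each
successive `q`-derivative has to be differentiable. -/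
def InfQDiff (q : ℝ) (f : ℝ → ℂ) : Prop :=
  ∀ k : ℕ, DifferentiableAt ℝ ((qDeriv q)^[k] f) 0

/-- The space `S_{*q}(ℝ_q)`: restrictions to `ℝ_q` of the even, infinitely `q`-differentiable
functions on `ℝ` that decrease fast together with all their `q`-derivatives. -/
def qSchwartz (q : ℝ) : Set (Rq q → ℂ) :=
  {f | ∃ F : ℝ → ℂ, (∀ x, F (-x) = F x) ∧ InfQDiff q F ∧
    (∀ k m : ℕ, ∃ C : ℝ, ∀ x : ℝ, ‖(((1 + x ^ 2) ^ m : ℝ) : ℂ) * (qDeriv q)^[k] F x‖ ≤ C) ∧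
    ∀ x : Rq q, f x = F x}

/-- The subspace `S_{*q,α}(ℝ_q)`: all moments `∫_0^∞ f(x) x^(2k+2α+1) d_q x` vanish. -/
def qSchwartzMoment (q α : ℝ) : Set (Rq q → ℂ) :=
  {f | f ∈ qSchwartz q ∧
    ∀ k : ℕ, jacksonInf q (fun x => f x * (((x : ℝ) ^ (2 * (k : ℝ) + 2 * α + 1) : ℝ) : ℂ)) = 0}

/-- `c_{α,q} = (1 + q⁻¹)^(-α) / Γ_{q²}(α + 1)`. -/
def cConst (q α : ℝ) : ℝ := (1 + q⁻¹) ^ (-α) / qGamma (q ^ 2) (α + 1)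

/-- The `q`-Bessel Fourier transform
`F_{α,q}(f)(l) = c_{α,q} ∫_0^∞ f(x) j_α^{(3)}(l x; q²) x^(2α+1) d_q x`. -/
def qBesselFourier (q α : ℝ) (f : Rq q → ℂ) (l : Rq q) : ℂ :=
  (cConst q α : ℂ) *
    jacksonInf q (fun x => f x * ((qBesselJ q α (l * x) * (x : ℝ) ^ (2 * α + 1) : ℝ) : ℂ))

/-- The inverse of `F_{α,q}`, as a map of `S_{*q}(ℝ_q)`. -/
def qBesselFourierInv (q α : ℝ) (h : Rq q → ℂ) : Rq q → ℂ :=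
  Function.invFunOn (qBesselFourier q α) (qSchwartz q) h

/-- The `q`-Fourier-cosine transform `F_q`, with kernel `cos(x; q²) = j_{-1/2}^{(3)}(x; q²)`,
is the case `α = -1/2`. -/
def qFourierCos (q : ℝ) : (Rq q → ℂ) → Rq q → ℂ := qBesselFourier q (-1 / 2)

/-- The inverse of `F_q`, as a map of `S_{*q}(ℝ_q)`. -/
def qFourierCosInv (q : ℝ) : (Rq q → ℂ) → Rq q → ℂ := qBesselFourierInv q (-1 / 2)

/-- The kernel `(q² y²; q²)_∞ / (q^(2α+1) y²; q²)_∞` of both integral transforms. -/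
def kernel (q α y : ℝ) : ℝ :=
  qPochInf (y ^ 2 * q ^ 2) (q ^ 2) / qPochInf (y ^ 2 * q ^ (2 * α + 1)) (q ^ 2)

/-- The `q`-Riemann-Liouville transform `R_{α,q}`. -/
def riemannLiouville (q α : ℝ) (f : Rq q → ℂ) (x : Rq q) : ℂ :=
  (((1 + q) * qGamma (q ^ 2) (α + 1) /
      (qGamma (q ^ 2) (1 / 2) * qGamma (q ^ 2) (α + 1 / 2)) : ℝ) : ℂ) *
    jackson0 q 1 (fun t => (kernel q α t : ℂ) * f (x * t))

/-- The `q`-Weyl transform `W_{α,q}`, normalized so that `F_{α,q} = F_q ∘ W_{α,q}`. The lower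
limit is `q |x|`, so that `W_{α,q} f` is even. -/
def weyl (q α : ℝ) (f : Rq q → ℂ) (x : Rq q) : ℂ :=
  ((q * (1 + q⁻¹) ^ (-α + 1 / 2) / qGamma (q ^ 2) (α + 1 / 2) : ℝ) : ℂ) *
    jacksonFrom q (q * |(x : ℝ)|)
      (fun t => ((kernel q α (x / t) : ℝ) : ℂ) * f t * (((t : ℝ) ^ (2 * α) : ℝ) : ℂ))

/-- The common constant of `K_{α,q,1}` and `K_{α,q,2}`. -/
def kConst (q α : ℝ) : ℝ :=
  qGamma (q ^ 2) (1 / 2) /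
    (q ^ (3 * α + 3 / 2) * (1 + q) ^ (α + 1 / 2) * qGamma (q ^ 2) (α + 1))

/-- `K_{α,q,1}(f) = const · F_q⁻¹(|l|^(2α+1) F_q(f))`. -/
def K1 (q α : ℝ) (f : Rq q → ℂ) : Rq q → ℂ := fun x =>
  (kConst q α : ℂ) *
    qFourierCosInv q (fun l => ((|(l : ℝ)| ^ (2 * α + 1) : ℝ) : ℂ) * qFourierCos q f l) x

/-- `K_{α,q,2}(f) = const · F_{α,q}⁻¹(|l|^(2α+1) F_{α,q}(f))`. -/
def K2 (q α : ℝ) (f : Rq q → ℂ) : Rq q → ℂ := fun x =>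
  (kConst q α : ℂ) *
    qBesselFourierInv q α
      (fun l => ((|(l : ℝ)| ^ (2 * α + 1) : ℝ) : ℂ) * qBesselFourier q α f l) x

end QBessel

end

/-! On the positive grid every transform is a sum over `ℤ`. Write `F_α` for `gridFourier q α`, `F`
for the case `α = -1/2`, and `h = F f`. The proof rests on three identities for sequences.

(1) `F_α F_α = q^(4α+2)`, and in particular `F F = 1` (`gridFourier_gridFourier`). The Mellin
transform over `p^ℤ` of `(c; p)_∞ ₁φ₁(0; c; p, ·)` is an explicit product (`hasSum_mellin`). At the
points `√c/z` and `√c z` with `|z| = 1` the infinite products cancel, so the product of the two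
transforms does not depend on `z`. Comparing Laurent coefficients gives orthogonality of the shifted
functions. The condition on `log (1 - q) / log q` says `1 - q = q^m`, which puts the arguments `(1 -
q)² q^(2n)` on the grid `(q²)^ℤ`.

(2) `F W_α = F_α` (`gridFourier_gridWeyl`), and (3) `κ q^(4α+2) R_α F u = F_α (|λ|^(-2α-1) u)`
(`riemannLiouville_gridFourier`). Both are interchanges of summation in the `q`-analogue of
Poisson's integral, `hasSum_kernel_mul_cos`, which is itself the `q`-binomial theorem applied
termwise.

By (3), together with (1) to invert the transforms, both `R_α K₁ f` and `K₂ R_α f` equal `q^(-4α-2)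
F_α h` on the positive grid. By (2) and (1), `F W_α F_α h = F_α F_α h = q^(4α+2) h = q^(4α+2) F f`,
and applying `F` once more yields `W_α F_α h = q^(4α+2) f`. The negative grid follows by evenness
and the point `0` by continuity (`weyl_eq_of_grid`).

The analytic part makes this legitimate. The sequence `h` decreases fast at infinity because the
even moments of the `q`-cosine vanish, and fast at `0` because those of `f` vanish. Hence
`|λ|^(±(2α+1)) h` keeps both decays. The transform of such a sequence lies in `S_{*q}(ℝ_q)`
(`gridFourier_mem_qSchwartz`), so the inverses defined by a choice really are inverses on the data
that occur (`gridFourier_inverse`). -/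

noncomputable section

namespace QBessel

open Filter Topology

/-! ### `q`-shifted factorials, the `q`-binomial theorem, and the Mellin transform of `₁φ₁`. -/

section Pochhammer

variable {𝕜 : Type*} [NormedField 𝕜]

/-- `(a; p)_n` in a normed field. -/
def pochFin (a p : 𝕜) (n : ℕ) : 𝕜 := ∏ k ∈ Finset.range n, (1 - a * p ^ k)

/-- `(a; p)_∞` in a normed field. -/
def pochInf (a p : 𝕜) : 𝕜 := ∏' k : ℕ, (1 - a * p ^ k)

theorem pochFin_succ (a p : 𝕜) (n : ℕ) :
    pochFin a p (n + 1) = pochFin a p n * (1 - a * p ^ n) :=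
  Finset.prod_range_succ _ _

theorem one_sub_ne_zero_of_norm_lt_one {x : 𝕜} (hx : ‖x‖ < 1) : 1 - x ≠ 0 := by
  intro h
  rw [sub_eq_zero] at h
  simp [← h] at hx

theorem norm_mul_pow_lt_one {a p : 𝕜} (hp : ‖p‖ < 1) (ha : ‖a‖ < 1) (n : ℕ) :
    ‖a * p ^ n‖ < 1 := by
  rw [norm_mul, norm_pow]
  calc ‖a‖ * ‖p‖ ^ n ≤ ‖a‖ * 1 := by
        gcongr
        exact pow_le_one₀ (norm_nonneg _) hp.le
    _ < 1 := by simpa using ha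

theorem pochFin_ne_zero {a p : 𝕜} (hp : ‖p‖ < 1) (ha : ‖a‖ < 1) (n : ℕ) : pochFin a p n ≠ 0 :=
  Finset.prod_ne_zero_iff.2 fun k _ => one_sub_ne_zero_of_norm_lt_one (norm_mul_pow_lt_one hp ha k)

theorem summable_norm_pochTerm {p : 𝕜} (hp : ‖p‖ < 1) (a : 𝕜) :
    Summable fun k : ℕ => ‖-(a * p ^ k)‖ := by
  simp only [norm_neg, norm_mul, norm_pow]
  exact (summable_geometric_of_lt_one (norm_nonneg _) hp).mul_left _

@[simp] theorem pochInf_zero (p : 𝕜) : pochInf 0 p = 1 := by simp [pochInf]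

theorem summable_norm_bounded_mul_pow {a : ℕ → 𝕜} {C : ℝ} (ha : ∀ n, ‖a n‖ ≤ C) {s : 𝕜}
    (hs : ‖s‖ < 1) : Summable fun n => ‖a n * s ^ n‖ := by
  refine Summable.of_nonneg_of_le (fun _ => norm_nonneg _) (fun n => ?_)
    ((summable_geometric_of_lt_one (norm_nonneg _) hs).mul_left C)
  rw [norm_mul, norm_pow]
  gcongr
  exact ha n

theorem summable_norm_pow_choose {p : 𝕜} (hp : ‖p‖ < 1) (x : 𝕜) :
    Summable fun n : ℕ => ‖p ^ n.choose 2 * x ^ n‖ := by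
  have h1 : Tendsto (fun n : ℕ => ‖p ^ n * x‖) atTop (𝓝 0) := by
    simpa using ((tendsto_pow_atTop_nhds_zero_of_norm_lt_one hp).mul_const x).norm
  refine summable_of_ratio_norm_eventually_le (r := 1 / 2) (by norm_num) ?_
  filter_upwards [h1.eventually (gt_mem_nhds (by norm_num : (0 : ℝ) < 1 / 2))] with n hn
  have : p ^ (n + 1).choose 2 * x ^ (n + 1) = p ^ n * x * (p ^ n.choose 2 * x ^ n) := by
    rw [Nat.choose_succ_succ' n 1, Nat.choose_one_right, pow_add, pow_succ]
    ring
  rw [this, norm_mul (p ^ n * x), norm_mul, norm_norm, norm_norm]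
  exact mul_le_mul_of_nonneg_right hn.le (norm_nonneg _)

/-- The coefficients of `(t; p)_∞ = ∑ eulerCoeff p n t^n`. -/
def eulerCoeff (p : 𝕜) (n : ℕ) : 𝕜 := (-1) ^ n * p ^ n.choose 2 / pochFin p p n

theorem eulerCoeff_succ {p : 𝕜} (hp : ‖p‖ < 1) (n : ℕ) :
    eulerCoeff p (n + 1) * (1 - p ^ (n + 1)) = -p ^ n * eulerCoeff p n := by
  have hn := pochFin_ne_zero hp hp n
  have hn' : 1 - p * p ^ n ≠ 0 := one_sub_ne_zero_of_norm_lt_one (norm_mul_pow_lt_one hp hp n)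
  rw [eulerCoeff, eulerCoeff, pochFin_succ, Nat.choose_succ_succ' n 1, Nat.choose_one_right,
    one_add_one_eq_two, pow_add, pow_succ (-1 : 𝕜), pow_succ' p n]
  generalize 1 - p * p ^ n = y at hn' ⊢
  field_simp
  rw [pow_add]

variable [CompleteSpace 𝕜]

theorem multipliable_pochTerm {p : 𝕜} (hp : ‖p‖ < 1) (a : 𝕜) :
    Multipliable fun k : ℕ => 1 - a * p ^ k := by
  simpa [sub_eq_add_neg] using multipliable_one_add_of_summable (summable_norm_pochTerm hp a)

theorem tendsto_pochFin {p : 𝕜} (hp : ‖p‖ < 1) (a : 𝕜) :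
    Tendsto (pochFin a p) atTop (𝓝 (pochInf a p)) :=
  (multipliable_pochTerm hp a).hasProd.tendsto_prod_nat

theorem pochInf_ne_zero {a p : 𝕜} (hp : ‖p‖ < 1) (ha : ‖a‖ < 1) : pochInf a p ≠ 0 := by
  have := tprod_one_add_ne_zero_of_summable (f := fun k : ℕ => -(a * p ^ k)) ?_
    (summable_norm_pochTerm hp a)
  · simpa [pochInf, sub_eq_add_neg] using this
  · intro k
    simpa [sub_eq_add_neg] using one_sub_ne_zero_of_norm_lt_one (norm_mul_pow_lt_one hp ha k)

theorem pochInf_eq_mul {p : 𝕜} (hp : ‖p‖ < 1) (a : 𝕜) :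
    pochInf a p = (1 - a) * pochInf (a * p) p := by
  have h1 := (tendsto_pochFin hp a).comp (tendsto_add_atTop_nat 1)
  have h2 := (tendsto_pochFin hp (a * p)).const_mul (1 - a)
  refine tendsto_nhds_unique h1 (h2.congr fun n => ?_)
  simp only [pochFin, Function.comp, Finset.prod_range_succ']
  rw [mul_comm]
  simp [pow_succ', mul_assoc]

theorem pochInf_eq_pochFin_mul {p : 𝕜} (hp : ‖p‖ < 1) (a : 𝕜) (n : ℕ) :
    pochInf a p = pochFin a p n * pochInf (a * p ^ n) p := by
  induction n with
  | zero => simp [pochFin]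
  | succ n ih =>
    rw [ih, pochFin_succ, pochInf_eq_mul hp (a * p ^ n), pow_succ]
    ring_nf

/-- The factor with index `n` is zero. This truncates the bilateral sum in `hasSum_zpow_mul_pochInf`
and makes the even moments of the Bessel function vanish. -/
theorem pochInf_inv_pow_eq_zero {p : 𝕜} (hp : ‖p‖ < 1) (hp0 : p ≠ 0) (n : ℕ) :
    pochInf (p ^ (-(n : ℤ))) p = 0 := by
  rw [pochInf_eq_pochFin_mul hp _ (n + 1), pochFin_succ]
  simp [hp0]

theorem exists_norm_pochFin_le {p : 𝕜} (hp : ‖p‖ < 1) (a : 𝕜) :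
    ∃ C, ∀ n, ‖pochFin a p n‖ ≤ C := by
  obtain ⟨C, hC⟩ := (Metric.isBounded_range_of_tendsto _ (tendsto_pochFin hp a)).exists_norm_le
  exact ⟨C, fun n => hC _ ⟨n, rfl⟩⟩

theorem exists_norm_pochFin_inv_le {a p : 𝕜} (hp : ‖p‖ < 1) (ha : ‖a‖ < 1) :
    ∃ C, ∀ n, ‖(pochFin a p n)⁻¹‖ ≤ C := by
  obtain ⟨C, hC⟩ := (Metric.isBounded_range_of_tendsto _
    ((tendsto_pochFin hp a).inv₀ (pochInf_ne_zero hp ha))).exists_norm_le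
  exact ⟨C, fun n => hC _ ⟨n, rfl⟩⟩

/-- Evaluation of a power series along `s p^N → 0`. -/
theorem tendsto_tsum_mul_pow_zero {p : 𝕜} (hp : ‖p‖ < 1) {a : ℕ → 𝕜} {s : 𝕜}
    (hs : Summable fun n => ‖a n * s ^ n‖) :
    Tendsto (fun N : ℕ => ∑' n, a n * (s * p ^ N) ^ n) atTop (𝓝 (a 0)) := by
  have h0 : ∑' n : ℕ, (if n = 0 then a 0 else 0) = a 0 := tsum_ite_eq 0 _
  rw [← h0]
  refine tendsto_tsum_of_dominated_convergence hs (fun n => ?_) (Eventually.of_forall fun N n => ?_)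
  · rcases eq_or_ne n 0 with rfl | hn
    · simp
    · have h1 : Tendsto (fun N : ℕ => p ^ N) atTop (𝓝 0) :=
        tendsto_pow_atTop_nhds_zero_of_norm_lt_one hp
      have := ((h1.const_mul s).pow n).const_mul (a n)
      simpa [hn] using this
  · rw [mul_pow, ← mul_assoc, norm_mul]
    refine mul_le_of_le_one_right (norm_nonneg _) ?_
    rw [norm_pow, norm_pow]
    exact pow_le_one₀ (by positivity) (pow_le_one₀ (norm_nonneg _) hp.le)

theorem exists_norm_binomialCoeff_le {p : 𝕜} (hp : ‖p‖ < 1) (b : 𝕜) :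
    ∃ C, ∀ n, ‖pochFin b p n / pochFin p p n‖ ≤ C := by
  obtain ⟨C, hC⟩ := exists_norm_pochFin_le hp b
  obtain ⟨D, hD⟩ := exists_norm_pochFin_inv_le hp hp
  refine ⟨C * D, fun n => ?_⟩
  rw [div_eq_mul_inv, norm_mul]
  exact mul_le_mul (hC n) (hD n) (norm_nonneg _) ((norm_nonneg _).trans (hC n))

theorem summable_norm_binomial {p : 𝕜} (hp : ‖p‖ < 1) (b : 𝕜) {s : 𝕜} (hs : ‖s‖ < 1) :
    Summable fun n => ‖pochFin b p n / pochFin p p n * s ^ n‖ := by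
  obtain ⟨C, hC⟩ := exists_norm_binomialCoeff_le hp b
  exact summable_norm_bounded_mul_pow hC hs

/-- Compare coefficients of `s^(n+1)`. Iterating along `s, sp, sp², …` produces the products of the
`q`-binomial theorem, and the series tends to its constant term `1`. -/
theorem binomial_functional {p : 𝕜} (hp : ‖p‖ < 1) (b : 𝕜) {s : 𝕜} (hs : ‖s‖ < 1) :
    (1 - s) * ∑' n, pochFin b p n / pochFin p p n * s ^ n =
      (1 - b * s) * ∑' n, pochFin b p n / pochFin p p n * (s * p) ^ n := by
  have hsp : ‖s * p‖ < 1 := by simpa using norm_mul_pow_lt_one hp hs 1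
  have h1 := (summable_norm_binomial hp b hs).of_norm
  have h2 := (summable_norm_binomial hp b hsp).of_norm
  have key : ∑' n, pochFin b p n / pochFin p p n * s ^ n -
        ∑' n, pochFin b p n / pochFin p p n * (s * p) ^ n =
      s * ∑' n, pochFin b p n / pochFin p p n * s ^ n -
        b * s * ∑' n, pochFin b p n / pochFin p p n * (s * p) ^ n := by
    rw [← h1.tsum_sub h2, ← tsum_mul_left, ← tsum_mul_left,
      ← (h1.mul_left s).tsum_sub (h2.mul_left (b * s)), (h1.sub h2).tsum_eq_zero_add]
    simp only [pow_zero, sub_self, zero_add]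
    refine tsum_congr fun n => ?_
    have hn := pochFin_ne_zero hp hp n
    have hn' : 1 - p * p ^ n ≠ 0 := one_sub_ne_zero_of_norm_lt_one (norm_mul_pow_lt_one hp hp n)
    rw [pochFin_succ, pochFin_succ, mul_pow, mul_pow]
    have e1 : pochFin b p n * (1 - b * p ^ n) / (pochFin p p n * (1 - p * p ^ n)) * (1 - p * p ^ n)
        = pochFin b p n / pochFin p p n * (1 - b * p ^ n) := by
      generalize 1 - p * p ^ n = y at hn' ⊢
      field_simp
    linear_combination s ^ (n + 1) * e1
  linear_combination key

/-- The `q`-binomial theorem. -/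
theorem tsum_binomial {p : 𝕜} (hp : ‖p‖ < 1) (b : 𝕜) {s : 𝕜} (hs : ‖s‖ < 1) :
    ∑' n, pochFin b p n / pochFin p p n * s ^ n = pochInf (b * s) p / pochInf s p := by
  rw [eq_div_iff (pochInf_ne_zero hp hs)]
  have iter : ∀ N : ℕ, (∑' n, pochFin b p n / pochFin p p n * s ^ n) * pochFin s p N =
      pochFin (b * s) p N * ∑' n, pochFin b p n / pochFin p p n * (s * p ^ N) ^ n := by
    intro N
    induction N with
    | zero => simp [pochFin]
    | succ N ih =>
      have := binomial_functional hp b (norm_mul_pow_lt_one hp hs N)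
      rw [pochFin_succ, pochFin_succ, ← mul_assoc, ih, pow_succ, ← mul_assoc s]
      linear_combination (pochFin (b * s) p N) * this
  have h1 := (tendsto_pochFin hp s).const_mul (∑' n, pochFin b p n / pochFin p p n * s ^ n)
  have h2 := (tendsto_pochFin hp (b * s)).mul
    (tendsto_tsum_mul_pow_zero hp (summable_norm_binomial hp b hs))
  simpa [pochFin] using tendsto_nhds_unique (h1.congr iter) h2

theorem summable_norm_eulerCoeff {p : 𝕜} (hp : ‖p‖ < 1) (x : 𝕜) :
    Summable fun n : ℕ => ‖eulerCoeff p n * x ^ n‖ := by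
  obtain ⟨D, hD⟩ := exists_norm_pochFin_inv_le hp hp
  refine Summable.of_nonneg_of_le (fun _ => norm_nonneg _) (fun n => ?_)
    ((summable_norm_pow_choose hp x).mul_left D)
  have : eulerCoeff p n * x ^ n = (pochFin p p n)⁻¹ * ((-1) ^ n * (p ^ n.choose 2 * x ^ n)) := by
    rw [eulerCoeff]; ring
  rw [this, norm_mul, norm_mul]
  simp only [norm_pow, norm_neg, norm_one, one_pow, one_mul]
  exact mul_le_mul_of_nonneg_right (hD n) (norm_nonneg _)

/-- Euler's expansion of `(t; p)_∞`. -/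
theorem tsum_eulerCoeff {p : 𝕜} (hp : ‖p‖ < 1) (t : 𝕜) :
    ∑' n, eulerCoeff p n * t ^ n = pochInf t p := by
  have func : ∀ t : 𝕜, ∑' n, eulerCoeff p n * t ^ n =
      (1 - t) * ∑' n, eulerCoeff p n * (t * p) ^ n := by
    intro t
    have h1 := (summable_norm_eulerCoeff hp t).of_norm
    have h2 := (summable_norm_eulerCoeff hp (t * p)).of_norm
    have key : ∑' n, eulerCoeff p n * t ^ n - ∑' n, eulerCoeff p n * (t * p) ^ n =
        -t * ∑' n, eulerCoeff p n * (t * p) ^ n := by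
      rw [← h1.tsum_sub h2, ← tsum_mul_left, (h1.sub h2).tsum_eq_zero_add]
      simp only [pow_zero, sub_self, zero_add]
      refine tsum_congr fun n => ?_
      rw [mul_pow, mul_pow]
      linear_combination t ^ (n + 1) * eulerCoeff_succ hp n
    linear_combination key
  have iter : ∀ N : ℕ, ∑' n, eulerCoeff p n * t ^ n =
      pochFin t p N * ∑' n, eulerCoeff p n * (t * p ^ N) ^ n := by
    intro N
    induction N with
    | zero => simp [pochFin]
    | succ N ih =>
      rw [ih, func (t * p ^ N), pochFin_succ, pow_succ]
      ring_nf
  have h2 := (tendsto_pochFin hp t).mul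
    (tendsto_tsum_mul_pow_zero hp (summable_norm_eulerCoeff hp t))
  have h3 := tendsto_nhds_unique (tendsto_const_nhds.congr iter) h2
  simpa [eulerCoeff, pochFin] using h3

/-- The function `(c; p)_∞ ₁φ₁(0; c; p, z)`. -/
def besselPhi (p c z : 𝕜) : 𝕜 := ∑' n, eulerCoeff p n * pochInf (c * p ^ n) p * z ^ n

theorem summable_besselPhi_double {p : 𝕜} (hp : ‖p‖ < 1) (c z : 𝕜) :
    Summable fun x : ℕ × ℕ =>
      eulerCoeff p x.1 * z ^ x.1 * (eulerCoeff p x.2 * (c * p ^ x.1) ^ x.2) := by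
  refine .of_norm (Summable.of_nonneg_of_le (fun _ => norm_nonneg _) (fun x => ?_)
    ((summable_norm_eulerCoeff hp z).mul_of_nonneg (summable_norm_eulerCoeff hp c)
      (fun _ => norm_nonneg _) fun _ => norm_nonneg _))
  rw [norm_mul]
  refine mul_le_mul_of_nonneg_left ?_ (norm_nonneg _)
  rw [mul_pow, ← mul_assoc, norm_mul]
  refine mul_le_of_le_one_right (norm_nonneg _) ?_
  rw [norm_pow, norm_pow]
  exact pow_le_one₀ (by positivity) (pow_le_one₀ (norm_nonneg _) hp.le)

/-- Expanding `(c p^n; p)_∞` by Euler's formula gives the double series `∑ e_n e_i z^n c^i p^(ni)`,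
which is symmetric under `c ↔ z`. It allows an expansion in powers of `c`, with the grid variable
inside the infinite product. -/
theorem besselPhi_symm {p : 𝕜} (hp : ‖p‖ < 1) (c z : 𝕜) : besselPhi p c z = besselPhi p z c := by
  have expand : ∀ c z : 𝕜, besselPhi p c z =
      ∑' n, ∑' i, eulerCoeff p n * z ^ n * (eulerCoeff p i * (c * p ^ n) ^ i) := by
    intro c z
    refine tsum_congr fun n => ?_
    rw [tsum_mul_left, tsum_eulerCoeff hp]
    ring
  rw [expand, expand, ← Summable.tsum_comm (f := fun i n =>
    eulerCoeff p i * c ^ i * (eulerCoeff p n * (z * p ^ i) ^ n))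
    (summable_besselPhi_double hp z c)]
  refine tsum_congr fun n => tsum_congr fun i => ?_
  rw [mul_pow, mul_pow, ← pow_mul, ← pow_mul, mul_comm n i]
  ring

variable {p c t : 𝕜}

/-- The terms with `j ≤ 0` vanish, and the others form the `q`-binomial series with `b = 0`. -/
theorem hasSum_zpow_mul_pochInf (hp : ‖p‖ < 1) (hp0 : p ≠ 0) (ht0 : t ≠ 0) (ht : ‖t‖ < 1) :
    HasSum (fun j : ℤ => t ^ j * pochInf (p ^ j) p) (t * pochInf p p / pochInf t p) ∧
      Summable fun j : ℤ => ‖t ^ j * pochInf (p ^ j) p‖ := by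
  have hinj : Function.Injective fun n : ℕ => (n : ℤ) + 1 := fun a b h => by simpa using h
  have hsupp : ∀ j : ℤ, j ∉ Set.range (fun n : ℕ => (n : ℤ) + 1) →
      t ^ j * pochInf (p ^ j) p = 0 := by
    intro j hj
    have hj0 : j ≤ 0 := by
      by_contra h
      exact hj ⟨(j - 1).toNat, by simp only; omega⟩
    obtain ⟨n, rfl⟩ : ∃ n : ℕ, j = -(n : ℤ) := ⟨(-j).toNat, by omega⟩
    rw [pochInf_inv_pow_eq_zero hp hp0, mul_zero]
  have hterm : ∀ n : ℕ, t ^ ((n : ℤ) + 1) * pochInf (p ^ ((n : ℤ) + 1)) p =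
      t * pochInf p p * (pochFin 0 p n / pochFin p p n * t ^ n) := by
    intro n
    rw [zpow_add_one₀ ht0, zpow_add_one₀ hp0, zpow_natCast, zpow_natCast,
      pochInf_eq_pochFin_mul hp p n, mul_comm (p ^ n)]
    have := pochFin_ne_zero hp hp n
    simp only [pochFin, zero_mul, sub_zero, Finset.prod_const_one] at this ⊢
    field_simp
  have hs := summable_norm_binomial hp 0 ht
  constructor
  · rw [← hinj.hasSum_iff hsupp]
    have h := (hs.of_norm.hasSum).mul_left (t * pochInf p p)
    rw [tsum_binomial hp 0 ht, zero_mul, pochInf_zero, mul_one_div] at h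
    simpa only [Function.comp_def, hterm] using h
  · rw [← hinj.summable_iff fun j hj => by rw [hsupp j hj, norm_zero]]
    simp only [Function.comp_def, hterm]
    simp only [norm_mul (t * pochInf p p)]
    exact hs.mul_left _

/-- The shift `(k, n) ↦ (k + n, n)` separates the variables: the family becomes a product of
`hasSum_zpow_mul_pochInf` with Euler's series at `c / t`. The same shift evaluates the sum in
`hasSum_mellin`. -/
theorem summable_mellin_double (hp : ‖p‖ < 1) (hp0 : p ≠ 0) (ht0 : t ≠ 0) (ht : ‖t‖ < 1) :
    Summable fun x : ℤ × ℕ =>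
      ‖t ^ x.1 * (eulerCoeff p x.2 * pochInf (p ^ x.1 * p ^ x.2) p * c ^ x.2)‖ := by
  have h := ((hasSum_zpow_mul_pochInf hp hp0 ht0 ht).2).mul_of_nonneg
    (summable_norm_eulerCoeff hp (c / t)) (fun _ => norm_nonneg _) fun _ => norm_nonneg _
  let e : ℤ × ℕ ≃ ℤ × ℕ :=
    ⟨fun x => (x.1 + x.2, x.2), fun x => (x.1 - x.2, x.2), fun x => by simp, fun x => by simp⟩
  refine (e.summable_iff.2 h).congr fun x => ?_
  simp only [Function.comp_def, e, Equiv.coe_fn_mk]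
  rw [← norm_mul, zpow_add₀ ht0, zpow_add₀ hp0, zpow_natCast, zpow_natCast]
  congr 1
  rw [div_pow]
  field_simp

/-- The Mellin transform of `(c; p)_∞ ₁φ₁(0; c; p, ·)` on the grid `p^ℤ`. -/
theorem hasSum_mellin (hp : ‖p‖ < 1) (hp0 : p ≠ 0) (ht0 : t ≠ 0) (ht : ‖t‖ < 1) (c : 𝕜) :
    HasSum (fun k : ℤ => t ^ k * besselPhi p c (p ^ k))
      (t * pochInf p p * pochInf (c / t) p / pochInf t p) := by
  have hd := (summable_mellin_double (c := c) hp hp0 ht0 ht).of_norm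
  have hk : ∀ k : ℤ, t ^ k * besselPhi p c (p ^ k) =
      ∑' n, t ^ k * (eulerCoeff p n * pochInf (p ^ k * p ^ n) p * c ^ n) := by
    intro k
    rw [tsum_mul_left, besselPhi_symm hp]
    rfl
  have h1 : HasSum (fun k : ℤ => t ^ k * besselPhi p c (p ^ k))
      (∑' x : ℤ × ℕ, t ^ x.1 * (eulerCoeff p x.2 * pochInf (p ^ x.1 * p ^ x.2) p * c ^ x.2)) := by
    simp only [hk]
    exact hd.hasSum.prod_fiberwise fun k => (hd.prod_factor k).hasSum
  convert h1 using 1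
  have hj := hasSum_zpow_mul_pochInf hp hp0 ht0 ht
  let e : ℤ × ℕ ≃ ℤ × ℕ :=
    ⟨fun x => (x.1 + x.2, x.2), fun x => (x.1 - x.2, x.2), fun x => by simp, fun x => by simp⟩
  have h2 := tsum_mul_tsum_of_summable_norm hj.2 (summable_norm_eulerCoeff hp (c / t))
  rw [hj.1.tsum_eq, tsum_eulerCoeff hp, ← e.tsum_eq] at h2
  rw [div_mul_eq_mul_div] at h2
  rw [h2]
  refine tsum_congr fun x => ?_
  simp only [e, Equiv.coe_fn_mk]
  rw [zpow_add₀ ht0, zpow_add₀ hp0, zpow_natCast, zpow_natCast, div_pow]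
  field_simp

theorem summable_norm_mellin (hp : ‖p‖ < 1) (hp0 : p ≠ 0) (ht0 : t ≠ 0) (ht : ‖t‖ < 1) (c : 𝕜) :
    Summable fun k : ℤ => ‖t ^ k * besselPhi p c (p ^ k)‖ := by
  have hd := summable_mellin_double (c := c) hp hp0 ht0 ht
  refine Summable.of_nonneg_of_le (fun _ => norm_nonneg _) (fun k => ?_) hd.prod
  have : t ^ k * besselPhi p c (p ^ k) =
      ∑' n, t ^ k * (eulerCoeff p n * pochInf (p ^ k * p ^ n) p * c ^ n) := by
    rw [tsum_mul_left, besselPhi_symm hp]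
    rfl
  rw [this]
  exact norm_tsum_le_tsum_norm (hd.prod_factor k)

end Pochhammer

/-! ### Orthogonality of the shifted functions `₁φ₁(0; c; p, p^k)`. -/

section Orthogonality

theorem integral_exp_int_mul (k : ℤ) :
    ∫ θ in (0 : ℝ)..2 * Real.pi, Complex.exp (θ * Complex.I) ^ k =
      if k = 0 then 2 * Real.pi else 0 := by
  split_ifs with hk
  · simp [hk]
  · have hk' : (k : ℂ) * Complex.I ≠ 0 := by simp [hk]
    have h : ∀ θ : ℝ, Complex.exp (θ * Complex.I) ^ k = Complex.exp (k * Complex.I * θ) := by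
      intro θ
      rw [← Complex.exp_int_mul]
      ring_nf
    simp only [h]
    rw [integral_exp_mul_complex hk']
    have : (k : ℂ) * Complex.I * ((2 * Real.pi : ℝ) : ℂ) = k * (2 * Real.pi * Complex.I) := by
      push_cast; ring
    rw [this, Complex.exp_int_mul_two_pi_mul_I]
    simp

/-- Uniqueness of the coefficients of an absolutely convergent Laurent series. -/
theorem laurent_coeff_eq {a : ℤ → ℂ} (ha : Summable fun n => ‖a n‖) {K : ℂ}
    (h : ∀ z : ℂ, ‖z‖ = 1 → ∑' n, a n * z ^ n = K) (n : ℤ) : a n = if n = 0 then K else 0 := by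
  have hpi : ((2 * Real.pi : ℝ) : ℂ) ≠ 0 := Complex.ofReal_ne_zero.2 Real.two_pi_pos.ne'
  set e : ℝ → ℂ := fun θ => Complex.exp (θ * Complex.I) with he
  have he0 : ∀ θ, e θ ≠ 0 := fun θ => Complex.exp_ne_zero _
  have hnorm : ∀ θ, ‖e θ‖ = 1 := fun θ => Complex.norm_exp_ofReal_mul_I θ
  have hcont : ∀ k : ℤ, Continuous fun θ => e θ ^ k := fun k =>
    Continuous.zpow₀ (by fun_prop) k fun θ => Or.inl (he0 θ)
  have hs : ∀ θ, HasSum (fun j => a j * e θ ^ (j - n)) (K * e θ ^ (-n)) := by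
    intro θ
    have h1 : Summable fun j => a j * e θ ^ j :=
      .of_norm (ha.congr fun j => by rw [norm_mul, norm_zpow, hnorm, one_zpow, mul_one])
    have h2 := h1.hasSum.mul_right (e θ ^ (-n))
    rw [h _ (hnorm θ)] at h2
    refine h2.congr_fun fun j => ?_
    rw [sub_eq_add_neg, zpow_add₀ (he0 θ), mul_assoc]
  -- Termwise integration of the series multiplied by `e^(-inθ)` isolates the coefficient `a n`.
  have hint := intervalIntegral.hasSum_integral_of_dominated_convergence
    (μ := MeasureTheory.volume) (a := 0) (b := 2 * Real.pi)
    (F := fun j θ => a j * e θ ^ (j - n)) (f := fun θ => K * e θ ^ (-n))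
    (fun j _ => ‖a j‖) (fun j => ((hcont _).const_mul _).aestronglyMeasurable)
    (fun j => .of_forall fun θ _ => by rw [norm_mul, norm_zpow, hnorm, one_zpow, mul_one])
    (.of_forall fun θ _ => ha) (by simp) (.of_forall fun θ _ => hs θ)
  simp only [intervalIntegral.integral_const_mul, he, integral_exp_int_mul] at hint
  have h3 := hint.unique (hasSum_single n fun j hj => by simp [sub_eq_zero, hj])
  simp only [sub_self, if_true, neg_eq_zero] at h3
  apply mul_right_cancel₀ hpi
  rw [← h3]
  split_ifs <;> simp

theorem ofReal_pochFin (a p : ℝ) (n : ℕ) :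
    pochFin (a : ℂ) p n = ((pochFin a p n : ℝ) : ℂ) := by
  simp [pochFin]

theorem ofReal_pochInf {p : ℝ} (hp : ‖p‖ < 1) (a : ℝ) :
    pochInf (a : ℂ) p = ((pochInf a p : ℝ) : ℂ) := by
  have hp' : ‖(p : ℂ)‖ < 1 := by simpa using hp
  refine tendsto_nhds_unique (tendsto_pochFin hp' _) ?_
  simp only [funext (ofReal_pochFin a p)]
  exact (Complex.continuous_ofReal.tendsto _).comp (tendsto_pochFin hp a)

theorem ofReal_besselPhi {p : ℝ} (hp : ‖p‖ < 1) (c z : ℝ) :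
    besselPhi (p : ℂ) c z = ((besselPhi p c z : ℝ) : ℂ) := by
  simp only [besselPhi, Complex.ofReal_tsum]
  refine tsum_congr fun n => ?_
  simp only [eulerCoeff, ofReal_pochFin]
  have := ofReal_pochInf hp (c * p ^ n)
  push_cast at this ⊢
  rw [this]

variable {p c : ℝ}

/-- A product of two bilateral series, grouped by the difference `x.1` of the two indices; this
difference becomes the exponent of `z` in the Laurent series. -/
theorem hasSum_int_mul_shift {A B : ℤ → ℂ} {a b : ℂ} (hA : HasSum A a) (hB : HasSum B b)
    (hA' : Summable fun k => ‖A k‖) (hB' : Summable fun k => ‖B k‖) :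
    HasSum (fun x : ℤ × ℤ => A x.2 * B (x.2 + x.1)) (a * b) ∧
      Summable fun x : ℤ × ℤ => ‖A x.2 * B (x.2 + x.1)‖ := by
  let e : ℤ × ℤ ≃ ℤ × ℤ :=
    ⟨fun x => (x.2, x.2 + x.1), fun x => (x.2 - x.1, x.1), fun x => by simp, fun x => by simp⟩
  have hs := hA'.mul_of_nonneg hB' (fun _ => norm_nonneg _) fun _ => norm_nonneg _
  refine ⟨e.hasSum_iff.2 (hA.mul hB (summable_mul_of_summable_norm hA' hB')), ?_⟩
  simp only [norm_mul]
  exact e.summable_iff.2 hs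

/-- This is the product of the Mellin transforms at `t = √c/z` and `t = √c z`. Since `c/t` is the
other point in each case, the numerator of one transform cancels the denominator of the other, and
only a constant remains. -/
theorem besselPhi_laurent (hp0 : 0 < p) (hp1 : p < 1) (hc0 : 0 < c) (hc1 : c < 1) {z : ℂ}
    (hz : ‖z‖ = 1) :
    (HasSum (fun x : ℤ × ℤ => ((c ^ x.2 * √c ^ x.1 *
      (besselPhi p c (p ^ x.2) * besselPhi p c (p ^ (x.2 + x.1))) : ℝ) : ℂ) * z ^ x.1)
      ((c * pochInf p p ^ 2 : ℝ) : ℂ)) ∧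
    Summable fun x : ℤ × ℤ => ‖((c ^ x.2 * √c ^ x.1 *
      (besselPhi p c (p ^ x.2) * besselPhi p c (p ^ (x.2 + x.1))) : ℝ) : ℂ) * z ^ x.1‖ := by
  have hp : ‖p‖ < 1 := by rwa [Real.norm_of_nonneg hp0.le]
  have hpc : ‖(p : ℂ)‖ < 1 := by simpa using hp
  have hpc0 : (p : ℂ) ≠ 0 := by exact_mod_cast hp0.ne'
  have hr0 : 0 < √c := Real.sqrt_pos.2 hc0
  have hr1 : √c < 1 := by rw [Real.sqrt_lt' one_pos]; simpa using hc1
  have hz0 : z ≠ 0 := fun h => by simp [h] at hz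
  have hr0' : (√c : ℂ) ≠ 0 := by exact_mod_cast hr0.ne'
  have hcc : (c : ℂ) = √c * √c := by exact_mod_cast (Real.mul_self_sqrt hc0.le).symm
  have n1 : ‖(√c : ℂ) / z‖ < 1 := by
    rw [norm_div, hz, Complex.norm_real, Real.norm_of_nonneg hr0.le]; simpa using hr1
  have n2 : ‖(√c : ℂ) * z‖ < 1 := by
    rw [norm_mul, hz, Complex.norm_real, Real.norm_of_nonneg hr0.le]; simpa using hr1
  have m1 := hasSum_mellin hpc hpc0 (div_ne_zero hr0' hz0) n1 (c : ℂ)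
  have m2 := hasSum_mellin hpc hpc0 (mul_ne_zero hr0' hz0) n2 (c : ℂ)
  have q1 : (c : ℂ) / (√c / z) = √c * z := by rw [hcc]; field_simp
  have q2 : (c : ℂ) / (√c * z) = √c / z := by rw [hcc]; field_simp
  rw [q1] at m1
  rw [q2] at m2
  have hm := hasSum_int_mul_shift m1 m2
    (summable_norm_mellin hpc hpc0 (div_ne_zero hr0' hz0) n1 (c : ℂ))
    (summable_norm_mellin hpc hpc0 (mul_ne_zero hr0' hz0) n2 (c : ℂ))
  have hterm : ∀ x : ℤ × ℤ, ((c ^ x.2 * √c ^ x.1 *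
        (besselPhi p c (p ^ x.2) * besselPhi p c (p ^ (x.2 + x.1))) : ℝ) : ℂ) * z ^ x.1 =
      (√c / z) ^ x.2 * besselPhi (p : ℂ) c ((p : ℂ) ^ x.2) *
        ((√c * z) ^ (x.2 + x.1) * besselPhi (p : ℂ) c ((p : ℂ) ^ (x.2 + x.1))) := by
    intro x
    rw [← Complex.ofReal_zpow, ← Complex.ofReal_zpow, ofReal_besselPhi hp, ofReal_besselPhi hp]
    have h1 : (c : ℂ) ^ x.2 = (√c : ℂ) ^ x.2 * (√c : ℂ) ^ x.2 := by
      rw [← mul_zpow, ← hcc]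
    rw [Complex.ofReal_mul, Complex.ofReal_mul, Complex.ofReal_mul, Complex.ofReal_zpow,
      Complex.ofReal_zpow, h1, div_zpow, mul_zpow, zpow_add₀ hr0', zpow_add₀ hz0]
    have h2 := zpow_ne_zero x.2 hz0
    generalize z ^ x.2 = y at h2 ⊢
    field_simp
  simp only [hterm]
  refine ⟨?_, hm.2⟩
  convert hm.1 using 1
  have h1 := pochInf_ne_zero hpc n1
  have h2 := pochInf_ne_zero hpc n2
  rw [Complex.ofReal_mul, Complex.ofReal_pow, ← ofReal_pochInf hp p]
  generalize pochInf (√c / z : ℂ) p = y at h1 ⊢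
  generalize pochInf (√c * z : ℂ) p = w at h2 ⊢
  rw [hcc]
  field_simp

/-- Orthogonality of `₁φ₁(0; c; p, p^k)`, `k ∈ ℤ`, under shifts. -/
theorem hasSum_besselPhi_mul_shift (hp0 : 0 < p) (hp1 : p < 1) (hc0 : 0 < c) (hc1 : c < 1)
    (b : ℤ) : HasSum (fun k : ℤ => c ^ k * (besselPhi p c (p ^ k) * besselPhi p c (p ^ (k + b))))
      (if b = 0 then c * pochInf p p ^ 2 else 0) := by
  have hs := (besselPhi_laurent hp0 hp1 hc0 hc1 norm_one).2
  simp only [one_zpow, mul_one, Complex.norm_real] at hs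
  have hr0 : 0 < √c := Real.sqrt_pos.2 hc0
  have hfac : ∀ b : ℤ, Summable fun k : ℤ =>
      c ^ k * (besselPhi p c (p ^ k) * besselPhi p c (p ^ (k + b))) := by
    intro b
    have := (hs.of_norm.prod_factor b).mul_left (√c ^ (-b))
    refine this.congr fun k => ?_
    have h := zpow_ne_zero b hr0.ne'
    simp only [zpow_neg]
    field_simp
  have hS : ∀ b : ℤ, ∑' k : ℤ, c ^ k * √c ^ b *
      (besselPhi p c (p ^ k) * besselPhi p c (p ^ (k + b))) =
      √c ^ b * ∑' k : ℤ, c ^ k * (besselPhi p c (p ^ k) * besselPhi p c (p ^ (k + b))) := by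
    intro b
    rw [← tsum_mul_left]
    exact tsum_congr fun k => by ring
  have ha : Summable fun b : ℤ => ‖((√c ^ b * ∑' k : ℤ, c ^ k *
      (besselPhi p c (p ^ k) * besselPhi p c (p ^ (k + b))) : ℝ) : ℂ)‖ := by
    refine Summable.of_nonneg_of_le (fun _ => norm_nonneg _) (fun b => ?_) hs.prod
    rw [Complex.norm_real, ← hS]
    exact norm_tsum_le_tsum_norm (hs.prod_factor b)
  have hK : ∀ z : ℂ, ‖z‖ = 1 → ∑' b : ℤ, ((√c ^ b * ∑' k : ℤ, c ^ k *
      (besselPhi p c (p ^ k) * besselPhi p c (p ^ (k + b))) : ℝ) : ℂ) * z ^ b =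
      ((c * pochInf p p ^ 2 : ℝ) : ℂ) := by
    intro z h1
    have := (besselPhi_laurent hp0 hp1 hc0 hc1 h1).1
    rw [← this.tsum_eq, this.summable.tsum_prod]
    refine tsum_congr fun b => ?_
    dsimp only
    rw [tsum_mul_right, ← Complex.ofReal_tsum, hS]
  have := laurent_coeff_eq ha hK b
  have hb := zpow_ne_zero b hr0.ne'
  rw [(hfac b).hasSum_iff]
  split_ifs at this ⊢ with h0
  · subst h0
    rw [zpow_zero, one_mul] at this
    exact_mod_cast this
  · have h2 : √c ^ b * ∑' k : ℤ, c ^ k *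
      (besselPhi p c (p ^ k) * besselPhi p c (p ^ (k + b))) = 0 := by exact_mod_cast this
    exact (mul_eq_zero.1 h2).resolve_left hb

end Orthogonality

/-! ### The third Jackson `q`-Bessel function on the grid. -/

section GridBessel

variable {q α : ℝ} {m : ℤ}

theorem norm_sq_lt_one (hq0 : 0 < q) (hq1 : q < 1) : ‖q ^ 2‖ < 1 := by
  rw [Real.norm_of_nonneg (sq_nonneg q)]
  exact pow_lt_one₀ hq0.le hq1 two_ne_zero

theorem norm_rpow_lt_one (hq0 : 0 < q) (hq1 : q < 1) {x : ℝ} (hx : 0 < x) : ‖q ^ x‖ < 1 := by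
  rw [Real.norm_of_nonneg (Real.rpow_nonneg hq0.le _)]
  exact Real.rpow_lt_one hq0.le hq1 hx

theorem sq_rpow (hq0 : 0 < q) (x : ℝ) : (q ^ 2) ^ x = q ^ (2 * x) := by
  rw [← Real.rpow_natCast, ← Real.rpow_mul hq0.le]
  norm_num

theorem qBesselJ_eq_besselPhi (hq0 : 0 < q) (hq1 : q < 1) (hα : -1 < α) (z : ℝ) :
    qBesselJ q α z = besselPhi (q ^ 2) (q ^ (2 * α + 2)) ((1 - q) ^ 2 * z ^ 2) /
      pochInf (q ^ (2 * α + 2)) (q ^ 2) := by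
  have hp := norm_sq_lt_one hq0 hq1
  have hc : ‖q ^ (2 * α + 2)‖ < 1 := norm_rpow_lt_one hq0 hq1 (by linarith)
  rw [qBesselJ, phi11, besselPhi, ← tsum_div_const]
  refine tsum_congr fun n => ?_
  have h0 : qPoch 0 (q ^ 2) n = 1 := by simp [qPoch]
  have h1 := pochInf_eq_pochFin_mul hp (q ^ (2 * α + 2)) n
  have h2 := pochFin_ne_zero hp hc n
  have h3 := pochInf_ne_zero hp hc
  have h4 := pochFin_ne_zero hp hp n
  have h5 : pochInf (q ^ (2 * α + 2) * (q ^ 2) ^ n) (q ^ 2) =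
      pochInf (q ^ (2 * α + 2)) (q ^ 2) / pochFin (q ^ (2 * α + 2)) (q ^ 2) n := by
    rw [eq_div_iff h2, h1, mul_comm]
  rw [h0, h5, eulerCoeff]
  change 1 / (pochFin _ _ n * pochFin _ _ n) * _ * _ * _ = _
  generalize pochFin (q ^ (2 * α + 2)) (q ^ 2) n = x at *
  generalize pochFin (q ^ 2) (q ^ 2) n = y at *
  generalize pochInf (q ^ (2 * α + 2)) (q ^ 2) = w at *
  field_simp

theorem qBesselJ_neg (z : ℝ) : qBesselJ q α (-z) = qBesselJ q α z := by
  simp [qBesselJ]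

/-- Here the integrality condition is used: `1 - q = q^m` turns the argument into a power of `q²`,
so the results on `p^ℤ` apply with `p = q²` after a shift by `m`. -/
theorem qBesselJ_zpow (hq0 : 0 < q) (hq1 : q < 1) (hm : 1 - q = q ^ m) (hα : -1 < α) (n : ℤ) :
    qBesselJ q α (q ^ n) = besselPhi (q ^ 2) (q ^ (2 * α + 2)) ((q ^ 2) ^ (n + m)) /
      pochInf (q ^ (2 * α + 2)) (q ^ 2) := by
  rw [qBesselJ_eq_besselPhi hq0 hq1 hα, hm, zpow_add₀ (by positivity), ← zpow_natCast q 2,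
    ← zpow_mul, ← zpow_mul, ← zpow_natCast, ← zpow_natCast, ← zpow_mul, ← zpow_mul]
  ring_nf

/-- As `s` may be arbitrarily small, this expresses decay faster than any power at infinity along
the grid (`n → -∞`). -/
theorem summable_zpow_mul_bessel (hq0 : 0 < q) (hq1 : q < 1) (hm : 1 - q = q ^ m) (hα : -1 < α)
    {s : ℝ} (hs0 : 0 < s) (hs1 : s < 1) :
    Summable fun n : ℤ => s ^ n * |qBesselJ q α (q ^ n)| := by
  have h := summable_norm_mellin (norm_sq_lt_one hq0 hq1) (by positivity : q ^ 2 ≠ 0) hs0.ne'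
    (by rwa [Real.norm_of_nonneg hs0.le]) (q ^ (2 * α + 2))
  have h2 := ((Equiv.addRight m).summable_iff.2 h).mul_left
    (s ^ (-m) * |pochInf (q ^ (2 * α + 2)) (q ^ 2)|⁻¹)
  refine h2.congr fun n => ?_
  simp only [Function.comp, Equiv.coe_addRight]
  rw [qBesselJ_zpow hq0 hq1 hm hα, norm_mul, abs_div, Real.norm_of_nonneg (zpow_nonneg hs0.le _),
    zpow_add₀ hs0.ne', zpow_neg, Real.norm_eq_abs]
  have := zpow_ne_zero m hs0.ne'
  field_simp

/-- The even moments of the `q`-Bessel function vanish. -/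
theorem hasSum_moment_bessel (hq0 : 0 < q) (hq1 : q < 1) (hm : 1 - q = q ^ m) (hα : -1 < α)
    (j : ℕ) : HasSum (fun n : ℤ => (q ^ (2 * α + 2) * (q ^ 2) ^ j) ^ n * qBesselJ q α (q ^ n)) 0 := by
  have hp := norm_sq_lt_one hq0 hq1
  have hc : ‖q ^ (2 * α + 2)‖ < 1 := norm_rpow_lt_one hq0 hq1 (by linarith)
  have hc0 : 0 < q ^ (2 * α + 2) := by positivity
  set t := q ^ (2 * α + 2) * (q ^ 2) ^ j with ht
  have ht0 : t ≠ 0 := by positivity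
  have h := hasSum_mellin hp (by positivity : q ^ 2 ≠ 0) ht0
    (norm_mul_pow_lt_one hp hc j) (q ^ (2 * α + 2))
  -- With `t = c p^j` the factor `(c/t; p)_∞` of the Mellin transform is `(p^(-j); p)_∞ = 0`.
  have hct : q ^ (2 * α + 2) / t = (q ^ 2) ^ (-(j : ℤ)) := by
    rw [ht, zpow_neg, zpow_natCast]
    field_simp
  rw [hct, pochInf_inv_pow_eq_zero hp (by positivity), mul_zero, zero_div] at h
  have h2 := ((Equiv.addRight m).hasSum_iff.2 h).mul_left
    (t ^ (-m) * (pochInf (q ^ (2 * α + 2)) (q ^ 2))⁻¹)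
  rw [mul_zero] at h2
  refine h2.congr_fun fun n => ?_
  simp only [Function.comp, Equiv.coe_addRight]
  rw [qBesselJ_zpow hq0 hq1 hm hα, zpow_add₀ ht0, zpow_neg]
  have := zpow_ne_zero m ht0
  field_simp

theorem hasSum_bessel_mul_bessel (hq0 : 0 < q) (hq1 : q < 1) (hm : 1 - q = q ^ m) (hα : -1 < α)
    (a b : ℤ) :
    HasSum (fun k : ℤ => (q ^ (2 * α + 2)) ^ k *
      (qBesselJ q α (q ^ (k + a)) * qBesselJ q α (q ^ (k + b))))
      (if a = b then (q ^ (2 * α + 2)) ^ (1 - m - a) * pochInf (q ^ 2) (q ^ 2) ^ 2 /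
        pochInf (q ^ (2 * α + 2)) (q ^ 2) ^ 2 else 0) := by
  have hp0 : 0 < q ^ 2 := by positivity
  have hp1 : q ^ 2 < 1 := pow_lt_one₀ hq0.le hq1 two_ne_zero
  have hc0 : 0 < q ^ (2 * α + 2) := by positivity
  have hc1 : q ^ (2 * α + 2) < 1 := Real.rpow_lt_one hq0.le hq1 (by linarith)
  have h := hasSum_besselPhi_mul_shift hp0 hp1 hc0 hc1 (b - a)
  have h2 := ((Equiv.addRight (a + m)).hasSum_iff.2 h).mul_left
    ((q ^ (2 * α + 2)) ^ (-(a + m)) * (pochInf (q ^ (2 * α + 2)) (q ^ 2) ^ 2)⁻¹)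
  have hval : (if a = b then (q ^ (2 * α + 2)) ^ (1 - m - a) * pochInf (q ^ 2) (q ^ 2) ^ 2 /
        pochInf (q ^ (2 * α + 2)) (q ^ 2) ^ 2 else 0) = (q ^ (2 * α + 2)) ^ (-(a + m)) *
        (pochInf (q ^ (2 * α + 2)) (q ^ 2) ^ 2)⁻¹ *
        if b - a = 0 then q ^ (2 * α + 2) * pochInf (q ^ 2) (q ^ 2) ^ 2 else 0 := by
    by_cases hab : a = b
    · subst hab
      rw [if_pos rfl, sub_self, if_pos rfl, show 1 - m - a = -(a + m) + 1 by ring,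
        zpow_add_one₀ hc0.ne']
      ring
    · rw [if_neg hab, if_neg (fun h => hab (sub_eq_zero.1 h).symm), mul_zero]
  rw [hval]
  refine h2.congr_fun fun k => ?_
  simp only [Function.comp, Equiv.coe_addRight]
  rw [qBesselJ_zpow hq0 hq1 hm hα, qBesselJ_zpow hq0 hq1 hm hα, zpow_add₀ hc0.ne' k (a + m),
    zpow_neg, add_assoc k a m, add_assoc k b m, show k + (a + m) + (b - a) = k + (b + m) by ring]
  have := zpow_ne_zero (a + m) hc0.ne'
  field_simp

theorem exists_norm_pochInf_mul_pow_le {p : ℝ} (hp : ‖p‖ < 1) (c : ℝ) :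
    ∃ D, ∀ n : ℕ, ‖pochInf (c * p ^ n) p‖ ≤ D := by
  refine ⟨∑' i, ‖eulerCoeff p i * |c| ^ i‖, fun n => ?_⟩
  rw [← tsum_eulerCoeff hp]
  have hle : ∀ i : ℕ, ‖eulerCoeff p i * (c * p ^ n) ^ i‖ ≤ ‖eulerCoeff p i * |c| ^ i‖ := by
    intro i
    simp only [norm_mul, norm_pow, Real.norm_eq_abs, abs_abs]
    gcongr
    refine mul_le_of_le_one_right (abs_nonneg _) (pow_le_one₀ (abs_nonneg _) ?_)
    exact (Real.norm_eq_abs p ▸ hp).le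
  have hs := summable_norm_eulerCoeff hp |c|
  have hs' := Summable.of_nonneg_of_le (fun _ => norm_nonneg _) hle hs
  exact (norm_tsum_le_tsum_norm hs').trans (hs'.tsum_le_tsum hle hs)

theorem exists_abs_besselPhi_le {p : ℝ} (hp : ‖p‖ < 1) (c : ℝ) (R : ℝ) :
    ∃ B, ∀ z : ℝ, |z| ≤ R → |besselPhi p c z| ≤ B := by
  obtain ⟨D, hD⟩ := exists_norm_pochInf_mul_pow_le hp c
  refine ⟨∑' n, D * ‖eulerCoeff p n * R ^ n‖, fun z hz => ?_⟩
  have hle : ∀ n : ℕ, ‖eulerCoeff p n * pochInf (c * p ^ n) p * z ^ n‖ ≤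
      D * ‖eulerCoeff p n * R ^ n‖ := by
    intro n
    have h1 : ‖z ^ n‖ ≤ ‖R ^ n‖ := by
      rw [norm_pow, norm_pow]
      gcongr
      rw [Real.norm_eq_abs, Real.norm_eq_abs]
      exact hz.trans (le_abs_self R)
    have hD0 := (norm_nonneg _).trans (hD n)
    calc _ = ‖pochInf (c * p ^ n) p‖ * (‖eulerCoeff p n‖ * ‖z ^ n‖) := by
          rw [norm_mul, norm_mul]; ring
      _ ≤ D * (‖eulerCoeff p n‖ * ‖R ^ n‖) := by gcongr; exact hD n
      _ = _ := by rw [norm_mul]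
  have hs := (summable_norm_eulerCoeff hp R).mul_left D
  have hs' := Summable.of_nonneg_of_le (fun _ => norm_nonneg _) hle hs
  exact (norm_tsum_le_tsum_norm hs').trans (hs'.tsum_le_tsum hle hs)

/-- For `n ≥ 0` the argument is bounded and the power series suffices. For `n ≤ 0` the value is at
most one term, with weight `q^n ≥ 1`, of a convergent series. -/
theorem exists_abs_bessel_le (hq0 : 0 < q) (hq1 : q < 1) (hm : 1 - q = q ^ m) (hα : -1 < α) :
    ∃ B, ∀ n : ℤ, |qBesselJ q α (q ^ n)| ≤ B := by
  obtain ⟨B, hB⟩ := exists_abs_besselPhi_le (norm_sq_lt_one hq0 hq1) (q ^ (2 * α + 2)) ((1 - q) ^ 2)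
  have hs := summable_zpow_mul_bessel hq0 hq1 hm hα hq0 hq1
  refine ⟨max (B / |pochInf (q ^ (2 * α + 2)) (q ^ 2)|) (∑' n : ℤ, q ^ n * |qBesselJ q α (q ^ n)|),
    fun n => ?_⟩
  rcases le_total 0 n with hn | hn
  · refine le_max_of_le_left ?_
    rw [qBesselJ_eq_besselPhi hq0 hq1 hα, abs_div]
    gcongr
    apply hB
    rw [abs_of_nonneg (by positivity)]
    refine mul_le_of_le_one_right (by positivity) (pow_le_one₀ (by positivity) ?_)
    exact zpow_le_one₀ hq0 hq1.le hn
  · refine le_max_of_le_right ?_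
    refine le_trans ?_ (hs.le_tsum n fun _ _ => by positivity)
    refine le_mul_of_one_le_left (abs_nonneg _) ?_
    exact one_le_zpow_of_nonpos₀ hq0 hq1.le hn

end GridBessel

/-! ### The transform `F_{α,q}` on sequences and its inversion. -/

section GridFourier

variable {q α : ℝ} {m : ℤ}

/-- The transform `F_{α,q}` of a sequence on the positive grid, as a function on `ℝ`. -/
def gridFourier (q α : ℝ) (a : ℤ → ℂ) (y : ℝ) : ℂ :=
  ((cConst q α * (1 - q) : ℝ) : ℂ) *
    ∑' n : ℤ, a n * ((qBesselJ q α (y * q ^ n) * (q ^ (2 * α + 2)) ^ n : ℝ) : ℂ)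

theorem zpow_rpow_comm (hq0 : 0 < q) (n : ℤ) (x : ℝ) : (q ^ n) ^ x = (q ^ x) ^ n := by
  rw [← Real.rpow_intCast, ← Real.rpow_intCast, ← Real.rpow_mul hq0.le, ← Real.rpow_mul hq0.le,
    mul_comm]

theorem qBesselFourier_eq_gridFourier (hq0 : 0 < q) (f : Rq q → ℂ) (l : Rq q) :
    qBesselFourier q α f l = gridFourier q α (fun n => f (gridPt q n)) l := by
  rw [qBesselFourier, gridFourier, jacksonInf, Complex.ofReal_mul, mul_assoc]
  congr 2
  refine tsum_congr fun n => ?_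
  have h : (q ^ (2 * α + 2)) ^ n = (q ^ n) ^ (2 * α + 1) * q ^ n := by
    rw [zpow_rpow_comm hq0, ← mul_zpow, show 2 * α + 2 = 2 * α + 1 + 1 by ring,
      Real.rpow_add_one hq0.ne' (2 * α + 1)]
  rw [h]
  simp only [gridPt]
  push_cast
  ring

theorem gridFourier_neg (a : ℤ → ℂ) (y : ℝ) : gridFourier q α a (-y) = gridFourier q α a y := by
  simp only [gridFourier, neg_mul, qBesselJ_neg]

theorem gridFourier_const_mul (C : ℂ) (a : ℤ → ℂ) (y : ℝ) :
    gridFourier q α (fun n => C * a n) y = C * gridFourier q α a y := by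
  simp only [gridFourier, mul_assoc, tsum_mul_left]
  ring

theorem cConst_eq (hq0 : 0 < q) (hq1 : q < 1) (hα : -1 < α) :
    cConst q α = (1 + q⁻¹) ^ (-α) * (1 - q ^ 2) ^ α *
      pochInf (q ^ (2 * α + 2)) (q ^ 2) / pochInf (q ^ 2) (q ^ 2) := by
  have h1 : 0 < 1 - q ^ 2 := by nlinarith
  rw [cConst, qGamma]
  change _ / (pochInf _ _ / pochInf _ _ * _) = _
  rw [sq_rpow hq0, show 2 * (α + 1) = 2 * α + 2 by ring,
    show 1 - (α + 1) = -α by ring, Real.rpow_neg h1.le]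
  have := pochInf_ne_zero (norm_sq_lt_one hq0 hq1) (norm_sq_lt_one hq0 hq1)
  have := pochInf_ne_zero (norm_sq_lt_one hq0 hq1)
    (norm_rpow_lt_one hq0 hq1 (by linarith : 0 < 2 * α + 2))
  field_simp

/-- The squared normalization times the norm constant of the orthogonality relation. As `1 - q² = (1
+ q) q^m`, the powers of `1 + q` cancel, and so do all powers depending on `m`. -/
theorem fourier_sq_const (hq0 : 0 < q) (hq1 : q < 1) (hm : 1 - q = q ^ m) (hα : -1 < α) :
    (cConst q α * (1 - q)) ^ 2 * ((q ^ (2 * α + 2)) ^ (1 - m) * pochInf (q ^ 2) (q ^ 2) ^ 2 /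
        pochInf (q ^ (2 * α + 2)) (q ^ 2) ^ 2) = q ^ (4 * α + 2) := by
  have h1 : 0 < 1 - q ^ 2 := by nlinarith
  have h2 := pochInf_ne_zero (norm_sq_lt_one hq0 hq1) (norm_sq_lt_one hq0 hq1)
  have h3 := pochInf_ne_zero (norm_sq_lt_one hq0 hq1)
    (norm_rpow_lt_one hq0 hq1 (by linarith : 0 < 2 * α + 2))
  have hA : (1 + q⁻¹) ^ (-α) * (1 - q ^ 2) ^ α = q ^ (α * (m + 1)) := by
    have e1 : (1 + q⁻¹) = (1 + q) * q⁻¹ := by field_simp; ring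
    have e2 : 1 - q ^ 2 = (1 + q) * q ^ (m : ℝ) := by
      rw [Real.rpow_intCast, ← hm]; ring
    rw [e1, e2, Real.mul_rpow (by positivity) (by positivity),
      Real.mul_rpow (by positivity) (by positivity), ← Real.rpow_mul hq0.le,
      Real.inv_rpow hq0.le, Real.rpow_neg (by positivity), Real.rpow_neg hq0.le, inv_inv,
      show α * ((m : ℝ) + 1) = α + m * α by ring, Real.rpow_add hq0]
    have : (1 + q) ^ α ≠ 0 := by positivity
    field_simp
  rw [cConst_eq hq0 hq1 hα, hA, hm, ← Real.rpow_intCast (q ^ (2 * α + 2)) (1 - m),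
    ← Real.rpow_mul hq0.le]
  have h4 : (q ^ (α * (m + 1)) * q ^ (m : ℝ)) ^ 2 * q ^ ((2 * α + 2) * ((1 - m : ℤ) : ℝ)) =
      q ^ (4 * α + 2) := by
    rw [← Real.rpow_add hq0, ← Real.rpow_natCast, ← Real.rpow_mul hq0.le, ← Real.rpow_add hq0]
    congr 1
    push_cast
    ring
  rw [← h4, Real.rpow_intCast q m]
  generalize pochInf (q ^ (2 * α + 2)) (q ^ 2) = x at h3 ⊢
  field_simp

theorem summable_mul_bessel (hq0 : 0 < q) (hq1 : q < 1) (hm : 1 - q = q ^ m) (hα : -1 < α)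
    {a : ℤ → ℂ} (ha : Summable fun n => ‖a n‖ * (q ^ (2 * α + 2)) ^ n) (k : ℤ) :
    Summable fun n : ℤ => ‖a n * ((qBesselJ q α (q ^ k * q ^ n) * (q ^ (2 * α + 2)) ^ n : ℝ) : ℂ)‖ := by
  obtain ⟨B, hB⟩ := exists_abs_bessel_le hq0 hq1 hm hα
  refine Summable.of_nonneg_of_le (fun _ => norm_nonneg _) (fun n => ?_) (ha.mul_left B)
  rw [norm_mul, Complex.norm_real, norm_mul, Real.norm_eq_abs, ← zpow_add₀ hq0.ne',
    Real.norm_of_nonneg (by positivity)]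
  have := hB (k + n)
  have h0 : 0 ≤ ‖a n‖ * (q ^ (2 * α + 2)) ^ n := by positivity
  nlinarith [mul_le_mul_of_nonneg_right this h0]

/-- The transform is, up to a constant, its own inverse. -/
theorem gridFourier_gridFourier (hq0 : 0 < q) (hq1 : q < 1) (hm : 1 - q = q ^ m) (hα : -1 < α)
    {a : ℤ → ℂ} (ha : Summable fun n => ‖a n‖ * (q ^ (2 * α + 2)) ^ n) (l : ℤ) :
    gridFourier q α (fun k => gridFourier q α a (q ^ k)) (q ^ l) =
      ((q ^ (4 * α + 2) : ℝ) : ℂ) * a l := by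
  obtain ⟨B, hB⟩ := exists_abs_bessel_le hq0 hq1 hm hα
  set c := q ^ (2 * α + 2) with hc
  have hc0 : 0 < c := by positivity
  have hc1 : c < 1 := Real.rpow_lt_one hq0.le hq1 (by linarith)
  set J := fun n : ℤ => qBesselJ q α (q ^ n) with hJ
  set κ : ℂ := ((cConst q α * (1 - q) : ℝ) : ℂ) with hκ
  have hEl : Summable fun k : ℤ => c ^ k * |J (l + k)| := by
    have h := (summable_zpow_mul_bessel hq0 hq1 hm hα hc0 hc1)
    have h2 := ((Equiv.addLeft l).summable_iff.2 h).mul_left (c ^ (-l))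
    refine h2.congr fun k => ?_
    simp only [Function.comp, Equiv.coe_addLeft, hJ, zpow_neg]
    rw [zpow_add₀ hc0.ne']
    have := zpow_ne_zero l hc0.ne'
    field_simp
  set G : ℤ → ℤ → ℂ := fun k n =>
    a n * ((J (k + n) * c ^ n : ℝ) : ℂ) * ((J (l + k) * c ^ k : ℝ) : ℂ) with hG
  have hdom : Summable (Function.uncurry G) := by
    refine .of_norm (Summable.of_nonneg_of_le (fun _ => norm_nonneg _) (fun x => ?_)
      ((hEl.mul_of_nonneg ha (fun _ => by positivity) fun _ => by positivity).mul_left B))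
    simp only [Function.uncurry, hG, norm_mul, Complex.norm_real, Real.norm_eq_abs,
      abs_of_pos (zpow_pos hc0 _)]
    have h0 : 0 ≤ c ^ x.1 * |J (l + x.1)| * (‖a x.2‖ * c ^ x.2) := by positivity
    have := mul_le_mul_of_nonneg_right (hB (x.1 + x.2)) h0
    simp only [hJ] at this ⊢
    nlinarith
  have h1 : gridFourier q α (fun k => gridFourier q α a (q ^ k)) (q ^ l) =
      κ * (κ * ∑' k, ∑' n, G k n) := by
    rw [gridFourier, ← hκ]
    congr 1
    rw [← tsum_mul_left]
    refine tsum_congr fun k => ?_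
    rw [gridFourier, ← hκ, mul_assoc, ← tsum_mul_right]
    simp only [hG, hJ, ← zpow_add₀ hq0.ne', ← hc]
  -- Summed over `k` first, the double series is the orthogonality relation, which leaves only `n =
  -- l`.
  have h2 : ∀ n, ∑' k, G k n = if n = l then a l * ((c ^ (1 - m) * pochInf (q ^ 2) (q ^ 2) ^ 2 /
        pochInf c (q ^ 2) ^ 2 : ℝ) : ℂ) else 0 := by
    intro n
    have h := hasSum_bessel_mul_bessel hq0 hq1 hm hα n l
    rw [← hc] at h
    have e : ∀ k, G k n = a n * ((c ^ n : ℝ) : ℂ) *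
        ((c ^ k * (qBesselJ q α (q ^ (k + n)) * qBesselJ q α (q ^ (k + l))) : ℝ) : ℂ) := by
      intro k
      simp only [hG, hJ, add_comm l k]
      push_cast
      ring
    simp only [e]
    rw [tsum_mul_left, ← Complex.ofReal_tsum, h.tsum_eq]
    split_ifs with hn
    · subst hn
      rw [sub_eq_add_neg (1 - m), zpow_add₀ hc0.ne', zpow_neg]
      have : ((c ^ n : ℝ) : ℂ) ≠ 0 := Complex.ofReal_ne_zero.2 (zpow_ne_zero n hc0.ne')
      push_cast at this ⊢
      field_simp
    · simp
  have hswap : ∑' k, ∑' n, G k n = ∑' n, ∑' k, G k n := (hdom.tsum_comm).symm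
  rw [h1, hswap, tsum_congr h2, tsum_ite_eq, ← fourier_sq_const hq0 hq1 hm hα,
    hκ, ← hc]
  push_cast
  ring

end GridFourier

/-! ### The common kernel, the constants, and the `q`-Poisson integral. -/

section Kernels

variable {q α : ℝ} {m : ℤ}

/-- On the grid the kernel is, up to a constant, the coefficient of the `q`-binomial series with `b
= q^(2α+1)`, base `q²`. -/
theorem kernel_pow (hq0 : 0 < q) (hq1 : q < 1) (hα : -1 / 2 < α) (j : ℕ) :
    kernel q α (q ^ j) = pochInf (q ^ 2) (q ^ 2) / pochInf (q ^ (2 * α + 1)) (q ^ 2) *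
      (pochFin (q ^ (2 * α + 1)) (q ^ 2) j / pochFin (q ^ 2) (q ^ 2) j) := by
  have hp := norm_sq_lt_one hq0 hq1
  have hb : ‖q ^ (2 * α + 1)‖ < 1 := norm_rpow_lt_one hq0 hq1 (by linarith)
  have h1 := pochInf_eq_pochFin_mul hp (q ^ 2) j
  have h2 := pochInf_eq_pochFin_mul hp (q ^ (2 * α + 1)) j
  have h3 := pochFin_ne_zero hp hp j
  have h4 := pochFin_ne_zero hp hb j
  have h5 := pochInf_ne_zero hp (norm_mul_pow_lt_one hp hb j)
  change pochInf _ _ / pochInf _ _ = _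
  rw [← pow_mul, mul_comm j 2, pow_mul, mul_comm _ (q ^ 2), mul_comm _ (q ^ (2 * α + 1)), h1, h2]
  generalize pochFin (q ^ (2 * α + 1)) (q ^ 2) j = x at *
  generalize pochFin (q ^ 2) (q ^ 2) j = y at *
  field_simp

theorem exists_abs_kernel_le (hq0 : 0 < q) (hq1 : q < 1) (hα : -1 / 2 < α) :
    ∃ D, ∀ j : ℕ, |kernel q α (q ^ j)| ≤ D := by
  obtain ⟨C, hC⟩ := exists_norm_binomialCoeff_le (norm_sq_lt_one hq0 hq1) (q ^ (2 * α + 1))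
  refine ⟨|pochInf (q ^ 2) (q ^ 2) / pochInf (q ^ (2 * α + 1)) (q ^ 2)| * C, fun j => ?_⟩
  rw [kernel_pow hq0 hq1 hα, abs_mul]
  gcongr
  exact hC j

theorem kernel_zero : kernel q α 0 = 1 := by
  change pochInf _ _ / pochInf _ _ = 1
  simp

theorem tendsto_kernel_pow (hq0 : 0 < q) (hq1 : q < 1) (hα : -1 / 2 < α) :
    Tendsto (fun j : ℕ => kernel q α (q ^ j)) atTop (𝓝 1) := by
  have hp := norm_sq_lt_one hq0 hq1
  have hb : ‖q ^ (2 * α + 1)‖ < 1 := norm_rpow_lt_one hq0 hq1 (by linarith)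
  have h1 := pochInf_ne_zero hp hp
  have h2 := pochInf_ne_zero hp hb
  simp only [kernel_pow hq0 hq1 hα]
  have h := ((tendsto_pochFin hp (q ^ (2 * α + 1))).div (tendsto_pochFin hp (q ^ 2)) h1).const_mul
    (pochInf (q ^ 2) (q ^ 2) / pochInf (q ^ (2 * α + 1)) (q ^ 2))
  rw [div_mul_div_comm, mul_comm (pochInf (q ^ 2) (q ^ 2)), div_self (mul_ne_zero h2 h1)] at h
  exact h

/-- The normalizing constant of `R_{α,q}`. -/
def rlConst (q α : ℝ) : ℝ :=
  (1 + q) * qGamma (q ^ 2) (α + 1) / (qGamma (q ^ 2) (1 / 2) * qGamma (q ^ 2) (α + 1 / 2))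

/-- The normalizing constant of `W_{α,q}`. -/
def weylConst (q α : ℝ) : ℝ :=
  q * (1 + q⁻¹) ^ (-α + 1 / 2) / qGamma (q ^ 2) (α + 1 / 2)

theorem qGamma_sq_eq (hq0 : 0 < q) (x : ℝ) : qGamma (q ^ 2) x =
    pochInf (q ^ 2) (q ^ 2) / pochInf (q ^ (2 * x)) (q ^ 2) * (1 - q ^ 2) ^ (1 - x) := by
  rw [← sq_rpow hq0]
  rfl

theorem qGamma_sq_ne_zero (hq0 : 0 < q) (hq1 : q < 1) {x : ℝ} (hx : 0 < x) :
    qGamma (q ^ 2) x ≠ 0 := by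
  have h1 : 0 < 1 - q ^ 2 := by nlinarith
  rw [qGamma_sq_eq hq0]
  have := pochInf_ne_zero (norm_sq_lt_one hq0 hq1) (norm_sq_lt_one hq0 hq1)
  have := pochInf_ne_zero (norm_sq_lt_one hq0 hq1)
    (norm_rpow_lt_one hq0 hq1 (by linarith : 0 < 2 * x))
  positivity

/-- The bracket is `∑ kernel(q^j) q^j`, by the `q`-binomial theorem at `s = q`; the identity says
that `R_{α,q}` fixes the constants. -/
theorem rlConst_mul (hq0 : 0 < q) (hq1 : q < 1) (hα : -1 / 2 < α) :
    rlConst q α * (1 - q) * (pochInf (q ^ 2) (q ^ 2) * pochInf (q ^ (2 * α + 2)) (q ^ 2) /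
      (pochInf (q ^ (2 * α + 1)) (q ^ 2) * pochInf q (q ^ 2))) = 1 := by
  have hp := norm_sq_lt_one hq0 hq1
  have h1 : 0 < 1 - q ^ 2 := by nlinarith
  have hb := pochInf_ne_zero hp (norm_rpow_lt_one hq0 hq1 (by linarith : 0 < 2 * α + 1))
  have hc := pochInf_ne_zero hp (norm_rpow_lt_one hq0 hq1 (by linarith : 0 < 2 * α + 2))
  have hpp := pochInf_ne_zero hp hp
  have hqq : pochInf q (q ^ 2) ≠ 0 := by
    refine pochInf_ne_zero hp ?_
    rwa [Real.norm_of_nonneg hq0.le]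
  have e : (1 - q ^ 2) ^ (1 - (1 / 2 : ℝ)) * (1 - q ^ 2) ^ (1 - (α + 1 / 2)) =
      (1 - q ^ 2) * (1 - q ^ 2) ^ (1 - (α + 1)) := by
    rw [← Real.rpow_add h1]
    nth_rw 2 [← Real.rpow_one (1 - q ^ 2)]
    rw [← Real.rpow_add h1]
    congr 1; ring
  have e1 : (2 : ℝ) * (1 / 2) = 1 := by norm_num
  have e2 : 2 * (α + 1 / 2) = 2 * α + 1 := by ring
  have e3 : 2 * (α + 1) = 2 * α + 2 := by ring
  rw [rlConst, qGamma_sq_eq hq0, qGamma_sq_eq hq0, qGamma_sq_eq hq0, e1, e2, e3, Real.rpow_one]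
  have h5 : (1 - q ^ 2) ^ (1 - (1 / 2 : ℝ)) ≠ 0 := by positivity
  have h6 : (1 - q ^ 2) ^ (1 - (α + 1 / 2)) ≠ 0 := by positivity
  have h7 : (1 - q ^ 2) ^ (1 - (α + 1)) ≠ 0 := by positivity
  generalize pochInf (q ^ (2 * α + 1)) (q ^ 2) = b at *
  generalize pochInf (q ^ (2 * α + 2)) (q ^ 2) = c at *
  generalize (1 - q ^ 2) ^ (1 - (1 / 2 : ℝ)) = x at *
  generalize (1 - q ^ 2) ^ (1 - (α + 1 / 2)) = y at *
  generalize (1 - q ^ 2) ^ (1 - (α + 1)) = z at *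
  generalize pochInf (q ^ 2) (q ^ 2) = w at *
  generalize pochInf q (q ^ 2) = v at *
  rw [div_mul_eq_mul_div, div_mul_div_comm, div_eq_one_iff_eq (by positivity)]
  field_simp
  linear_combination -e

/-- The balance of constants behind `F_{α,q} = F_q ∘ W_{α,q}`. -/
theorem cConst_mul_weylConst (hq0 : 0 < q) (hq1 : q < 1) (hα : -1 / 2 < α) :
    cConst q (-1 / 2) * weylConst q α = cConst q α * rlConst q α := by
  have g1 := qGamma_sq_ne_zero hq0 hq1 (by norm_num : (0 : ℝ) < 1 / 2)
  have g2 := qGamma_sq_ne_zero hq0 hq1 (by linarith : 0 < α + 1 / 2)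
  have g3 := qGamma_sq_ne_zero hq0 hq1 (by linarith : 0 < α + 1)
  have e : (1 + q⁻¹) ^ (-(-1 / 2 : ℝ)) * (q * (1 + q⁻¹) ^ (-α + 1 / 2)) =
      (1 + q⁻¹) ^ (-α) * (1 + q) := by
    have h0 : 0 < 1 + q⁻¹ := by positivity
    have h2 : (1 + q⁻¹) ^ (-(-1 / 2 : ℝ)) * (1 + q⁻¹) ^ (-α + 1 / 2) =
        (1 + q⁻¹) ^ (-α) * (1 + q⁻¹) := by
      rw [← Real.rpow_add h0, ← Real.rpow_add_one h0.ne']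
      congr 1; ring
    have h3 : q * (1 + q⁻¹) = 1 + q := by field_simp; ring
    linear_combination q * h2 + (1 + q⁻¹) ^ (-α) * h3
  rw [cConst, cConst, weylConst, rlConst, show (-1 / 2 + 1 : ℝ) = 1 / 2 by norm_num]
  generalize qGamma (q ^ 2) (α + 1 / 2) = x at *
  generalize qGamma (q ^ 2) (α + 1) = y at *
  generalize qGamma (q ^ 2) (1 / 2) = z at *
  rw [div_mul_div_comm, e]
  field_simp

/-- This determines `κ`: it is the factor for which `R_{α,q}` carries the normalization of `F_q` to
that of `F_{α,q}`, up to `q^(4α+2)`. -/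
theorem kConst_mul_cConst (hq0 : 0 < q) (hq1 : q < 1) (hα : -1 / 2 < α) :
    kConst q α * q ^ (4 * α + 2) * cConst q (-1 / 2) = cConst q α := by
  have g1 := qGamma_sq_ne_zero hq0 hq1 (by norm_num : (0 : ℝ) < 1 / 2)
  have g3 := qGamma_sq_ne_zero hq0 hq1 (by linarith : 0 < α + 1)
  have e1 : (1 + q⁻¹) = (1 + q) * q⁻¹ := by field_simp; ring
  have e : q ^ (4 * α + 2) * (1 + q⁻¹) ^ (-(-1 / 2 : ℝ)) =
      (1 + q⁻¹) ^ (-α) * (q ^ (3 * α + 3 / 2) * (1 + q) ^ (α + 1 / 2)) := by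
    have h1 : q ^ (4 * α + 2) = q ^ (3 * α + 3 / 2) * q ^ α * q ^ (1 / 2 : ℝ) := by
      rw [← Real.rpow_add hq0, ← Real.rpow_add hq0]
      congr 1; ring
    rw [e1, Real.mul_rpow (by positivity) (by positivity),
      Real.mul_rpow (by positivity) (by positivity), Real.inv_rpow hq0.le, Real.inv_rpow hq0.le,
      h1, Real.rpow_add (by positivity) α, Real.rpow_neg (by positivity) α,
      Real.rpow_neg hq0.le α, show -(-1 / 2 : ℝ) = 1 / 2 by norm_num, inv_inv]
    have : (1 + q) ^ α ≠ 0 := by positivity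
    field_simp
  have h0 : q ^ (3 * α + 3 / 2) * (1 + q) ^ (α + 1 / 2) ≠ 0 := by positivity
  rw [kConst, cConst, cConst, show (-1 / 2 + 1 : ℝ) = 1 / 2 by norm_num]
  generalize q ^ (3 * α + 3 / 2) * (1 + q) ^ (α + 1 / 2) = w at *
  generalize qGamma (q ^ 2) (α + 1) = y at *
  generalize qGamma (q ^ 2) (1 / 2) = z at *
  rw [div_mul_eq_mul_div, div_mul_div_comm, mul_assoc z, e]
  field_simp

/-- The `q`-analogue of Poisson's integral: `R_{α,q}` maps the `q`-cosine to `j_α`. -/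
theorem hasSum_kernel_mul_cos (hq0 : 0 < q) (hq1 : q < 1) (hα : -1 / 2 < α) (y : ℝ) :
    HasSum (fun j : ℕ => kernel q α (q ^ j) * q ^ j * qBesselJ q (-1 / 2) (y * q ^ j))
      ((rlConst q α * (1 - q))⁻¹ * qBesselJ q α y) := by
  have hp := norm_sq_lt_one hq0 hq1
  have hqn : ‖q‖ < 1 := by rwa [Real.norm_of_nonneg hq0.le]
  have hb := pochInf_ne_zero hp (norm_rpow_lt_one hq0 hq1 (by linarith : 0 < 2 * α + 1))
  have hc := pochInf_ne_zero hp (norm_rpow_lt_one hq0 hq1 (by linarith : 0 < 2 * α + 2))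
  have hqq := pochInf_ne_zero hp hqn
  have hpp := pochInf_ne_zero hp hp
  obtain ⟨D, hD⟩ := exists_abs_kernel_le hq0 hq1 hα
  obtain ⟨B, hB⟩ := exists_norm_pochInf_mul_pow_le hp q
  set Z := (1 - q) ^ 2 * y ^ 2 with hZ
  set G : ℕ → ℕ → ℝ := fun j n => kernel q α (q ^ j) * (q * (q ^ 2) ^ n) ^ j *
    (eulerCoeff (q ^ 2) n * Z ^ n * pochInf (q * (q ^ 2) ^ n) (q ^ 2) / pochInf q (q ^ 2)) with hG
  have hsum : Summable (Function.uncurry G) := by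
    refine .of_norm (Summable.of_nonneg_of_le (fun _ => norm_nonneg _) (fun x => ?_)
      (((summable_geometric_of_lt_one hq0.le hq1).mul_of_nonneg (summable_norm_eulerCoeff hp Z)
        (fun _ => by positivity) fun _ => norm_nonneg _).mul_left (D * (B / |pochInf q (q ^ 2)|))))
    have hD0 := (abs_nonneg _).trans (hD x.1)
    have hB0 := (norm_nonneg _).trans (hB x.2)
    have h1 : ‖(q * (q ^ 2) ^ x.2) ^ x.1‖ ≤ q ^ x.1 := by
      rw [Real.norm_of_nonneg (by positivity)]
      gcongr
      exact mul_le_of_le_one_right hq0.le (pow_le_one₀ (by positivity) (pow_le_one₀ hq0.le hq1.le))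
    simp only [Function.uncurry, hG]
    calc _ = |kernel q α (q ^ x.1)| * ‖(q * (q ^ 2) ^ x.2) ^ x.1‖ *
          (‖eulerCoeff (q ^ 2) x.2 * Z ^ x.2‖ * ‖pochInf (q * (q ^ 2) ^ x.2) (q ^ 2)‖ /
            |pochInf q (q ^ 2)|) := by
          rw [norm_mul, norm_mul, norm_div, norm_mul (eulerCoeff _ _ * _)]; rfl
      _ ≤ D * q ^ x.1 * (‖eulerCoeff (q ^ 2) x.2 * Z ^ x.2‖ * B / |pochInf q (q ^ 2)|) := by
          gcongr
          · exact hD _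
          · exact hB _
      _ = _ := by ring
  have hrow : ∀ j : ℕ, ∑' n, G j n =
      kernel q α (q ^ j) * q ^ j * qBesselJ q (-1 / 2) (y * q ^ j) := by
    intro j
    rw [qBesselJ_eq_besselPhi hq0 hq1 (by norm_num), show (2 * (-1 / 2) + 2 : ℝ) = 1 by norm_num,
      Real.rpow_one, besselPhi, ← tsum_div_const, ← tsum_mul_left]
    refine tsum_congr fun n => ?_
    simp only [hG, hZ, mul_pow, ← pow_mul, mul_assoc]
    ring
  have hcol : ∀ n : ℕ, ∑' j, G j n = (rlConst q α * (1 - q))⁻¹ *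
      (eulerCoeff (q ^ 2) n * pochInf (q ^ (2 * α + 2) * (q ^ 2) ^ n) (q ^ 2) * Z ^ n /
        pochInf (q ^ (2 * α + 2)) (q ^ 2)) := by
    intro n
    have hs : ‖q * (q ^ 2) ^ n‖ < 1 := norm_mul_pow_lt_one hp hqn n
    have hs0 := pochInf_ne_zero hp hs
    -- The choice `s = q · q^(2n)` makes the denominator `(s; q²)_∞` cancel the factor of the cosine
    -- coefficient; the numerator is the factor `(q^(2α+2+2n); q²)_∞` of `j_α`.
    have h := tsum_binomial hp (q ^ (2 * α + 1)) hs
    rw [← mul_assoc, ← Real.rpow_add_one hq0.ne', show 2 * α + 1 + 1 = 2 * α + 2 by ring] at h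
    have hr := eq_inv_of_mul_eq_one_right (rlConst_mul hq0 hq1 hα)
    simp only [hG, kernel_pow hq0 hq1 hα]
    rw [tsum_mul_right]
    simp only [mul_assoc]
    rw [tsum_mul_left, h, ← hr]
    generalize pochInf (q ^ (2 * α + 2)) (q ^ 2) = c at *
    field_simp
  have h1 : HasSum (fun j => ∑' n, G j n) (∑' x : ℕ × ℕ, G x.1 x.2) :=
    hsum.hasSum.prod_fiberwise fun j => (hsum.prod_factor j).hasSum
  simp only [hrow] at h1
  convert h1 using 1
  have h2 : ∑' x : ℕ × ℕ, G x.1 x.2 = ∑' n, ∑' j, G j n := by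
    rw [hsum.tsum_comm]
    exact hsum.tsum_prod
  rw [h2, tsum_congr hcol, tsum_mul_left, tsum_div_const, qBesselJ_eq_besselPhi hq0 hq1 (by linarith)]
  rfl

end Kernels

/-! ### Intertwining relations for `R_{α,q}` and `W_{α,q}`. -/

section Transforms

variable {q α : ℝ} {m : ℤ}

theorem rlConst_mul_ne_zero (hq0 : 0 < q) (hq1 : q < 1) (hα : -1 / 2 < α) :
    rlConst q α * (1 - q) ≠ 0 :=
  left_ne_zero_of_mul_eq_one (rlConst_mul hq0 hq1 hα)

theorem rpow_cos_weight : q ^ (2 * (-1 / 2 : ℝ) + 2) = q := by norm_num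

theorem rpow_weight_mul (hq0 : 0 < q) (n : ℤ) :
    (q ^ (2 * α + 2)) ^ n = (q ^ (2 * α + 1)) ^ n * q ^ n := by
  rw [← mul_zpow, ← Real.rpow_add_one hq0.ne']
  ring_nf

theorem coe_gridPt (n : ℤ) : ((gridPt q n : Rq q) : ℝ) = q ^ n := rfl

theorem gridPt_mul (hq0 : 0 < q) (k j : ℤ) : gridPt q k * gridPt q j = gridPt q (k + j) := by
  apply Subtype.ext
  simp [coe_gridPt, zpow_add₀ hq0.ne']

theorem riemannLiouville_gridPt (hq0 : 0 < q) (f : Rq q → ℂ) (k : ℤ) :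
    riemannLiouville q α f (gridPt q k) = ((rlConst q α * (1 - q) : ℝ) : ℂ) *
      ∑' j : ℕ, ((kernel q α (q ^ j) * q ^ j : ℝ) : ℂ) * f (gridPt q (k + j)) := by
  rw [riemannLiouville, ← rlConst, jackson0]
  simp only [one_mul, gridPt_mul hq0, coe_gridPt, zpow_natCast]
  push_cast
  rw [mul_one, mul_assoc]
  congr 3
  funext j
  ring

/-- `R_{α,q}` intertwines the `q`-cosine transform and `F_{α,q}`. -/
theorem riemannLiouville_gridFourier (hq0 : 0 < q) (hq1 : q < 1) (hm : 1 - q = q ^ m)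
    (hα : -1 / 2 < α) {h : ℤ → ℂ} (hh : Summable fun n => ‖h n‖ * q ^ n) (k : ℤ) :
    ((kConst q α * q ^ (4 * α + 2) : ℝ) : ℂ) * (((rlConst q α * (1 - q) : ℝ) : ℂ) *
      ∑' j : ℕ, ((kernel q α (q ^ j) * q ^ j : ℝ) : ℂ) *
        gridFourier q (-1 / 2) h (q ^ (k + j))) =
      gridFourier q α (fun n => (((q ^ (2 * α + 1)) ^ (-n) : ℝ) : ℂ) * h n) (q ^ k) := by
  obtain ⟨D, hD⟩ := exists_abs_kernel_le hq0 hq1 hα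
  obtain ⟨B, hB⟩ := exists_abs_bessel_le hq0 hq1 hm (by norm_num : (-1 : ℝ) < -1 / 2)
  set G : ℕ → ℤ → ℂ := fun j n => ((kernel q α (q ^ j) * q ^ j *
    qBesselJ q (-1 / 2) (q ^ k * q ^ n * q ^ j) : ℝ) : ℂ) * (h n * ((q ^ n : ℝ) : ℂ)) with hG
  have hsum : Summable (Function.uncurry G) := by
    refine .of_norm (Summable.of_nonneg_of_le (fun _ => norm_nonneg _) (fun x => ?_)
      (((summable_geometric_of_lt_one hq0.le hq1).mul_of_nonneg hh
        (fun _ => by positivity) fun _ => by positivity).mul_left (D * B)))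
    have hD0 := (abs_nonneg _).trans (hD x.1)
    have h1 : q ^ k * q ^ x.2 * q ^ x.1 = q ^ (k + x.2 + x.1) := by
      rw [zpow_add₀ hq0.ne', zpow_add₀ hq0.ne', zpow_natCast]
    simp only [Function.uncurry, hG, h1, norm_mul, Complex.norm_real]
    rw [Real.norm_of_nonneg (by positivity : 0 ≤ q ^ x.1),
      Real.norm_of_nonneg (by positivity : 0 ≤ q ^ x.2)]
    calc _ ≤ D * q ^ x.1 * B * (‖h x.2‖ * q ^ x.2) := by
          gcongr
          · exact hD _
          · exact hB _
      _ = _ := by ring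
  have hrow : ∀ j : ℕ, ((kernel q α (q ^ j) * q ^ j : ℝ) : ℂ) *
      gridFourier q (-1 / 2) h (q ^ (k + j)) =
      ((cConst q (-1 / 2) * (1 - q) : ℝ) : ℂ) * ∑' n, G j n := by
    intro j
    rw [gridFourier, rpow_cos_weight, mul_left_comm, ← tsum_mul_left]
    congr 1
    refine tsum_congr fun n => ?_
    simp only [hG]
    rw [zpow_add₀ hq0.ne', zpow_natCast, mul_right_comm (q ^ k)]
    push_cast
    ring
  have hcol : ∀ n : ℤ, ∑' j, G j n = (((rlConst q α * (1 - q))⁻¹ : ℝ) : ℂ) *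
      ((((q ^ (2 * α + 1)) ^ (-n) : ℝ) : ℂ) * h n *
        ((qBesselJ q α (q ^ k * q ^ n) * (q ^ (2 * α + 2)) ^ n : ℝ) : ℂ)) := by
    intro n
    simp only [hG]
    rw [tsum_mul_right, ← Complex.ofReal_tsum,
      (hasSum_kernel_mul_cos hq0 hq1 hα (q ^ k * q ^ n)).tsum_eq, rpow_weight_mul hq0, zpow_neg]
    have : (((q ^ (2 * α + 1)) ^ n : ℝ) : ℂ) ≠ 0 :=
      Complex.ofReal_ne_zero.2 (zpow_ne_zero _ (by positivity))
    push_cast at this ⊢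
    field_simp
  have hr := rlConst_mul_ne_zero hq0 hq1 hα
  have hswap : ∑' j, ∑' n, G j n = ∑' n, ∑' j, G j n := hsum.tsum_comm.symm
  rw [tsum_congr hrow, tsum_mul_left, hswap, tsum_congr hcol, tsum_mul_left, gridFourier,
    ← kConst_mul_cConst hq0 hq1 hα]
  have hr' : ((rlConst q α * (1 - q) : ℝ) : ℂ) ≠ 0 := Complex.ofReal_ne_zero.2 hr
  rw [Complex.ofReal_inv]
  push_cast at hr' ⊢
  generalize (rlConst q α : ℂ) * (1 - (q : ℂ)) = r at hr' ⊢
  field_simp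

/-- The transform `W_{α,q}` on sequences. -/
def gridWeyl (q α : ℝ) (u : ℤ → ℂ) (n : ℤ) : ℂ :=
  ((weylConst q α * (1 - q) : ℝ) : ℂ) *
    ∑' i : ℕ, ((kernel q α (q ^ i) : ℝ) : ℂ) *
      (u (n - i) * (((q ^ (2 * α + 1)) ^ (n - i) : ℝ) : ℂ))

theorem kernel_abs (y : ℝ) : kernel q α |y| = kernel q α y := by
  rw [kernel, kernel, sq_abs]

theorem rpow_two_mul_weight (hq0 : 0 < q) (k : ℤ) :
    (q ^ k) ^ (2 * α) * q ^ k = (q ^ (2 * α + 1)) ^ k := by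
  rw [zpow_rpow_comm hq0, ← mul_zpow, ← Real.rpow_add_one hq0.ne']

theorem weyl_of_abs_eq (hq0 : 0 < q) (hq1 : q < 1) (f : Rq q → ℂ) {x : Rq q} {n : ℤ}
    (hx : |(x : ℝ)| = q ^ n) :
    weyl q α f x = gridWeyl q α (fun k => f (gridPt q k)) n := by
  have hinj : Function.Injective fun i : ℕ => n - (i : ℤ) := fun a b h => by simpa using h
  rw [weyl, ← weylConst, gridWeyl, jacksonFrom, jacksonInf, Complex.ofReal_mul, mul_assoc]
  congr 2
  rw [← hinj.tsum_eq]
  · refine tsum_congr fun i => ?_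
    -- The strict lower limit `q |x| = q^(n+1)` retains exactly the exponents `k ≤ n`, so the
    -- endpoint `|x|` is included; these are `k = n - i` with `i` natural.
    have h1 : q * |(x : ℝ)| < (gridPt q (n - (i : ℤ)) : Rq q) := by
      rw [coe_gridPt, hx, ← zpow_one_add₀ hq0.ne', zpow_lt_zpow_iff_right_of_lt_one₀ hq0 hq1]
      omega
    have h2 : |(x : ℝ) / q ^ (n - (i : ℤ))| = q ^ i := by
      rw [abs_div, hx, abs_of_pos (zpow_pos hq0 _), ← zpow_sub₀ hq0.ne', ← zpow_natCast]
      congr 1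
      ring
    rw [if_pos h1, coe_gridPt, ← kernel_abs, h2, ← rpow_two_mul_weight hq0]
    push_cast
    ring
  · intro k hk
    by_contra hne
    apply hk
    have h1 : ¬ q * |(x : ℝ)| < (gridPt q k : Rq q) := by
      rw [coe_gridPt, hx, ← zpow_one_add₀ hq0.ne', zpow_lt_zpow_iff_right_of_lt_one₀ hq0 hq1]
      intro hlt
      exact hne ⟨(n - k).toNat, by simp only; omega⟩
    simp only [if_neg h1, zero_mul]

theorem weyl_zero (hq0 : 0 < q) (f : Rq q → ℂ) {x : Rq q} (hx : (x : ℝ) = 0) :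
    weyl q α f x = ((weylConst q α * (1 - q) : ℝ) : ℂ) *
      ∑' k : ℤ, f (gridPt q k) * (((q ^ (2 * α + 1)) ^ k : ℝ) : ℂ) := by
  rw [weyl, ← weylConst, jacksonFrom, jacksonInf, Complex.ofReal_mul, mul_assoc]
  congr 2
  refine tsum_congr fun k => ?_
  have h1 : q * |(x : ℝ)| < (gridPt q k : Rq q) := by
    rw [coe_gridPt, hx, abs_zero, mul_zero]
    positivity
  rw [if_pos h1, coe_gridPt, hx, zero_div, kernel_zero, ← rpow_two_mul_weight hq0]
  push_cast
  ring

/-- The limit is the value `weyl_zero` at the origin, so the inversion at `0` can be deduced from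
the inversion on the positive grid. -/
theorem tendsto_gridWeyl (hq0 : 0 < q) (hq1 : q < 1) (hα : -1 / 2 < α) {u : ℤ → ℂ}
    (hu : Summable fun n => ‖u n‖ * (q ^ (2 * α + 1)) ^ n) :
    Tendsto (fun n : ℕ => gridWeyl q α u n) atTop
      (𝓝 (((weylConst q α * (1 - q) : ℝ) : ℂ) *
        ∑' k : ℤ, u k * (((q ^ (2 * α + 1)) ^ k : ℝ) : ℂ))) := by
  obtain ⟨D, hD⟩ := exists_abs_kernel_le hq0 hq1 hα
  have hb : 0 < q ^ (2 * α + 1) := by positivity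
  set v : ℤ → ℂ := fun k => u k * (((q ^ (2 * α + 1)) ^ k : ℝ) : ℂ) with hv
  have hvn : Summable fun k => ‖v k‖ := by
    refine hu.congr fun k => ?_
    rw [hv, norm_mul, Complex.norm_real, Real.norm_of_nonneg (by positivity)]
  refine Tendsto.const_mul _ ?_
  -- Indexing by the grid point `k = n - i` makes only the kernel depend on `n`; it tends to `1`,
  -- and dominated convergence applies.
  have hre : ∀ n : ℕ, ∑' i : ℕ, ((kernel q α (q ^ i) : ℝ) : ℂ) *
      (u (n - i) * (((q ^ (2 * α + 1)) ^ ((n : ℤ) - i) : ℝ) : ℂ)) =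
      ∑' k : ℤ, if k ≤ n then ((kernel q α (q ^ (n - k).toNat) : ℝ) : ℂ) * v k else 0 := by
    intro n
    have hinj : Function.Injective fun i : ℕ => (n : ℤ) - (i : ℤ) := fun a b h => by simpa using h
    rw [← hinj.tsum_eq]
    · refine tsum_congr fun i => ?_
      rw [if_pos (by omega), show ((n : ℤ) - (n - i)).toNat = i by omega]
    · intro k hk
      by_contra hne
      apply hk
      simp only
      rw [if_neg]
      intro hle
      exact hne ⟨(n - k).toNat, by simp only; omega⟩
  simp only [hre]
  refine tendsto_tsum_of_dominated_convergence (hvn.mul_left D) (fun k => ?_)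
    (Eventually.of_forall fun n k => ?_)
  · have h1 : Tendsto (fun n : ℕ => (n - k : ℤ).toNat) atTop atTop := by
      refine tendsto_atTop.2 fun N => ?_
      filter_upwards [eventually_ge_atTop (N + k.toNat)] with n hn
      omega
    have h2 : Tendsto (fun n : ℕ => ((kernel q α (q ^ (n - k : ℤ).toNat) : ℝ) : ℂ) * v k) atTop
        (𝓝 (((1 : ℝ) : ℂ) * v k)) :=
      ((Complex.continuous_ofReal.tendsto _).comp
        ((tendsto_kernel_pow hq0 hq1 hα).comp h1)).mul_const _
    rw [Complex.ofReal_one, one_mul] at h2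
    refine h2.congr' ?_
    filter_upwards [eventually_ge_atTop k.toNat] with n hn
    rw [if_pos (by omega)]
  · split_ifs
    · rw [norm_mul, Complex.norm_real]
      gcongr
      exact hD _
    · rw [norm_zero]
      exact mul_nonneg ((abs_nonneg _).trans (hD 0)) (norm_nonneg _)

theorem summable_gridWeyl_double (hq0 : 0 < q) (hq1 : q < 1) (hα : -1 / 2 < α) {u : ℤ → ℂ}
    (hu : Summable fun n => ‖u n‖ * (q ^ (2 * α + 2)) ^ n) :
    Summable fun x : ℤ × ℕ => ‖((kernel q α (q ^ x.2) * q ^ x.1 : ℝ) : ℂ) *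
      (u (x.1 - x.2) * (((q ^ (2 * α + 1)) ^ (x.1 - x.2 : ℤ) : ℝ) : ℂ))‖ := by
  obtain ⟨D, hD⟩ := exists_abs_kernel_le hq0 hq1 hα
  let e : ℤ × ℕ ≃ ℤ × ℕ :=
    ⟨fun x => (x.1 - x.2, x.2), fun x => (x.1 + x.2, x.2), fun x => by simp, fun x => by simp⟩
  have h := (hu.mul_of_nonneg (summable_geometric_of_lt_one hq0.le hq1)
    (fun _ => by positivity) fun _ => by positivity).mul_left D
  refine Summable.of_nonneg_of_le (fun _ => norm_nonneg _) (fun x => ?_) (e.summable_iff.2 h)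
  simp only [Function.comp, e, Equiv.coe_fn_mk, norm_mul, Complex.norm_real]
  rw [Real.norm_of_nonneg (by positivity : 0 ≤ q ^ x.1), rpow_weight_mul hq0,
    Real.norm_of_nonneg (by positivity : 0 ≤ (q ^ (2 * α + 1)) ^ (x.1 - x.2 : ℤ)),
    zpow_sub₀ hq0.ne' x.1, zpow_natCast]
  have h1 : D * (‖u (x.1 - x.2)‖ * ((q ^ (2 * α + 1)) ^ (x.1 - x.2 : ℤ) * (q ^ x.1 / q ^ x.2)) *
      q ^ x.2) = D * q ^ x.1 * (‖u (x.1 - x.2)‖ * (q ^ (2 * α + 1)) ^ (x.1 - x.2 : ℤ)) := by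
    field_simp
  rw [h1]
  gcongr
  exact hD _

theorem summable_gridWeyl (hq0 : 0 < q) (hq1 : q < 1) (hα : -1 / 2 < α) {u : ℤ → ℂ}
    (hu : Summable fun n => ‖u n‖ * (q ^ (2 * α + 2)) ^ n) :
    Summable fun n => ‖gridWeyl q α u n‖ * q ^ n := by
  have h := summable_gridWeyl_double hq0 hq1 hα hu
  refine Summable.of_nonneg_of_le (fun _ => by positivity) (fun n => ?_)
    (h.prod.mul_left |weylConst q α * (1 - q)|)
  have h1 : gridWeyl q α u n * ((q ^ n : ℝ) : ℂ) = ((weylConst q α * (1 - q) : ℝ) : ℂ) *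
      ∑' i : ℕ, ((kernel q α (q ^ i) * q ^ n : ℝ) : ℂ) *
        (u (n - i) * (((q ^ (2 * α + 1)) ^ (n - i : ℤ) : ℝ) : ℂ)) := by
    rw [gridWeyl, mul_assoc, ← tsum_mul_right]
    congr 1
    refine tsum_congr fun i => ?_
    push_cast
    ring
  have h2 : ‖gridWeyl q α u n‖ * q ^ n = ‖gridWeyl q α u n * ((q ^ n : ℝ) : ℂ)‖ := by
    rw [norm_mul, Complex.norm_real, Real.norm_of_nonneg (by positivity : 0 ≤ q ^ n)]
  rw [h2, h1, norm_mul, Complex.norm_real, Real.norm_eq_abs]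
  gcongr
  exact norm_tsum_le_tsum_norm (h.prod_factor n)

/-- `F_{α,q} = F_q ∘ W_{α,q}` on sequences. -/
theorem gridFourier_gridWeyl (hq0 : 0 < q) (hq1 : q < 1) (hm : 1 - q = q ^ m)
    (hα : -1 / 2 < α) {u : ℤ → ℂ} (hu : Summable fun n => ‖u n‖ * (q ^ (2 * α + 2)) ^ n) (l : ℤ) :
    gridFourier q (-1 / 2) (gridWeyl q α u) (q ^ l) = gridFourier q α u (q ^ l) := by
  obtain ⟨B, hB⟩ := exists_abs_bessel_le hq0 hq1 hm (by norm_num : (-1 : ℝ) < -1 / 2)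
  let e : ℤ × ℕ ≃ ℤ × ℕ :=
    ⟨fun x => (x.1 + x.2, x.2), fun x => (x.1 - x.2, x.2), fun x => by simp, fun x => by simp⟩
  set H : ℤ × ℕ → ℂ := fun x => ((kernel q α (q ^ x.2) * q ^ x.1 : ℝ) : ℂ) *
      (u (x.1 - x.2) * (((q ^ (2 * α + 1)) ^ (x.1 - x.2 : ℤ) : ℝ) : ℂ)) *
      ((qBesselJ q (-1 / 2) (q ^ l * q ^ x.1) : ℝ) : ℂ) with hH
  have hsum : Summable H := by
    refine .of_norm (Summable.of_nonneg_of_le (fun _ => norm_nonneg _) (fun x => ?_)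
      ((summable_gridWeyl_double hq0 hq1 hα hu).mul_right B))
    rw [hH, norm_mul, Complex.norm_real, ← zpow_add₀ hq0.ne']
    gcongr
    exact hB _
  have hrow : ∀ n : ℤ, gridWeyl q α u n *
      ((qBesselJ q (-1 / 2) (q ^ l * q ^ n) * q ^ n : ℝ) : ℂ) =
      ((weylConst q α * (1 - q) : ℝ) : ℂ) * ∑' i : ℕ, H (n, i) := by
    intro n
    rw [gridWeyl, mul_assoc, ← tsum_mul_right]
    congr 1
    refine tsum_congr fun i => ?_
    simp only [hH]
    push_cast
    ring
  have hcol : ∀ k : ℤ, ∑' i : ℕ, H (e (k, i)) = (((rlConst q α * (1 - q))⁻¹ : ℝ) : ℂ) *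
      (u k * ((qBesselJ q α (q ^ l * q ^ k) * (q ^ (2 * α + 2)) ^ k : ℝ) : ℂ)) := by
    intro k
    have h1 : ∀ i : ℕ, H (e (k, i)) = ((kernel q α (q ^ i) * q ^ i *
        qBesselJ q (-1 / 2) (q ^ l * q ^ k * q ^ i) : ℝ) : ℂ) *
        (u k * (((q ^ (2 * α + 2)) ^ k : ℝ) : ℂ)) := by
      intro i
      simp only [hH, e, Equiv.coe_fn_mk, add_sub_cancel_right]
      rw [rpow_weight_mul hq0, zpow_add₀ hq0.ne', zpow_natCast, mul_assoc (q ^ l)]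
      push_cast
      ring
    rw [tsum_congr h1, tsum_mul_right, ← Complex.ofReal_tsum,
      (hasSum_kernel_mul_cos hq0 hq1 hα (q ^ l * q ^ k)).tsum_eq]
    push_cast
    ring
  have hswap : ∑' n : ℤ, ∑' i : ℕ, H (n, i) = ∑' k : ℤ, ∑' i : ℕ, H (e (k, i)) := by
    rw [← hsum.tsum_prod, ← e.tsum_eq]
    exact (e.summable_iff.2 hsum).tsum_prod
  rw [gridFourier, rpow_cos_weight, tsum_congr hrow, tsum_mul_left, hswap, tsum_congr hcol,
    tsum_mul_left, gridFourier]
  have hr' : ((rlConst q α * (1 - q) : ℝ) : ℂ) ≠ 0 :=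
    Complex.ofReal_ne_zero.2 (rlConst_mul_ne_zero hq0 hq1 hα)
  have hc : (cConst q (-1 / 2) : ℂ) * weylConst q α = cConst q α * rlConst q α := by
    exact_mod_cast cConst_mul_weylConst hq0 hq1 hα
  rw [Complex.ofReal_inv, ← mul_assoc, ← mul_assoc]
  congr 1
  rw [← div_eq_mul_inv, div_eq_iff hr']
  push_cast
  linear_combination (1 - (q : ℂ)) ^ 2 * hc

end Transforms

/-! ### Membership in `S_{*q}(ℝ_q)`: decay, `q`-differentiability, superposition of dilates. -/

section SchwartzSpace

variable {q α : ℝ} {m : ℤ}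

/-- Decrease faster than every power on the whole line. -/
def RapidDecay (F : ℝ → ℂ) : Prop := ∀ m : ℕ, ∃ C : ℝ, ∀ x : ℝ, (1 + x ^ 2) ^ m * ‖F x‖ ≤ C

theorem RapidDecay.bounded {F : ℝ → ℂ} (hF : RapidDecay F) : ∃ B, ∀ x, ‖F x‖ ≤ B := by
  obtain ⟨C, hC⟩ := hF 0
  exact ⟨C, fun x => by simpa using hC x⟩

/-- Differentiability gives the bound near `0`. For `|x| ≥ δ` the bound `2B` on the difference is at
most `(2B/δ) |x|`. -/
theorem exists_norm_sub_le {F : ℝ → ℂ} (hF : DifferentiableAt ℝ F 0) {B : ℝ}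
    (hB : ∀ x, ‖F x‖ ≤ B) : ∃ L, 0 ≤ L ∧ ∀ x, ‖F x - F 0‖ ≤ L * |x| := by
  obtain ⟨c, hc⟩ := hF.isBigO_sub.bound
  obtain ⟨δ, hδ, hball⟩ := Metric.eventually_nhds_iff.1 hc
  have hB0 := (norm_nonneg _).trans (hB 0)
  refine ⟨|c| + 2 * B / δ, by positivity, fun x => ?_⟩
  rcases lt_or_ge |x| δ with hx | hx
  · have h := hball (y := x) (by simpa using hx)
    rw [sub_zero, Real.norm_eq_abs] at h
    refine h.trans ?_
    gcongr
    have := le_abs_self c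
    have : 0 ≤ 2 * B / δ := by positivity
    linarith
  · have h1 : ‖F x - F 0‖ ≤ 2 * B := by
      linarith [norm_sub_le (F x) (F 0), hB x, hB 0]
    have h2 : 2 * B = 2 * B / δ * δ := by field_simp
    have h3 : 2 * B / δ * δ ≤ 2 * B / δ * |x| := by gcongr
    nlinarith [mul_nonneg (abs_nonneg c) (abs_nonneg x)]

theorem norm_qDeriv_eq (hq1 : q < 1) {F : ℝ → ℂ} {x : ℝ} (hx : x ≠ 0) :
    ‖qDeriv q F x‖ = ‖F x - F (q * x)‖ / ((1 - q) * |x|) := by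
  rw [qDeriv, if_neg hx, norm_div, Complex.norm_real, Real.norm_eq_abs, abs_mul,
    abs_of_pos (sub_pos.2 hq1)]

/-- For `|x| ≤ 1` the Lipschitz bound at `0` compensates the division by `x`; for `|x| ≥ 1` the
decay at `x` and at `qx` suffices. Thus the conditions on all `q`-derivatives reduce to the decay of
the function itself. -/
theorem RapidDecay.qDeriv (hq0 : 0 < q) (hq1 : q < 1) {F : ℝ → ℂ} (hF : RapidDecay F)
    (hd : DifferentiableAt ℝ F 0) : RapidDecay (qDeriv q F) := by
  intro m
  obtain ⟨B, hB⟩ := hF.bounded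
  obtain ⟨L, hL0, hL⟩ := exists_norm_sub_le hd hB
  obtain ⟨C, hC⟩ := hF m
  have hC0 : 0 ≤ C := le_trans (by positivity) (hC 0)
  have h1q : 0 < 1 - q := sub_pos.2 hq1
  refine ⟨‖deriv F 0‖ + 2 ^ m * (2 * L / (1 - q)) + (C + (q⁻¹ ^ 2) ^ m * C) / (1 - q),
    fun x => ?_⟩
  have hA : 0 ≤ ‖deriv F 0‖ := norm_nonneg _
  have hA2 : 0 ≤ 2 ^ m * (2 * L / (1 - q)) := by positivity
  have hA3 : 0 ≤ (C + (q⁻¹ ^ 2) ^ m * C) / (1 - q) := by positivity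
  rcases eq_or_ne x 0 with rfl | hx
  · rw [zero_pow two_ne_zero, add_zero, one_pow, one_mul, QBessel.qDeriv, if_pos rfl]
    linarith
  rw [norm_qDeriv_eq hq1 hx]
  have hx' : 0 < |x| := abs_pos.2 hx
  rcases le_total |x| 1 with h1 | h1
  · have e1 : (1 + x ^ 2) ^ m ≤ 2 ^ m := by
      gcongr
      have := (sq_le_one_iff_abs_le_one x).2 h1
      linarith
    have e2 : ‖F x - F (q * x)‖ ≤ 2 * L * |x| := by
      have a1 := hL x
      have a2 := hL (q * x)
      rw [abs_mul, abs_of_pos hq0] at a2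
      have a3 : ‖F x - F (q * x)‖ ≤ ‖F x - F 0‖ + ‖F (q * x) - F 0‖ := by
        rw [norm_sub_rev (F (q * x))]
        exact norm_sub_le_norm_sub_add_norm_sub _ _ _
      have a4 : L * (q * |x|) ≤ L * |x| := by
        gcongr
        exact mul_le_of_le_one_left hx'.le hq1.le
      linarith
    have e3 : ‖F x - F (q * x)‖ / ((1 - q) * |x|) ≤ 2 * L / (1 - q) := by
      rw [div_le_div_iff₀ (by positivity) h1q]
      nlinarith
    have := mul_le_mul e1 e3 (by positivity) (by positivity)
    linarith
  · have e1 : (1 + x ^ 2) ^ m * ‖F (q * x)‖ ≤ (q⁻¹ ^ 2) ^ m * C := by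
      have a1 : 1 + x ^ 2 ≤ q⁻¹ ^ 2 * (1 + (q * x) ^ 2) := by
        have : q⁻¹ ^ 2 * (1 + (q * x) ^ 2) = q⁻¹ ^ 2 + x ^ 2 := by field_simp
        rw [this]
        have : 1 ≤ q⁻¹ ^ 2 := one_le_pow₀ (one_le_inv₀ hq0 |>.2 hq1.le)
        linarith
      calc _ ≤ (q⁻¹ ^ 2 * (1 + (q * x) ^ 2)) ^ m * ‖F (q * x)‖ := by gcongr
        _ = (q⁻¹ ^ 2) ^ m * ((1 + (q * x) ^ 2) ^ m * ‖F (q * x)‖) := by rw [mul_pow]; ring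
        _ ≤ _ := by gcongr; exact hC _
    have e2 : (1 + x ^ 2) ^ m * ‖F x - F (q * x)‖ ≤ C + (q⁻¹ ^ 2) ^ m * C := by
      calc _ ≤ (1 + x ^ 2) ^ m * (‖F x‖ + ‖F (q * x)‖) := by gcongr; exact norm_sub_le _ _
        _ ≤ _ := by linarith [hC x]
    have e3 : (1 + x ^ 2) ^ m * (‖F x - F (q * x)‖ / ((1 - q) * |x|)) ≤
        (C + (q⁻¹ ^ 2) ^ m * C) / (1 - q) := by
      rw [← mul_div_assoc]
      exact div_le_div₀ (by positivity) e2 h1q (le_mul_of_one_le_right h1q.le h1)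
    linarith

theorem InfQDiff.qDeriv {F : ℝ → ℂ} (hF : InfQDiff q F) : InfQDiff q (qDeriv q F) := fun k => by
  simpa only [Function.iterate_succ_apply] using hF (k + 1)

theorem InfQDiff.differentiableAt {F : ℝ → ℂ} (hF : InfQDiff q F) : DifferentiableAt ℝ F 0 := hF 0

theorem RapidDecay.iterate_qDeriv (hq0 : 0 < q) (hq1 : q < 1) {F : ℝ → ℂ} (hF : RapidDecay F)
    (hd : InfQDiff q F) (k : ℕ) : RapidDecay ((QBessel.qDeriv q)^[k] F) := by
  induction k with
  | zero => exact hF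
  | succ k ih =>
    rw [Function.iterate_succ_apply']
    exact ih.qDeriv hq0 hq1 (hd k)

theorem mem_qSchwartz_of_rapidDecay (hq0 : 0 < q) (hq1 : q < 1) {F : ℝ → ℂ}
    (heven : ∀ x, F (-x) = F x) (hd : InfQDiff q F) (hF : RapidDecay F) {f : Rq q → ℂ}
    (hf : ∀ x : Rq q, f x = F x) : f ∈ qSchwartz q := by
  refine ⟨F, heven, hd, fun k m => ?_, hf⟩
  obtain ⟨C, hC⟩ := hF.iterate_qDeriv hq0 hq1 hd k m
  refine ⟨C, fun x => ?_⟩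
  rw [norm_mul, Complex.norm_real, Real.norm_of_nonneg (by positivity)]
  exact hC x

theorem exists_rapidDecay_of_mem_qSchwartz {f : Rq q → ℂ} (hf : f ∈ qSchwartz q) :
    ∃ F : ℝ → ℂ, (∀ x, F (-x) = F x) ∧ InfQDiff q F ∧ RapidDecay F ∧ ∀ x : Rq q, f x = F x := by
  obtain ⟨F, heven, hd, hF, hfF⟩ := hf
  refine ⟨F, heven, hd, fun m => ?_, hfF⟩
  obtain ⟨C, hC⟩ := hF 0 m
  refine ⟨C, fun x => ?_⟩
  have := hC x
  rwa [norm_mul, Complex.norm_real, Real.norm_of_nonneg (by positivity)] at this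

/-- Infinite `q`-differentiability is a condition on the germ at `0`, so a function may be altered
away from `0`. -/
theorem qDeriv_eventuallyEq {F G : ℝ → ℂ} (h : F =ᶠ[𝓝 0] G) :
    qDeriv q F =ᶠ[𝓝 0] qDeriv q G := by
  have h1 : Tendsto (fun x : ℝ => q * x) (𝓝 0) (𝓝 0) := by
    simpa using (continuous_const_mul q).tendsto 0
  filter_upwards [h, h1.eventually h] with x hx hqx
  rw [qDeriv, qDeriv, h.deriv_eq, hx, hqx]

/-- The `q`-derivative is the divided difference at `0` of `(F(x) - F(qx)) / (1 - q)`, including the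
value `F'(0)` at the origin. -/
theorem analyticAt_qDeriv (hq1 : q < 1) {F : ℝ → ℂ} (hF : AnalyticAt ℝ F 0) :
    AnalyticAt ℝ (qDeriv q F) 0 := by
  have hlin : AnalyticAt ℝ (fun x : ℝ => q * x) 0 := by fun_prop
  have hFq : AnalyticAt ℝ (fun x : ℝ => F (q * x)) 0 :=
    AnalyticAt.comp_of_eq (g := F) (f := fun x => q * x) hF hlin (by simp)
  have hG : AnalyticAt ℝ (fun x => (F x - F (q * x)) / ((1 - q : ℝ) : ℂ)) 0 :=
    (hF.sub hFq).div_const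
  obtain ⟨p, hp⟩ := hG
  have hd := hp.has_fpower_series_dslope_fslope.analyticAt
  suffices heq : qDeriv q F = dslope (fun x => (F x - F (q * x)) / ((1 - q : ℝ) : ℂ)) 0 by
    rwa [heq]
  funext x
  have h1q : ((1 - q : ℝ) : ℂ) ≠ 0 := Complex.ofReal_ne_zero.2 (sub_pos.2 hq1).ne'
  rcases eq_or_ne x 0 with rfl | hx
  · rw [qDeriv, if_pos rfl, dslope_same]
    have h0 : HasDerivAt F (deriv F 0) 0 := hF.differentiableAt.hasDerivAt
    have h1 : HasDerivAt (fun x : ℝ => F (q * x)) (q • deriv F 0) 0 := by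
      have h0' : HasDerivAt F (deriv F 0) (q * 0) := by rwa [mul_zero]
      have h := h0'.scomp (0 : ℝ) ((hasDerivAt_id (0 : ℝ)).const_mul q)
      rwa [mul_one] at h
    have h2 : HasDerivAt (fun x => (F x - F (q * x)) / ((1 - q : ℝ) : ℂ))
        ((deriv F 0 - q • deriv F 0) / ((1 - q : ℝ) : ℂ)) 0 := (h0.sub h1).div_const _
    rw [h2.deriv, eq_div_iff h1q, Complex.real_smul]
    push_cast
    ring
  · rw [qDeriv, if_neg hx, dslope_of_ne _ hx, slope_def_module, mul_zero, sub_self, zero_div,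
      sub_zero, sub_zero, Complex.real_smul]
    push_cast
    field_simp

theorem infQDiff_of_analyticAt (hq1 : q < 1) {F G : ℝ → ℂ} (hF : AnalyticAt ℝ F 0)
    (h : G =ᶠ[𝓝 0] F) : InfQDiff q G := by
  have : ∀ k : ℕ, AnalyticAt ℝ ((qDeriv q)^[k] F) 0 ∧ (qDeriv q)^[k] G =ᶠ[𝓝 0] (qDeriv q)^[k] F := by
    intro k
    induction k with
    | zero => exact ⟨hF, h⟩
    | succ k ih =>
      rw [Function.iterate_succ_apply', Function.iterate_succ_apply']
      exact ⟨analyticAt_qDeriv hq1 ih.1, qDeriv_eventuallyEq ih.2⟩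
  intro k
  exact (this k).1.differentiableAt.congr_of_eventuallyEq (this k).2

section Superposition

variable {H : ℝ → ℂ} {a : ℤ → ℂ}

theorem summable_mul_dilate {B : ℝ} (hB : ∀ x, ‖H x‖ ≤ B) (ha : Summable fun n => ‖a n‖) (x : ℝ) :
    Summable fun n : ℤ => a n * H (x * q ^ n) := by
  refine .of_norm (Summable.of_nonneg_of_le (fun _ => norm_nonneg _) (fun n => ?_) (ha.mul_right B))
  rw [norm_mul]
  gcongr
  exact hB _

theorem hasDerivAt_superposition (hq0 : 0 < q) {B : ℝ} (hB : ∀ x, ‖H x‖ ≤ B)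
    (hH : DifferentiableAt ℝ H 0) (ha : Summable fun n => ‖a n‖)
    (ha1 : Summable fun n => ‖a n‖ * q ^ n) :
    HasDerivAt (fun x => ∑' n : ℤ, a n * H (x * q ^ n))
      (∑' n : ℤ, a n * ((q ^ n : ℝ) : ℂ) * deriv H 0) 0 := by
  obtain ⟨L, hL0, hL⟩ := exists_norm_sub_le hH hB
  rw [hasDerivAt_iff_tendsto_slope]
  have hterm : ∀ x : ℝ, slope (fun x => ∑' n : ℤ, a n * H (x * q ^ n)) 0 x =
      ∑' n : ℤ, a n * slope (fun x => H (x * q ^ n)) 0 x := by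
    intro x
    rw [slope_def_module, ← (summable_mul_dilate hB ha x).tsum_sub (summable_mul_dilate hB ha 0),
      ← tsum_const_smul'']
    refine tsum_congr fun n => ?_
    rw [slope_def_module, mul_smul_comm, mul_sub]
  simp only [funext hterm]
  refine tendsto_tsum_of_dominated_convergence (ha1.mul_right L) (fun n => ?_) ?_
  · have h0 : HasDerivAt H (deriv H 0) (0 * q ^ n) := by
      rw [zero_mul]
      exact hH.hasDerivAt
    have h1 : HasDerivAt (fun x : ℝ => H (x * q ^ n)) ((q ^ n) • deriv H 0) 0 := by
      have h := h0.scomp (0 : ℝ) ((hasDerivAt_id (0 : ℝ)).mul_const (q ^ n))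
      rwa [one_mul] at h
    have h2 := h1.tendsto_slope.const_mul (a n)
    rwa [Complex.real_smul, ← mul_assoc] at h2
  · filter_upwards [self_mem_nhdsWithin] with x hx n
    have hx' : 0 < |x| := abs_pos.2 hx
    rw [norm_mul, slope_def_module, norm_smul, zero_mul, sub_zero, norm_inv, Real.norm_eq_abs,
      mul_assoc]
    refine mul_le_mul_of_nonneg_left ?_ (norm_nonneg _)
    rw [inv_mul_le_iff₀ hx']
    refine (hL _).trans (le_of_eq ?_)
    rw [abs_mul, abs_of_pos (zpow_pos hq0 n)]
    ring

/-- A `q`-derivative multiplies the coefficients by `q^n` and replaces `H` by its `q`-derivative.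
Coefficients decreasing fast at both ends remain so, which is what lets the induction on the order
of the derivative run. -/
theorem qDeriv_superposition (hq0 : 0 < q) {B : ℝ} (hB : ∀ x, ‖H x‖ ≤ B)
    (hH : DifferentiableAt ℝ H 0) (ha : Summable fun n => ‖a n‖)
    (ha1 : Summable fun n => ‖a n‖ * q ^ n) :
    qDeriv q (fun x => ∑' n : ℤ, a n * H (x * q ^ n)) =
      fun x => ∑' n : ℤ, a n * ((q ^ n : ℝ) : ℂ) * qDeriv q H (x * q ^ n) := by
  funext x
  rcases eq_or_ne x 0 with rfl | hx
  · simp only [qDeriv, if_true, zero_mul]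
    rw [(hasDerivAt_superposition hq0 hB hH ha ha1).deriv]
  · rw [qDeriv, if_neg hx, ← (summable_mul_dilate hB ha x).tsum_sub (summable_mul_dilate hB ha _),
      ← tsum_div_const]
    refine tsum_congr fun n => ?_
    have hqn := zpow_pos hq0 n
    rw [qDeriv, if_neg (mul_ne_zero hx hqn.ne'), ← mul_assoc q x]
    have : ((q ^ n : ℝ) : ℂ) ≠ 0 := Complex.ofReal_ne_zero.2 hqn.ne'
    have : (x : ℂ) ≠ 0 := Complex.ofReal_ne_zero.2 hx
    push_cast at *
    generalize H (x * q ^ n) = u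
    generalize H (q * (x * q ^ n)) = v
    field_simp

theorem infQDiff_superposition (hq0 : 0 < q) (hq1 : q < 1) (hH : RapidDecay H) (hd : InfQDiff q H)
    (ha : ∀ s : ℝ, 0 < s → Summable fun n => ‖a n‖ * s ^ n) :
    InfQDiff q (fun x => ∑' n : ℤ, a n * H (x * q ^ n)) := by
  intro k
  induction k generalizing a H with
  | zero =>
    obtain ⟨B, hB⟩ := hH.bounded
    exact (hasDerivAt_superposition hq0 hB hd.differentiableAt (by simpa using ha 1 one_pos)
      (ha q hq0)).differentiableAt
  | succ k ih =>
    obtain ⟨B, hB⟩ := hH.bounded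
    rw [Function.iterate_succ_apply, qDeriv_superposition hq0 hB hd.differentiableAt
      (by simpa using ha 1 one_pos) (ha q hq0)]
    refine ih (hH.qDeriv hq0 hq1 hd.differentiableAt) hd.qDeriv fun s hs => ?_
    refine (ha (q * s) (mul_pos hq0 hs)).congr fun n => ?_
    rw [norm_mul, Complex.norm_real, Real.norm_of_nonneg (zpow_pos hq0 n).le, mul_zpow, mul_assoc]

/-- The inequality `1 + x² ≤ (1 + q^(-2n)) (1 + (x q^n)²)` moves the weight onto `H(x q^n)`, at the
cost of a power of `q^(-n)` that the coefficients absorb. -/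
theorem rapidDecay_superposition (hq0 : 0 < q) (hH : RapidDecay H)
    (ha : ∀ s : ℝ, 0 < s → Summable fun n => ‖a n‖ * s ^ n) :
    RapidDecay (fun x => ∑' n : ℤ, a n * H (x * q ^ n)) := by
  intro m
  obtain ⟨B, hB⟩ := hH.bounded
  obtain ⟨C, hC⟩ := hH m
  have hC0 : 0 ≤ C := le_trans (by positivity) (hC 0)
  have h1 : Summable fun n => ‖a n‖ := by simpa using ha 1 one_pos
  have hw : Summable fun n : ℤ => ‖a n‖ * (1 + ((q ^ n)⁻¹) ^ 2) ^ m * C := by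
    refine Summable.mul_right _ ?_
    refine Summable.of_nonneg_of_le (fun n => by positivity) (fun n => ?_)
      ((h1.add (ha (q⁻¹ ^ (2 * m)) (by positivity))).mul_left (2 ^ (m - 1)))
    have := add_pow_le zero_le_one (by positivity : 0 ≤ ((q ^ n)⁻¹) ^ 2) m
    calc _ ≤ ‖a n‖ * (2 ^ (m - 1) * (1 ^ m + (((q ^ n)⁻¹) ^ 2) ^ m)) := by gcongr
      _ = _ := by
        have : (((q ^ n)⁻¹) ^ 2) ^ m = (q⁻¹ ^ (2 * m)) ^ n := by
          rw [← pow_mul, ← inv_zpow, ← zpow_natCast, ← zpow_natCast, ← zpow_mul, ← zpow_mul, mul_comm]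
        rw [this, one_pow]
        ring
  refine ⟨∑' n : ℤ, ‖a n‖ * (1 + ((q ^ n)⁻¹) ^ 2) ^ m * C, fun x => ?_⟩
  have hle : ∀ n : ℤ, ‖((1 + x ^ 2) ^ m : ℝ) * (a n * H (x * q ^ n))‖ ≤
      ‖a n‖ * (1 + ((q ^ n)⁻¹) ^ 2) ^ m * C := by
    intro n
    have hqn := zpow_pos hq0 n
    have e1 : 1 + x ^ 2 ≤ (1 + ((q ^ n)⁻¹) ^ 2) * (1 + (x * q ^ n) ^ 2) := by
      have : (1 + ((q ^ n)⁻¹) ^ 2) * (1 + (x * q ^ n) ^ 2) =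
          1 + x ^ 2 + ((q ^ n)⁻¹) ^ 2 + (x * q ^ n) ^ 2 := by field_simp; ring
      rw [this]
      nlinarith [sq_nonneg ((q ^ n)⁻¹), sq_nonneg (x * q ^ n)]
    rw [norm_mul, norm_mul, Complex.norm_real, Real.norm_of_nonneg (by positivity)]
    calc _ ≤ ((1 + ((q ^ n)⁻¹) ^ 2) * (1 + (x * q ^ n) ^ 2)) ^ m * (‖a n‖ * ‖H (x * q ^ n)‖) := by
          gcongr
      _ = ‖a n‖ * (1 + ((q ^ n)⁻¹) ^ 2) ^ m * ((1 + (x * q ^ n) ^ 2) ^ m * ‖H (x * q ^ n)‖) := by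
          rw [mul_pow]; ring
      _ ≤ _ := by gcongr; exact hC _
  have hs := Summable.of_nonneg_of_le (fun _ => norm_nonneg _) hle hw
  calc _ = ‖((1 + x ^ 2) ^ m : ℝ) * ∑' n : ℤ, a n * H (x * q ^ n)‖ := by
        rw [norm_mul, Complex.norm_real, Real.norm_of_nonneg (by positivity)]
    _ ≤ _ := by
        rw [← tsum_mul_left]
        exact (norm_tsum_le_tsum_norm hs).trans (hs.tsum_le_tsum hle hw)

end Superposition

theorem analyticAt_tsum_mul_pow {a : ℕ → ℝ} {R : ℝ} (hR : 0 < R)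
    (ha : Summable fun n => ‖a n * R ^ n‖) : AnalyticAt ℝ (fun x => ∑' n, a n * x ^ n) 0 := by
  refine ⟨FormalMultilinearSeries.ofScalars ℝ a, hasFPowerSeriesAt_iff.2 ?_⟩
  filter_upwards [Metric.ball_mem_nhds (0 : ℝ) hR] with z hz
  have hz' : |z| < R := by simpa using hz
  rw [zero_add]
  have hs : Summable fun n => a n * z ^ n := by
    refine .of_norm (Summable.of_nonneg_of_le (fun _ => norm_nonneg _) (fun n => ?_) ha)
    rw [norm_mul, norm_mul, norm_pow, norm_pow, Real.norm_of_nonneg hR.le, Real.norm_eq_abs z]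
    gcongr
  refine hs.hasSum.congr_fun fun n => ?_
  rw [FormalMultilinearSeries.coeff_ofScalars, smul_eq_mul, mul_comm]

theorem analyticAt_qBesselJ (hq0 : 0 < q) (hq1 : q < 1) (hα : -1 < α) :
    AnalyticAt ℝ (fun y : ℝ => ((qBesselJ q α y : ℝ) : ℂ)) 0 := by
  have hp := norm_sq_lt_one hq0 hq1
  have h1 : AnalyticAt ℝ (fun z : ℝ => besselPhi (q ^ 2) (q ^ (2 * α + 2)) z) 0 := by
    refine analyticAt_tsum_mul_pow one_pos ?_
    obtain ⟨D, hD⟩ := exists_norm_pochInf_mul_pow_le hp (q ^ (2 * α + 2))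
    refine Summable.of_nonneg_of_le (fun _ => norm_nonneg _) (fun n => ?_)
      ((summable_norm_eulerCoeff hp 1).mul_left D)
    rw [one_pow, mul_one, mul_one, norm_mul, mul_comm]
    gcongr
    exact hD n
  have h2 : AnalyticAt ℝ (fun y : ℝ => (1 - q) ^ 2 * y ^ 2) 0 := by fun_prop
  have h3 : AnalyticAt ℝ (fun y : ℝ => qBesselJ q α y) 0 := by
    simp only [qBesselJ_eq_besselPhi hq0 hq1 hα]
    exact (h1.comp_of_eq h2 (by simp)).div_const
  exact (Complex.ofRealCLM.analyticAt _).comp h3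

/-- The `q`-Bessel function cut off away from the grid, where it would grow. -/
def besselCut (q α : ℝ) (y : ℝ) : ℂ :=
  open Classical in if |y| ≤ 1 ∨ y ∈ Rq q then ((qBesselJ q α y : ℝ) : ℂ) else 0

theorem besselCut_of_mem {y : ℝ} (hy : y ∈ Rq q) :
    besselCut q α y = ((qBesselJ q α y : ℝ) : ℂ) := by
  rw [besselCut, if_pos (Or.inr hy)]

theorem neg_mem_Rq {y : ℝ} (hy : y ∈ Rq q) : -y ∈ Rq q := by
  rcases hy with h | ⟨n, h | h⟩
  · exact Or.inl (by simp [h])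
  · exact Or.inr ⟨n, Or.inr (by rw [h])⟩
  · exact Or.inr ⟨n, Or.inl (by rw [h, neg_neg])⟩

theorem besselCut_neg (y : ℝ) : besselCut q α (-y) = besselCut q α y := by
  have h : -y ∈ Rq q ↔ y ∈ Rq q := ⟨fun h => neg_neg y ▸ neg_mem_Rq h, neg_mem_Rq⟩
  unfold besselCut
  rw [abs_neg, qBesselJ_neg]
  by_cases hc : |y| ≤ 1 ∨ y ∈ Rq q
  · rw [if_pos hc, if_pos (by rwa [h])]
  · rw [if_neg hc, if_neg (by rwa [h])]

theorem infQDiff_besselCut (hq0 : 0 < q) (hq1 : q < 1) (hα : -1 < α) :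
    InfQDiff q (besselCut q α) := by
  refine infQDiff_of_analyticAt hq1 (analyticAt_qBesselJ hq0 hq1 hα) ?_
  filter_upwards [Metric.ball_mem_nhds (0 : ℝ) one_pos] with y hy
  have : |y| < 1 := by simpa using hy
  rw [besselCut, if_pos (Or.inl this.le)]

theorem rapidDecay_besselCut (hq0 : 0 < q) (hq1 : q < 1) (hm : 1 - q = q ^ m) (hα : -1 < α) :
    RapidDecay (besselCut q α) := by
  intro N
  obtain ⟨B, hB⟩ := exists_abs_besselPhi_le (norm_sq_lt_one hq0 hq1) (q ^ (2 * α + 2)) ((1 - q) ^ 2)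
  have hB0 : 0 ≤ B := (abs_nonneg _).trans (hB 0 (by rw [abs_zero]; positivity))
  -- The exponent `2N + 1` instead of `2N` keeps the base below `1` also for `N = 0`; where it is
  -- used `q^n > 1`, so the extra factor is harmless.
  have hs := summable_zpow_mul_bessel hq0 hq1 hm hα (by positivity : 0 < q ^ (2 * N + 1))
    (pow_lt_one₀ hq0.le hq1 (by omega))
  set T := ∑' n : ℤ, (q ^ (2 * N + 1)) ^ n * |qBesselJ q α (q ^ n)| with hT
  have hT0 : 0 ≤ T := tsum_nonneg fun n => by positivity
  have hle : ∀ y : ℝ, |y| ≤ 1 → |qBesselJ q α y| ≤ B / |pochInf (q ^ (2 * α + 2)) (q ^ 2)| := by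
    intro y hy
    rw [qBesselJ_eq_besselPhi hq0 hq1 hα, abs_div]
    gcongr
    apply hB
    rw [abs_of_nonneg (by positivity)]
    exact mul_le_of_le_one_right (by positivity) ((sq_le_one_iff_abs_le_one y).2 hy)
  refine ⟨2 ^ N * (B / |pochInf (q ^ (2 * α + 2)) (q ^ 2)|) + 2 ^ N * T, fun y => ?_⟩
  have hA : 0 ≤ 2 ^ N * (B / |pochInf (q ^ (2 * α + 2)) (q ^ 2)|) := by positivity
  have hA2 : 0 ≤ 2 ^ N * T := by positivity
  rcases le_or_gt |y| 1 with hy | hy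
  · rw [besselCut, if_pos (Or.inl hy), Complex.norm_real]
    have e1 : (1 + y ^ 2) ^ N ≤ 2 ^ N := by
      gcongr
      have := (sq_le_one_iff_abs_le_one y).2 hy
      linarith
    have := mul_le_mul e1 (hle y hy) (abs_nonneg _) (by positivity)
    rw [Real.norm_eq_abs]
    linarith
  by_cases hyq : y ∈ Rq q
  · rw [besselCut_of_mem hyq, Complex.norm_real, Real.norm_eq_abs]
    obtain ⟨n, hn⟩ : ∃ n : ℤ, |y| = q ^ n := by
      rcases hyq with h | ⟨n, h | h⟩
      · simp [h] at hy
        linarith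
      · exact ⟨n, by rw [h, abs_of_pos (zpow_pos hq0 n)]⟩
      · exact ⟨n, by rw [h, abs_neg, abs_of_pos (zpow_pos hq0 n)]⟩
    have hJ : qBesselJ q α y = qBesselJ q α (q ^ n) := by
      rw [← hn]
      rcases abs_choice y with h | h <;> rw [h]
      rw [qBesselJ_neg]
    have hy2 : y ^ 2 = (q ^ n) ^ 2 := by rw [← hn, sq_abs]
    rw [hn] at hy
    have e1 : (1 + y ^ 2) ^ N ≤ 2 ^ N * (q ^ (2 * N + 1)) ^ n := by
      have a1 : 1 ≤ (q ^ n) ^ 2 := one_le_pow₀ hy.le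
      calc (1 + y ^ 2) ^ N ≤ (2 * (q ^ n) ^ 2) ^ N := by
            gcongr
            linarith
        _ = 2 ^ N * (q ^ n) ^ (2 * N) := by rw [mul_pow, ← pow_mul]
        _ ≤ 2 ^ N * (q ^ n) ^ (2 * N + 1) := by
            gcongr
            · exact hy.le
            · omega
        _ = _ := by
            rw [← zpow_natCast (q ^ n), ← zpow_natCast q, ← zpow_mul, ← zpow_mul, mul_comm n]
    have e2 := hs.le_tsum n fun _ _ => by positivity
    rw [← hT] at e2
    rw [hJ]
    have := mul_le_mul_of_nonneg_right e1 (abs_nonneg (qBesselJ q α (q ^ n)))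
    nlinarith [mul_le_mul_of_nonneg_left e2 (by positivity : (0 : ℝ) ≤ 2 ^ N)]
  · rw [besselCut, if_neg (by rw [not_or, not_le]; exact ⟨hy, hyq⟩), norm_zero, mul_zero]
    linarith

/-- The transform of a sequence that decreases fast at both ends belongs to `S_{*q}(ℝ_q)`. -/
theorem gridFourier_mem_qSchwartz (hq0 : 0 < q) (hq1 : q < 1) (hm : 1 - q = q ^ m) (hα : -1 < α)
    {a : ℤ → ℂ} (ha : ∀ s : ℝ, 0 < s → Summable fun n => ‖a n‖ * s ^ n) :
    (fun x : Rq q => gridFourier q α a x) ∈ qSchwartz q := by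
  set b : ℤ → ℂ := fun n => ((cConst q α * (1 - q) : ℝ) : ℂ) *
    (a n * (((q ^ (2 * α + 2)) ^ n : ℝ) : ℂ)) with hb
  have hbs : ∀ s : ℝ, 0 < s → Summable fun n => ‖b n‖ * s ^ n := by
    intro s hs
    have h0 : 0 < q ^ (2 * α + 2) := by positivity
    refine ((ha (q ^ (2 * α + 2) * s) (by positivity)).mul_left
      |cConst q α * (1 - q)|).congr fun n => ?_
    rw [hb, norm_mul, norm_mul, Complex.norm_real, Complex.norm_real, Real.norm_eq_abs,
      Real.norm_of_nonneg (zpow_pos h0 n).le, mul_zpow]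
    ring
  have hr := rapidDecay_besselCut hq0 hq1 hm hα
  have hi := infQDiff_besselCut (α := α) hq0 hq1 hα
  refine mem_qSchwartz_of_rapidDecay hq0 hq1 (F := fun x => ∑' n : ℤ, b n * besselCut q α (x * q ^ n))
    (fun x => ?_) (infQDiff_superposition hq0 hq1 hr hi hbs) (rapidDecay_superposition hq0 hr hbs)
    fun x => ?_
  · simp only [neg_mul, besselCut_neg]
  · rw [gridFourier, ← tsum_mul_left]
    refine tsum_congr fun n => ?_
    have hx : (x : ℝ) * q ^ n ∈ Rq q := (x * gridPt q n).2
    rw [besselCut_of_mem hx, hb]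
    push_cast
    ring

end SchwartzSpace

/-! ### Taylor expansion of `q`-differentiable functions at `0`. -/

section Taylor

variable {q α : ℝ} {m : ℤ}

theorem qDeriv_mul (hq1 : q < 1) (F : ℝ → ℂ) (x : ℝ) :
    ((1 - q : ℝ) : ℂ) * x * qDeriv q F x = F x - F (q * x) := by
  rcases eq_or_ne x 0 with rfl | hx
  · simp
  · have h1 : ((1 - q : ℝ) : ℂ) ≠ 0 := Complex.ofReal_ne_zero.2 (sub_pos.2 hq1).ne'
    have h2 : (x : ℂ) ≠ 0 := Complex.ofReal_ne_zero.2 hx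
    rw [qDeriv, if_neg hx, Complex.ofReal_mul]
    field_simp

/-- Taylor expansion at `0` of infinitely `q`-differentiable functions. -/
theorem exists_qTaylor (hq0 : 0 < q) (hq1 : q < 1) (N : ℕ) {F : ℝ → ℂ} (hF : InfQDiff q F) :
    ∃ (a : ℕ → ℂ) (C δ : ℝ), 0 < δ ∧ 0 ≤ C ∧ ∀ x : ℝ, |x| < δ →
      ‖F x - ∑ i ∈ Finset.range N, a i * (x : ℂ) ^ i‖ ≤ C * |x| ^ N := by
  induction N generalizing F with
  | zero =>
    obtain ⟨δ, hδ, h⟩ := Metric.continuousAt_iff.1 hF.differentiableAt.continuousAt 1 one_pos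
    refine ⟨fun _ => 0, ‖F 0‖ + 1, δ, hδ, by positivity, fun x hx => ?_⟩
    have h1 := h (x := x) (by simpa using hx)
    rw [dist_eq_norm] at h1
    have h2 := norm_sub_norm_le (F x) (F 0)
    simp only [Finset.range_zero, Finset.sum_empty, sub_zero, pow_zero, mul_one]
    linarith
  | succ N ih =>
    obtain ⟨a, C, δ, hδ, hC, ha⟩ := ih hF.qDeriv
    -- The `q`-derivative of `x^n` is `(1 - q^n)/(1 - q) x^(n-1)`, so these coefficients are a
    -- formal `q`-antiderivative of the expansion of `D_q F`.
    set b : ℕ → ℂ := fun n => if n = 0 then F 0 else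
      a (n - 1) * ((1 - q : ℝ) : ℂ) / ((1 - q ^ n : ℝ) : ℂ) with hb
    set G : ℝ → ℂ := fun x => F x - ∑ i ∈ Finset.range (N + 1), b i * (x : ℂ) ^ i with hG
    refine ⟨b, C, δ, hδ, hC, fun x hx => ?_⟩
    have hstep : ∀ y : ℝ, G y - G (q * y) = ((1 - q : ℝ) : ℂ) * y *
        (qDeriv q F y - ∑ i ∈ Finset.range N, a i * (y : ℂ) ^ i) := by
      intro y
      rw [mul_sub, qDeriv_mul hq1, Finset.mul_sum]
      have hsum : ∑ i ∈ Finset.range N, ((1 - q : ℝ) : ℂ) * y * (a i * (y : ℂ) ^ i) =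
          ∑ i ∈ Finset.range (N + 1), b i * (y : ℂ) ^ i -
            ∑ i ∈ Finset.range (N + 1), b i * ((q * y : ℝ) : ℂ) ^ i := by
        rw [← Finset.sum_sub_distrib, Finset.sum_range_succ']
        simp only [pow_zero, sub_self, add_zero]
        refine Finset.sum_congr rfl fun i _ => ?_
        have h1 : ((1 - q ^ (i + 1) : ℝ) : ℂ) ≠ 0 := Complex.ofReal_ne_zero.2
          (sub_pos.2 (pow_lt_one₀ hq0.le hq1 (by omega))).ne'
        simp only [hb, Nat.add_eq_zero_iff, one_ne_zero, and_false, if_false, Nat.add_sub_cancel]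
        have h2 : (y : ℂ) ^ (i + 1) - ((q * y : ℝ) : ℂ) ^ (i + 1) =
            ((1 - q ^ (i + 1) : ℝ) : ℂ) * (y * (y : ℂ) ^ i) := by
          push_cast
          ring
        rw [← mul_sub, h2]
        field_simp
      rw [hsum]
      simp only [hG]
      ring
    -- The differences along `x, qx, q²x, …` telescope, with weights `q^k - q^(k+1)` summing to `1 -
    -- q^k`. The constant `C` is therefore unchanged, and continuity of `G` at `0` gives the limit
    -- `k → ∞`.
    have hbound : ∀ k : ℕ, ‖G x - G (q ^ k * x)‖ ≤ C * |x| ^ (N + 1) * (1 - q ^ k) := by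
      intro k
      induction k with
      | zero => simp
      | succ k ihk =>
        have hqk : q ^ k ≤ 1 := pow_le_one₀ hq0.le hq1.le
        have hle : |q ^ k * x| ≤ |x| := by
          rw [abs_mul, abs_of_pos (pow_pos hq0 k)]
          exact mul_le_of_le_one_left (abs_nonneg _) hqk
        have h1 : ‖G (q ^ k * x) - G (q ^ (k + 1) * x)‖ ≤
            C * |x| ^ (N + 1) * (q ^ k - q ^ (k + 1)) := by
          have h2 := ha (q ^ k * x) (hle.trans_lt hx)
          rw [show q ^ (k + 1) * x = q * (q ^ k * x) by ring, hstep, norm_mul, norm_mul,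
            Complex.norm_real, Complex.norm_real, Real.norm_of_nonneg (sub_pos.2 hq1).le,
            Real.norm_eq_abs]
          calc _ ≤ (1 - q) * |q ^ k * x| * (C * |q ^ k * x| ^ N) := by
                have := (sub_pos.2 hq1).le
                gcongr
            _ ≤ (1 - q) * (q ^ k * |x|) * (C * |x| ^ N) := by
                have := (sub_pos.2 hq1).le
                gcongr
                rw [abs_mul, abs_of_pos (pow_pos hq0 k)]
            _ = _ := by ring
        have h3 := norm_sub_le_norm_sub_add_norm_sub (G x) (G (q ^ k * x)) (G (q ^ (k + 1) * x))
        linarith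
    have hG0 : G 0 = 0 := by
      simp only [hG]
      rw [Finset.sum_range_succ']
      simp [hb]
    have hGc : ContinuousAt G 0 := by
      refine hF.differentiableAt.continuousAt.sub (Continuous.continuousAt ?_)
      exact continuous_finsetSum _ fun i _ => by fun_prop
    have hlim : Tendsto (fun k : ℕ => ‖G x - G (q ^ k * x)‖) atTop (𝓝 ‖G x - G 0‖) := by
      have h1 : Tendsto (fun k : ℕ => q ^ k * x) atTop (𝓝 0) := by
        simpa using (tendsto_pow_atTop_nhds_zero_of_lt_one hq0.le hq1).mul_const x
      exact ((tendsto_const_nhds.sub (hGc.tendsto.comp h1))).norm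
    rw [hG0, sub_zero] at hlim
    refine le_of_tendsto hlim (Eventually.of_forall fun k => (hbound k).trans ?_)
    refine mul_le_of_le_one_right (by positivity) ?_
    linarith [pow_pos hq0 k]

theorem sum_even_part (a : ℕ → ℂ) (x : ℂ) (M : ℕ) :
    ∑ i ∈ Finset.range (2 * M), a i * x ^ i + ∑ i ∈ Finset.range (2 * M), a i * (-x) ^ i =
      2 * ∑ j ∈ Finset.range M, a (2 * j) * x ^ (2 * j) := by
  induction M with
  | zero => simp
  | succ M ih =>
    have h1 : (-x) ^ (2 * M) = x ^ (2 * M) := Even.neg_pow ⟨M, by ring⟩ x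
    have h2 : (-x) ^ (2 * M + 1) = -x ^ (2 * M + 1) := Odd.neg_pow ⟨M, rfl⟩ x
    rw [show 2 * (M + 1) = 2 * M + 1 + 1 by ring, Finset.sum_range_succ, Finset.sum_range_succ,
      Finset.sum_range_succ _ (2 * M + 1), Finset.sum_range_succ _ (2 * M),
      Finset.sum_range_succ _ M, h1, h2]
    linear_combination ih

/-- Taylor expansion of even functions, with a global bound of the remainder. -/
theorem exists_even_qTaylor (hq0 : 0 < q) (hq1 : q < 1) (M : ℕ) {F : ℝ → ℂ}
    (heven : ∀ x, F (-x) = F x) (hF : InfQDiff q F) {B : ℝ} (hB : ∀ x, ‖F x‖ ≤ B) :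
    ∃ (e : ℕ → ℂ) (C : ℝ), 0 ≤ C ∧ ∀ x : ℝ,
      ‖F x - ∑ j ∈ Finset.range M, e j * (x : ℂ) ^ (2 * j)‖ ≤ C * |x| ^ (2 * M) := by
  obtain ⟨a, C, δ, hδ, hC, ha⟩ := exists_qTaylor hq0 hq1 (2 * M) hF
  have hB0 := (norm_nonneg _).trans (hB 0)
  have hS0 : 0 ≤ ∑ j ∈ Finset.range M, ‖a (2 * j)‖ * δ⁻¹ ^ (2 * (M - j)) :=
    Finset.sum_nonneg fun j _ => by positivity
  refine ⟨fun j => a (2 * j), C + B * δ⁻¹ ^ (2 * M) +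
    ∑ j ∈ Finset.range M, ‖a (2 * j)‖ * δ⁻¹ ^ (2 * (M - j)), by positivity, fun x => ?_⟩
  rcases lt_or_ge |x| δ with hx | hx
  · have h1 := ha x hx
    have h2 := ha (-x) (by rwa [abs_neg])
    rw [heven, abs_neg, Complex.ofReal_neg] at h2
    -- Averaging the expansions at `x` and `-x` removes the odd powers.
    have h3 : F x - ∑ j ∈ Finset.range M, a (2 * j) * (x : ℂ) ^ (2 * j) =
        ((F x - ∑ i ∈ Finset.range (2 * M), a i * (x : ℂ) ^ i) +
          (F x - ∑ i ∈ Finset.range (2 * M), a i * (-(x : ℂ)) ^ i)) / 2 := by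
      have := sum_even_part a x M
      linear_combination this / 2
    have h4 : ‖F x - ∑ j ∈ Finset.range M, a (2 * j) * (x : ℂ) ^ (2 * j)‖ ≤ C * |x| ^ (2 * M) := by
      rw [h3, norm_div]
      have := norm_add_le (F x - ∑ i ∈ Finset.range (2 * M), a i * (x : ℂ) ^ i)
        (F x - ∑ i ∈ Finset.range (2 * M), a i * (-(x : ℂ)) ^ i)
      rw [Complex.norm_ofNat, div_le_iff₀ two_pos]
      linarith
    refine h4.trans ?_
    gcongr
    have : 0 ≤ B * δ⁻¹ ^ (2 * M) := by positivity
    linarith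
  · have hx0 : 0 < |x| := hδ.trans_le hx
    -- Away from the origin each term is at most a constant times `|x|^(2M)`, since every missing
    -- factor can be supplied by `δ⁻¹ |x| ≥ 1`.
    have hone : 1 ≤ δ⁻¹ * |x| := by
      rw [inv_mul_eq_div, one_le_div hδ]
      exact hx
    have h1 : ‖F x‖ ≤ B * δ⁻¹ ^ (2 * M) * |x| ^ (2 * M) := by
      rw [mul_assoc, ← mul_pow]
      exact (hB x).trans (le_mul_of_one_le_right hB0 (one_le_pow₀ hone))
    have h2 : ‖∑ j ∈ Finset.range M, a (2 * j) * (x : ℂ) ^ (2 * j)‖ ≤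
        (∑ j ∈ Finset.range M, ‖a (2 * j)‖ * δ⁻¹ ^ (2 * (M - j))) * |x| ^ (2 * M) := by
      rw [Finset.sum_mul]
      refine norm_sum_le_of_le _ fun j hj => ?_
      have hjM := Finset.mem_range.1 hj
      rw [norm_mul, norm_pow, Complex.norm_real, Real.norm_eq_abs, mul_assoc]
      gcongr
      have h3 : |x| ^ (2 * M) = |x| ^ (2 * (M - j)) * |x| ^ (2 * j) := by
        rw [← pow_add]
        congr 1
        omega
      rw [h3, ← mul_assoc, ← mul_pow]
      exact le_mul_of_one_le_left (by positivity) (one_le_pow₀ hone)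
    have h4 := norm_sub_le (F x) (∑ j ∈ Finset.range M, a (2 * j) * (x : ℂ) ^ (2 * j))
    have h5 : 0 ≤ C * |x| ^ (2 * M) := by positivity
    dsimp only
    nlinarith

end Taylor

/-! ### Fast decrease of the `q`-cosine transform at infinity and at `0`. -/

section Decay

variable {q α : ℝ} {m : ℤ}

/-- The bound with the larger `s₂` controls `n → +∞`, that with the smaller `s₁` controls `n → -∞`.
-/
theorem summable_zpow_of_bounds {a : ℤ → ℂ} {s₁ s s₂ C₁ C₂ : ℝ} (h0 : 0 < s₁) (h1 : s₁ < s)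
    (h2 : s < s₂) (hC₁ : ∀ n, ‖a n‖ * s₁ ^ n ≤ C₁) (hC₂ : ∀ n, ‖a n‖ * s₂ ^ n ≤ C₂) :
    Summable fun n => ‖a n‖ * s ^ n := by
  have hs := h0.trans h1
  have hs2 := hs.trans h2
  refine Summable.of_nat_of_neg ?_ ?_
  · refine Summable.of_nonneg_of_le (fun _ => by positivity) (fun n => ?_)
      ((summable_geometric_of_lt_one (by positivity) ((div_lt_one hs2).2 h2)).mul_left C₂)
    have h := mul_le_mul_of_nonneg_right (hC₂ n) (by positivity : 0 ≤ (s / s₂) ^ n)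
    refine (le_of_eq ?_).trans h
    rw [zpow_natCast, zpow_natCast, div_pow]
    field_simp
  · refine Summable.of_nonneg_of_le (fun _ => by positivity) (fun n => ?_)
      ((summable_geometric_of_lt_one (by positivity) ((div_lt_one hs).2 h1)).mul_left C₁)
    have h := mul_le_mul_of_nonneg_right (hC₁ (-n)) (by positivity : 0 ≤ (s₁ / s) ^ n)
    refine (le_of_eq ?_).trans h
    rw [zpow_neg, zpow_neg, zpow_natCast, zpow_natCast, div_pow]
    field_simp

theorem summable_of_mem_qSchwartz (hq0 : 0 < q) (hq1 : q < 1) {f : Rq q → ℂ}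
    (hf : f ∈ qSchwartz q) {s : ℝ} (hs0 : 0 < s) (hs1 : s < 1) :
    Summable fun n : ℤ => ‖f (gridPt q n)‖ * s ^ n := by
  obtain ⟨F, -, -, hF, hfF⟩ := exists_rapidDecay_of_mem_qSchwartz hf
  obtain ⟨B, hB⟩ := hF.bounded
  obtain ⟨N, hN⟩ := exists_pow_lt_of_lt_one hs0 hq1
  obtain ⟨C, hC⟩ := hF N
  have hN2 : q ^ (2 * N) < s :=
    lt_of_le_of_lt (pow_le_pow_of_le_one hq0.le hq1.le (by omega)) hN
  refine summable_zpow_of_bounds (C₁ := C) (C₂ := B) (by positivity : 0 < q ^ (2 * N)) hN2 hs1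
    (fun n => ?_) (fun n => ?_)
  · rw [hfF, coe_gridPt]
    refine le_trans ?_ (hC (q ^ n))
    rw [mul_comm]
    gcongr
    rw [← zpow_natCast q, ← zpow_mul, mul_comm, zpow_mul, zpow_natCast, pow_mul]
    gcongr
    linarith
  · rw [one_zpow, mul_one, hfF]
    exact hB _

theorem hasSum_zpow_mul_bessel_shift (hq0 : 0 < q) (hq1 : q < 1) (hm : 1 - q = q ^ m)
    (hα : -1 < α) {s : ℝ} (hs0 : 0 < s) (hs1 : s < 1) (k : ℤ) :
    HasSum (fun n : ℤ => s ^ n * |qBesselJ q α (q ^ k * q ^ n)|)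
      (s ^ (-k) * ∑' n : ℤ, s ^ n * |qBesselJ q α (q ^ n)|) := by
  have h := ((Equiv.addLeft k).hasSum_iff.2
    (summable_zpow_mul_bessel hq0 hq1 hm hα hs0 hs1).hasSum).mul_left (s ^ (-k))
  refine h.congr_fun fun n => ?_
  simp only [Function.comp, Equiv.coe_addLeft]
  rw [zpow_add₀ hs0.ne', zpow_add₀ hq0.ne', zpow_neg]
  have := zpow_ne_zero k hs0.ne'
  field_simp

theorem hasSum_moment_cos_shift (hq0 : 0 < q) (hq1 : q < 1) (hm : 1 - q = q ^ m) (j : ℕ) (k : ℤ) :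
    HasSum (fun n : ℤ => (q ^ n) ^ (2 * j) * (qBesselJ q (-1 / 2) (q ^ k * q ^ n) * q ^ n)) 0 := by
  have h0 := hasSum_moment_bessel hq0 hq1 hm (by norm_num : (-1 : ℝ) < -1 / 2) j
  rw [rpow_cos_weight] at h0
  have ht0 : q * (q ^ 2) ^ j ≠ 0 := by positivity
  have h := ((Equiv.addLeft k).hasSum_iff.2 h0).mul_left ((q * (q ^ 2) ^ j) ^ (-k))
  rw [mul_zero] at h
  refine h.congr_fun fun n => ?_
  simp only [Function.comp, Equiv.coe_addLeft]
  have e : (q ^ n) ^ (2 * j) * q ^ n = (q * (q ^ 2) ^ j) ^ n := by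
    rw [mul_zpow, ← pow_mul, ← zpow_natCast, ← zpow_natCast q, ← zpow_mul, ← zpow_mul, mul_comm n,
      mul_comm]
  rw [zpow_add₀ ht0, zpow_add₀ hq0.ne', zpow_neg, ← e]
  have := zpow_ne_zero k ht0
  field_simp

/-- The `q`-cosine transform of an element of `S_{*q}(ℝ_q)` decreases fast at infinity. -/
theorem exists_gridFourier_mul_pow_le (hq0 : 0 < q) (hq1 : q < 1) (hm : 1 - q = q ^ m)
    {f : Rq q → ℂ} (hf : f ∈ qSchwartz q) (M : ℕ) :
    ∃ C, ∀ k : ℤ, ‖gridFourier q (-1 / 2) (fun n => f (gridPt q n)) (q ^ k)‖ *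
      (q ^ (2 * M + 1)) ^ k ≤ C := by
  obtain ⟨F, heven, hd, hF, hfF⟩ := exists_rapidDecay_of_mem_qSchwartz hf
  obtain ⟨B, hB⟩ := hF.bounded
  obtain ⟨e, C, hC0, hC⟩ := exists_even_qTaylor hq0 hq1 M heven hd hB
  have hα : (-1 : ℝ) < -1 / 2 := by norm_num
  have hs0 : 0 < q ^ (2 * M + 1) := by positivity
  have hs1 : q ^ (2 * M + 1) < 1 := pow_lt_one₀ hq0.le hq1 (by omega)
  refine ⟨|cConst q (-1 / 2) * (1 - q)| *
    (C * ∑' n : ℤ, (q ^ (2 * M + 1)) ^ n * |qBesselJ q (-1 / 2) (q ^ n)|), fun k => ?_⟩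
  have hsk := hasSum_zpow_mul_bessel_shift hq0 hq1 hm hα hs0 hs1 k
  set P : ℤ → ℂ := fun n => ∑ j ∈ Finset.range M, e j * ((q ^ n : ℝ) : ℂ) ^ (2 * j) with hP
  set w : ℤ → ℝ := fun n => qBesselJ q (-1 / 2) (q ^ k * q ^ n) * q ^ n with hw
  -- The Taylor polynomial of `f` contributes nothing, because the even moments of the `q`-cosine
  -- vanish; only the remainder of order `2M` is left, and scaling gives the power of `q^k`.
  have hPs : HasSum (fun n => P n * (w n : ℂ)) 0 := by
    have h := hasSum_sum (s := Finset.range M) (f := fun j n => e j *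
      (((q ^ n) ^ (2 * j) * w n : ℝ) : ℂ)) (a := fun j => e j * ((0 : ℝ) : ℂ)) fun j _ =>
        (Complex.hasSum_ofReal.2 (hasSum_moment_cos_shift hq0 hq1 hm j k)).mul_left (e j)
    simp only [Complex.ofReal_zero, mul_zero, Finset.sum_const_zero] at h
    refine h.congr_fun fun n => ?_
    simp only [hP]
    rw [Finset.sum_mul]
    refine Finset.sum_congr rfl fun j _ => ?_
    push_cast
    ring
  have hfs : Summable fun n => f (gridPt q n) * (w n : ℂ) := by
    have := summable_mul_bessel hq0 hq1 hm hα (a := fun n => f (gridPt q n))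
      (by simpa only [rpow_cos_weight] using summable_of_mem_qSchwartz hq0 hq1 hf hq0 hq1) k
    rw [rpow_cos_weight] at this
    exact this.of_norm
  have hle : ∀ n, ‖(f (gridPt q n) - P n) * (w n : ℂ)‖ ≤
      C * ((q ^ (2 * M + 1)) ^ n * |qBesselJ q (-1 / 2) (q ^ k * q ^ n)|) := by
    intro n
    have h1 := hC (q ^ n)
    rw [abs_of_pos (zpow_pos hq0 n)] at h1
    have e1 : (q ^ (2 * M + 1)) ^ n = (q ^ n) ^ (2 * M) * q ^ n := by
      rw [← pow_succ, ← zpow_natCast, ← zpow_natCast (q ^ n), ← zpow_mul, ← zpow_mul, mul_comm]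
    rw [norm_mul, hfF, coe_gridPt, Complex.norm_real, hw, norm_mul,
      Real.norm_of_nonneg (zpow_pos hq0 n).le, Real.norm_eq_abs, e1]
    calc _ ≤ C * (q ^ n) ^ (2 * M) * (|qBesselJ q (-1 / 2) (q ^ k * q ^ n)| * q ^ n) := by
          gcongr
      _ = _ := by ring
  have hsn := Summable.of_nonneg_of_le (fun _ => norm_nonneg _) hle (hsk.summable.mul_left C)
  have hval : gridFourier q (-1 / 2) (fun n => f (gridPt q n)) (q ^ k) =
      ((cConst q (-1 / 2) * (1 - q) : ℝ) : ℂ) * ∑' n, (f (gridPt q n) - P n) * (w n : ℂ) := by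
    simp only [sub_mul]
    rw [hfs.tsum_sub hPs.summable, hPs.tsum_eq, sub_zero, gridFourier, rpow_cos_weight]
  have hnorm := (norm_tsum_le_tsum_norm hsn).trans (hsn.tsum_le_tsum hle (hsk.summable.mul_left C))
  rw [tsum_mul_left, hsk.tsum_eq] at hnorm
  rw [hval, norm_mul, Complex.norm_real, Real.norm_eq_abs, mul_assoc]
  refine mul_le_mul_of_nonneg_left ?_ (abs_nonneg _)
  have := mul_le_mul_of_nonneg_right hnorm (zpow_pos hs0 k).le
  refine this.trans (le_of_eq ?_)
  rw [zpow_neg]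
  have := zpow_ne_zero k hs0.ne'
  field_simp

theorem tsum_moment_eq_zero (hq1 : q < 1) {f : Rq q → ℂ}
    (hf : f ∈ qSchwartzMoment q (-1 / 2)) (j : ℕ) :
    ∑' n : ℤ, f (gridPt q n) * (((q ^ n) ^ (2 * j) * q ^ n : ℝ) : ℂ) = 0 := by
  have h := hf.2 j
  have h1q : ((1 - q : ℝ) : ℂ) ≠ 0 := Complex.ofReal_ne_zero.2 (sub_pos.2 hq1).ne'
  rw [jacksonInf] at h
  rw [← (mul_eq_zero.1 h).resolve_left h1q]
  refine tsum_congr fun n => ?_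
  rw [coe_gridPt, show (2 * (j : ℝ) + 2 * (-1 / 2) + 1) = ((2 * j : ℕ) : ℝ) by push_cast; ring,
    Real.rpow_natCast]
  push_cast
  ring

/-- If all moments vanish, the `q`-cosine transform vanishes to infinite order at `0`. -/
theorem exists_gridFourier_mul_zpow_neg_le (hq0 : 0 < q) (hq1 : q < 1) (hm : 1 - q = q ^ m)
    {f : Rq q → ℂ} (hf : f ∈ qSchwartzMoment q (-1 / 2)) (M : ℕ) :
    ∃ C, ∀ k : ℤ, ‖gridFourier q (-1 / 2) (fun n => f (gridPt q n)) (q ^ k)‖ *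
      ((q ^ (2 * M))⁻¹) ^ k ≤ C := by
  have hα : (-1 : ℝ) < -1 / 2 := by norm_num
  -- The cut-off kernel is bounded on the whole line, as the global remainder estimate requires, and
  -- agrees with the `q`-cosine on the grid.
  obtain ⟨B, hB⟩ := (rapidDecay_besselCut hq0 hq1 hm hα).bounded
  obtain ⟨e, C, hC0, hC⟩ := exists_even_qTaylor hq0 hq1 M (besselCut_neg (α := -1 / 2))
    (infQDiff_besselCut hq0 hq1 hα) hB
  have hfw : ∀ j : ℕ, Summable fun n : ℤ => ‖f (gridPt q n)‖ * ((q ^ n) ^ (2 * j) * q ^ n) := by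
    intro j
    refine (summable_of_mem_qSchwartz hq0 hq1 hf.1 (by positivity : 0 < q ^ (2 * j + 1))
      (pow_lt_one₀ hq0.le hq1 (by omega))).congr fun n => ?_
    rw [← pow_succ, ← zpow_natCast, ← zpow_natCast (q ^ n), ← zpow_mul, ← zpow_mul, mul_comm n]
  refine ⟨|cConst q (-1 / 2) * (1 - q)| *
    (C * ∑' n : ℤ, ‖f (gridPt q n)‖ * ((q ^ n) ^ (2 * M) * q ^ n)), fun k => ?_⟩
  set P : ℤ → ℂ := fun n => ∑ j ∈ Finset.range M, e j * ((q ^ k * q ^ n : ℝ) : ℂ) ^ (2 * j) with hP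
  -- The dual argument: now the Taylor polynomial of the kernel is killed by the vanishing moments
  -- of `f`.
  have hPs : HasSum (fun n => f (gridPt q n) * ((q ^ n : ℝ) : ℂ) * P n) 0 := by
    have hj : ∀ j : ℕ, HasSum (fun n : ℤ =>
        f (gridPt q n) * (((q ^ n) ^ (2 * j) * q ^ n : ℝ) : ℂ)) 0 := by
      intro j
      rw [← tsum_moment_eq_zero hq1 hf j]
      refine (Summable.of_norm ((hfw j).congr fun n => ?_)).hasSum
      rw [norm_mul, Complex.norm_real, Real.norm_of_nonneg (by positivity)]
    have h := hasSum_sum (s := Finset.range M) (f := fun j n => e j * ((q ^ k : ℝ) : ℂ) ^ (2 * j) *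
      (f (gridPt q n) * (((q ^ n) ^ (2 * j) * q ^ n : ℝ) : ℂ)))
      (a := fun j => e j * ((q ^ k : ℝ) : ℂ) ^ (2 * j) * 0) fun j _ => (hj j).mul_left _
    simp only [mul_zero, Finset.sum_const_zero] at h
    refine h.congr_fun fun n => ?_
    simp only [hP]
    rw [Finset.mul_sum]
    refine Finset.sum_congr rfl fun j _ => ?_
    push_cast
    ring
  have hfs : Summable fun n => f (gridPt q n) *
      ((qBesselJ q (-1 / 2) (q ^ k * q ^ n) * q ^ n : ℝ) : ℂ) := by
    have := summable_mul_bessel hq0 hq1 hm hα (a := fun n => f (gridPt q n))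
      (by simpa only [rpow_cos_weight] using summable_of_mem_qSchwartz hq0 hq1 hf.1 hq0 hq1) k
    rw [rpow_cos_weight] at this
    exact this.of_norm
  have hle : ∀ n : ℤ, ‖f (gridPt q n) * ((qBesselJ q (-1 / 2) (q ^ k * q ^ n) * q ^ n : ℝ) : ℂ) -
      f (gridPt q n) * ((q ^ n : ℝ) : ℂ) * P n‖ ≤
      C * (q ^ k) ^ (2 * M) * (‖f (gridPt q n)‖ * ((q ^ n) ^ (2 * M) * q ^ n)) := by
    intro n
    have h1 := hC (q ^ k * q ^ n)
    have hmem : q ^ k * q ^ n ∈ Rq q := (gridPt q k * gridPt q n).2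
    rw [besselCut_of_mem hmem, abs_of_pos (by positivity), mul_pow] at h1
    have e1 : f (gridPt q n) * ((qBesselJ q (-1 / 2) (q ^ k * q ^ n) * q ^ n : ℝ) : ℂ) -
        f (gridPt q n) * ((q ^ n : ℝ) : ℂ) * P n = f (gridPt q n) * ((q ^ n : ℝ) : ℂ) *
          (((qBesselJ q (-1 / 2) (q ^ k * q ^ n) : ℝ) : ℂ) - P n) := by
      push_cast
      ring
    rw [e1, norm_mul, norm_mul, Complex.norm_real, Real.norm_of_nonneg (zpow_pos hq0 n).le]
    calc _ ≤ ‖f (gridPt q n)‖ * q ^ n * (C * ((q ^ k) ^ (2 * M) * (q ^ n) ^ (2 * M))) := by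
          gcongr
      _ = _ := by ring
  have hsw := (hfw M).mul_left (C * (q ^ k) ^ (2 * M))
  have hsn := Summable.of_nonneg_of_le (fun _ => norm_nonneg _) hle hsw
  have hval : gridFourier q (-1 / 2) (fun n => f (gridPt q n)) (q ^ k) =
      ((cConst q (-1 / 2) * (1 - q) : ℝ) : ℂ) *
        ∑' n : ℤ, (f (gridPt q n) * ((qBesselJ q (-1 / 2) (q ^ k * q ^ n) * q ^ n : ℝ) : ℂ) -
          f (gridPt q n) * ((q ^ n : ℝ) : ℂ) * P n) := by
    rw [hfs.tsum_sub hPs.summable, hPs.tsum_eq, sub_zero, gridFourier, rpow_cos_weight]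
  have hnorm := (norm_tsum_le_tsum_norm hsn).trans (hsn.tsum_le_tsum hle hsw)
  rw [tsum_mul_left] at hnorm
  rw [hval, norm_mul, Complex.norm_real, Real.norm_eq_abs, mul_assoc]
  refine mul_le_mul_of_nonneg_left ?_ (abs_nonneg _)
  have h0 : 0 < ((q ^ (2 * M))⁻¹) ^ k := by positivity
  refine (mul_le_mul_of_nonneg_right hnorm h0.le).trans (le_of_eq ?_)
  have e2 : ((q ^ (2 * M))⁻¹) ^ k = ((q ^ k) ^ (2 * M))⁻¹ := by
    rw [inv_zpow, ← zpow_natCast, ← zpow_natCast (q ^ k), ← zpow_mul, ← zpow_mul, mul_comm]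
  rw [e2]
  have : (q ^ k) ^ (2 * M) ≠ 0 := by positivity
  field_simp

theorem summable_gridFourier_cos (hq0 : 0 < q) (hq1 : q < 1) (hm : 1 - q = q ^ m)
    {f : Rq q → ℂ} (hf : f ∈ qSchwartzMoment q (-1 / 2)) {s : ℝ} (hs : 0 < s) :
    Summable fun k : ℤ =>
      ‖gridFourier q (-1 / 2) (fun n => f (gridPt q n)) (q ^ k)‖ * s ^ k := by
  obtain ⟨M, hM⟩ := exists_pow_lt_of_lt_one hs hq1
  obtain ⟨N, hN⟩ := exists_pow_lt_of_lt_one (inv_pos.2 hs) hq1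
  obtain ⟨C, hC⟩ := exists_gridFourier_mul_pow_le hq0 hq1 hm hf.1 M
  obtain ⟨D, hD⟩ := exists_gridFourier_mul_zpow_neg_le hq0 hq1 hm hf N
  refine summable_zpow_of_bounds (by positivity) ?_ ?_ hC hD
  · exact lt_of_le_of_lt (pow_le_pow_of_le_one hq0.le hq1.le (by omega)) hM
  · rw [lt_inv_comm₀ hs (by positivity)]
    exact lt_of_le_of_lt (pow_le_pow_of_le_one hq0.le hq1.le (by omega)) hN

end Decay

/-! ### Inverse transforms and the two inversion formulas. -/

section Inversion

variable {q α : ℝ} {m : ℤ}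

theorem gridFourier_abs (a : ℤ → ℂ) (y : ℝ) : gridFourier q α a |y| = gridFourier q α a y := by
  rcases abs_choice y with h | h <;> rw [h]
  rw [gridFourier_neg]

theorem mem_Rq_cases (hq0 : 0 < q) (x : Rq q) : (x : ℝ) = 0 ∨ ∃ n : ℤ, |(x : ℝ)| = q ^ n := by
  rcases x.2 with h | ⟨n, h | h⟩
  · exact Or.inl h
  · exact Or.inr ⟨n, by rw [h, abs_of_pos (zpow_pos hq0 n)]⟩
  · exact Or.inr ⟨n, by rw [h, abs_neg, abs_of_pos (zpow_pos hq0 n)]⟩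

theorem tendsto_zpow_natCast (hq0 : 0 < q) (hq1 : q < 1) :
    Tendsto (fun n : ℕ => q ^ (n : ℤ)) atTop (𝓝 0) := by
  simpa using tendsto_pow_atTop_nhds_zero_of_lt_one hq0.le hq1

/-- The origin belongs to `ℝ_q` but not to `q^ℤ`, where the inversion is proved; the value there is
recovered by continuity of the transform along the grid. -/
theorem gridFourier_zero_eq_zero (hq0 : 0 < q) (hq1 : q < 1) (hm : 1 - q = q ^ m) (hα : -1 < α)
    {a : ℤ → ℂ} (ha : Summable fun n => ‖a n‖ * (q ^ (2 * α + 2)) ^ n)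
    (h0 : Tendsto (fun k : ℕ => gridFourier q α a (q ^ (k : ℤ))) atTop (𝓝 0)) :
    gridFourier q α a 0 = 0 := by
  obtain ⟨B, hB⟩ := exists_abs_bessel_le hq0 hq1 hm hα
  refine tendsto_nhds_unique ?_ h0
  refine Tendsto.const_mul _ ?_
  refine tendsto_tsum_of_dominated_convergence (ha.mul_left B) (fun n => ?_)
    (Eventually.of_forall fun k n => ?_)
  · have hJ : ContinuousAt (fun y : ℝ => ((qBesselJ q α y : ℝ) : ℂ)) 0 :=
      (analyticAt_qBesselJ hq0 hq1 hα).continuousAt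
    have h1 : Tendsto (fun k : ℕ => q ^ (k : ℤ) * q ^ n) atTop (𝓝 0) := by
      simpa using (tendsto_zpow_natCast hq0 hq1).mul_const (q ^ n)
    have h2 := ((hJ.tendsto.comp h1).mul_const (((q ^ (2 * α + 2)) ^ n : ℝ) : ℂ)).const_mul (a n)
    simpa only [zero_mul, Complex.ofReal_mul, Function.comp_def] using h2
  · have h1 := hB (k + n)
    rw [norm_mul, Complex.norm_real, norm_mul, Real.norm_eq_abs, ← zpow_add₀ hq0.ne',
      Real.norm_of_nonneg (by positivity)]
    calc _ ≤ ‖a n‖ * (B * (q ^ (2 * α + 2)) ^ n) := by gcongr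
      _ = _ := by ring

/-- The rescaled transform of `h` is an explicit preimage of `H` in `S_{*q}(ℝ_q)`, so the chosen
element is a preimage as well. Whichever one is chosen, applying `F_{α,q}` to it again determines
its values on the positive grid. -/
theorem gridFourier_inverse (hq0 : 0 < q) (hq1 : q < 1) (hm : 1 - q = q ^ m) (hα : -1 < α)
    {h : ℤ → ℂ} (hh : ∀ s : ℝ, 0 < s → Summable fun n => ‖h n‖ * s ^ n) {H : Rq q → ℂ}
    (hH : ∀ (x : Rq q) (n : ℤ), |(x : ℝ)| = q ^ n → H x = h n)
    (hH0 : ∀ x : Rq q, (x : ℝ) = 0 → H x = 0) (n : ℤ) :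
    qBesselFourierInv q α H (gridPt q n) =
      ((q ^ (4 * α + 2) : ℝ) : ℂ)⁻¹ * gridFourier q α h (q ^ n) := by
  have hN : ((q ^ (4 * α + 2) : ℝ) : ℂ) ≠ 0 := Complex.ofReal_ne_zero.2 (by positivity)
  have hc0 : 0 < q ^ (2 * α + 2) := by positivity
  have hc1 : q ^ (2 * α + 2) < 1 := Real.rpow_lt_one hq0.le hq1 (by linarith)
  have hk : ∀ k : ℤ, |((gridPt q k : Rq q) : ℝ)| = q ^ k := fun k => abs_of_pos (zpow_pos hq0 k)
  have hex : ∃ A ∈ qSchwartz q, qBesselFourier q α A = H := by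
    have hh' : ∀ s : ℝ, 0 < s →
        Summable fun n => ‖((q ^ (4 * α + 2) : ℝ) : ℂ)⁻¹ * h n‖ * s ^ n := by
      intro s hs
      simp only [norm_mul, mul_assoc]
      exact (hh s hs).mul_left _
    have hmem := gridFourier_mem_qSchwartz hq0 hq1 hm hα hh'
    refine ⟨_, hmem, funext fun x => ?_⟩
    have hs := summable_of_mem_qSchwartz hq0 hq1 hmem hc0 hc1
    rw [qBesselFourier_eq_gridFourier hq0]
    have hval : ∀ k : ℤ, gridFourier q α (fun n => gridFourier q α
        (fun n => ((q ^ (4 * α + 2) : ℝ) : ℂ)⁻¹ * h n) ((gridPt q n : Rq q) : ℝ)) (q ^ k) = h k := by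
      intro k
      simp only [coe_gridPt]
      rw [gridFourier_gridFourier hq0 hq1 hm hα (hh' _ hc0), mul_inv_cancel_left₀ hN]
    rcases mem_Rq_cases hq0 x with hx | ⟨k, hx⟩
    · rw [hH0 x hx, hx]
      refine gridFourier_zero_eq_zero hq0 hq1 hm hα hs ?_
      simp only [hval]
      have h1 : Summable fun n : ℤ => ‖h n‖ := by simpa using hh 1 one_pos
      have h2 : Summable fun n : ℕ => ‖h n‖ := h1.comp_injective Nat.cast_injective
      exact tendsto_zero_iff_norm_tendsto_zero.2 h2.tendsto_atTop_zero
    · rw [hH x k hx, ← gridFourier_abs, hx, hval]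
  have hA := Function.invFunOn_mem hex
  have hFA := Function.invFunOn_eq hex
  have hs := summable_of_mem_qSchwartz hq0 hq1 hA hc0 hc1
  have hinv := gridFourier_gridFourier hq0 hq1 hm hα hs n
  have hval : ∀ k : ℤ, gridFourier q α
      (fun n => Function.invFunOn (qBesselFourier q α) (qSchwartz q) H (gridPt q n)) (q ^ k) = h k := by
    intro k
    rw [← coe_gridPt, ← qBesselFourier_eq_gridFourier hq0, hFA, hH _ k (hk k)]
  simp only [hval] at hinv
  rw [hinv, inv_mul_cancel_left₀ hN]
  rfl

theorem gridWeyl_const_mul (C : ℂ) (u : ℤ → ℂ) (n : ℤ) :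
    gridWeyl q α (fun n => C * u n) n = C * gridWeyl q α u n := by
  rw [gridWeyl, gridWeyl, mul_left_comm, ← tsum_mul_left (a := C)]
  congr 1
  refine tsum_congr fun i => ?_
  ring

theorem gridWeyl_gridFourier_gridFourier (hq0 : 0 < q) (hq1 : q < 1) (hm : 1 - q = q ^ m)
    (hα : -1 / 2 < α) {f : Rq q → ℂ} (hf : f ∈ qSchwartzMoment q (-1 / 2)) (n : ℤ) :
    gridWeyl q α (fun k => gridFourier q α (fun l =>
      gridFourier q (-1 / 2) (fun n => f (gridPt q n)) (q ^ l)) (q ^ k)) n =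
      ((q ^ (4 * α + 2) : ℝ) : ℂ) * f (gridPt q n) := by
  have hα1 : -1 < α := by linarith
  have hβ : (-1 : ℝ) < -1 / 2 := by norm_num
  have hc0 : 0 < q ^ (2 * α + 2) := by positivity
  have hc1 : q ^ (2 * α + 2) < 1 := Real.rpow_lt_one hq0.le hq1 (by linarith)
  set h : ℤ → ℂ := fun l => gridFourier q (-1 / 2) (fun n => f (gridPt q n)) (q ^ l) with hh
  have hr : ∀ s : ℝ, 0 < s → Summable fun n => ‖h n‖ * s ^ n :=
    fun s hs => summable_gridFourier_cos hq0 hq1 hm hf hs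
  set u : ℤ → ℂ := fun k => gridFourier q α h (q ^ k) with hu
  have hus : Summable fun n => ‖u n‖ * (q ^ (2 * α + 2)) ^ n :=
    summable_of_mem_qSchwartz hq0 hq1 (gridFourier_mem_qSchwartz hq0 hq1 hm hα1 hr) hc0 hc1
  have hws : Summable fun n => ‖gridWeyl q α u n‖ * (q ^ (2 * (-1 / 2 : ℝ) + 2)) ^ n := by
    rw [rpow_cos_weight]
    exact summable_gridWeyl hq0 hq1 hα hus
  have hfs : Summable fun n => ‖f (gridPt q n)‖ * (q ^ (2 * (-1 / 2 : ℝ) + 2)) ^ n := by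
    rw [rpow_cos_weight]
    exact summable_of_mem_qSchwartz hq0 hq1 hf.1 hq0 hq1
  have h1 := gridFourier_gridFourier hq0 hq1 hm hβ hws n
  have h2 := gridFourier_gridFourier hq0 hq1 hm hβ hfs n
  have h3 : q ^ (4 * (-1 / 2 : ℝ) + 2) = 1 := by norm_num
  have h4 : ∀ k : ℤ, gridFourier q (-1 / 2) (gridWeyl q α u) (q ^ k) =
      ((q ^ (4 * α + 2) : ℝ) : ℂ) * h k := fun k => by
    rw [gridFourier_gridWeyl hq0 hq1 hm hα hus, hu,
      gridFourier_gridFourier hq0 hq1 hm hα1 (hr _ hc0)]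
  simp only [h4] at h1
  rw [h3, Complex.ofReal_one, one_mul] at h1 h2
  -- Both `W_{α,q}(F_{α,q} h)` and `q^(4α+2) f` have the same `q`-cosine transform, and that
  -- transform is its own inverse.
  rw [← h1, gridFourier_const_mul, h2]

/-- If `g` is the rescaled `F_{α,q} F_q f` on the positive grid, then `W_{α,q} g = f`. -/
theorem weyl_eq_of_grid (hq0 : 0 < q) (hq1 : q < 1) (hm : 1 - q = q ^ m)
    (hα : -1 / 2 < α) {f g : Rq q → ℂ} (hf : f ∈ qSchwartzMoment q (-1 / 2))
    (hg : ∀ k : ℤ, ((q ^ (4 * α + 2) : ℝ) : ℂ) * g (gridPt q k) = gridFourier q α (fun l =>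
      gridFourier q (-1 / 2) (fun n => f (gridPt q n)) (q ^ l)) (q ^ k)) :
    f = weyl q α g := by
  have hα1 : -1 < α := by linarith
  have hN : ((q ^ (4 * α + 2) : ℝ) : ℂ) ≠ 0 := Complex.ofReal_ne_zero.2 (by positivity)
  have hgrid : ∀ n : ℤ, gridWeyl q α (fun k => g (gridPt q k)) n = f (gridPt q n) := by
    intro n
    have h1 := gridWeyl_gridFourier_gridFourier hq0 hq1 hm hα hf n
    simp only [← hg, gridWeyl_const_mul] at h1
    exact mul_left_cancel₀ hN h1
  have hgs : Summable fun n : ℤ => ‖g (gridPt q n)‖ * (q ^ (2 * α + 1)) ^ n := by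
    have hb1 : q ^ (2 * α + 1) < 1 := Real.rpow_lt_one hq0.le hq1 (by linarith)
    have h1 := summable_of_mem_qSchwartz hq0 hq1 (gridFourier_mem_qSchwartz hq0 hq1 hm hα1
      fun s hs => summable_gridFourier_cos hq0 hq1 hm hf hs) (by positivity) hb1
    simp only [coe_gridPt, ← hg, norm_mul, mul_assoc] at h1
    exact (summable_mul_left_iff (norm_ne_zero_iff.2 hN)).1 h1
  obtain ⟨F, heven, hd, -, hfF⟩ := exists_rapidDecay_of_mem_qSchwartz hf.1
  funext x
  rcases mem_Rq_cases hq0 x with hx | ⟨n, hx⟩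
  · rw [weyl_zero hq0 g hx]
    have h1 := tendsto_gridWeyl hq0 hq1 hα hgs
    simp only [hgrid] at h1
    refine tendsto_nhds_unique ?_ h1
    rw [hfF, hx]
    simp only [hfF, coe_gridPt]
    exact hd.differentiableAt.continuousAt.tendsto.comp (tendsto_zpow_natCast hq0 hq1)
  · rw [weyl_of_abs_eq hq0 hq1 g hx, hgrid, hfF, hfF, coe_gridPt, ← hx]
    rcases abs_choice (x : ℝ) with h | h <;> rw [h]
    rw [heven]

theorem one_sub_eq_zpow (hq0 : 0 < q) (hq1 : q < 1) (h : Real.log (1 - q) / Real.log q = m) :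
    1 - q = q ^ m := by
  have h1 : 0 < 1 - q := sub_pos.2 hq1
  have h2 : Real.log q ≠ 0 := (Real.log_neg hq0 hq1).ne
  apply Real.log_injOn_pos (Set.mem_Ioi.2 h1) (Set.mem_Ioi.2 (zpow_pos hq0 m))
  rw [Real.log_zpow, ← h, div_mul_cancel₀ _ h2]

theorem abs_rpow_weight (hq0 : 0 < q) {x : ℝ} {n : ℤ} (hx : |x| = q ^ n) :
    |x| ^ (2 * α + 1) = (q ^ (2 * α + 1)) ^ n := by
  rw [hx, zpow_rpow_comm hq0]

theorem kConst_mul_ne_zero (hq0 : 0 < q) (hq1 : q < 1) (hα : -1 / 2 < α) :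
    kConst q α * q ^ (4 * α + 2) ≠ 0 := by
  have g1 := qGamma_sq_ne_zero hq0 hq1 (by norm_num : (0 : ℝ) < 1 / 2)
  have g3 := qGamma_sq_ne_zero hq0 hq1 (by linarith : 0 < α + 1)
  rw [kConst]
  positivity

theorem K1_gridPt (hq0 : 0 < q) (hq1 : q < 1) (hm : 1 - q = q ^ m)
    (hα : -1 / 2 < α) {f : Rq q → ℂ} (hf : f ∈ qSchwartzMoment q (-1 / 2)) (n : ℤ) :
    K1 q α f (gridPt q n) = kConst q α * gridFourier q (-1 / 2) (fun l =>
      (((q ^ (2 * α + 1)) ^ l : ℝ) : ℂ) *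
        gridFourier q (-1 / 2) (fun n => f (gridPt q n)) (q ^ l)) (q ^ n) := by
  rw [K1, qFourierCosInv, gridFourier_inverse hq0 hq1 hm (by norm_num)
    (h := fun l => (((q ^ (2 * α + 1)) ^ l : ℝ) : ℂ) *
        gridFourier q (-1 / 2) (fun n => f (gridPt q n)) (q ^ l))]
  · norm_num
  · intro s hs
    have hb : 0 < q ^ (2 * α + 1) := by positivity
    refine (summable_gridFourier_cos hq0 hq1 hm hf (mul_pos hb hs)).congr fun k => ?_
    rw [norm_mul, Complex.norm_real, Real.norm_of_nonneg (zpow_pos hb k).le, mul_zpow]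
    ring
  · intro x k hx
    rw [qFourierCos, qBesselFourier_eq_gridFourier hq0, ← gridFourier_abs, abs_rpow_weight hq0 hx,
      hx]
  · intro x hx
    rw [hx, abs_zero, Real.zero_rpow (by linarith), Complex.ofReal_zero, zero_mul]

/-- On the positive grid `K₁ f` is `κ F_q(|λ|^(2α+1) h)`, and the power `|λ|^(-2α-1)` produced by
`R_{α,q}` cancels the multiplier. -/
theorem mul_riemannLiouville_K1 (hq0 : 0 < q) (hq1 : q < 1) (hm : 1 - q = q ^ m)
    (hα : -1 / 2 < α) {f : Rq q → ℂ} (hf : f ∈ qSchwartzMoment q (-1 / 2)) (k : ℤ) :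
    ((q ^ (4 * α + 2) : ℝ) : ℂ) * riemannLiouville q α (K1 q α f) (gridPt q k) =
      gridFourier q α (fun l =>
        gridFourier q (-1 / 2) (fun n => f (gridPt q n)) (q ^ l)) (q ^ k) := by
  have hb : 0 < q ^ (2 * α + 1) := by positivity
  have hs : Summable fun l : ℤ => ‖(((q ^ (2 * α + 1)) ^ l : ℝ) : ℂ) *
        gridFourier q (-1 / 2) (fun n => f (gridPt q n)) (q ^ l)‖ * q ^ l := by
    refine (summable_gridFourier_cos hq0 hq1 hm hf (mul_pos hb hq0)).congr fun k => ?_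
    rw [norm_mul, Complex.norm_real, Real.norm_of_nonneg (zpow_pos hb k).le, mul_zpow]
    ring
  have h := riemannLiouville_gridFourier hq0 hq1 hm hα hs k
  have hcancel : ∀ n : ℤ, (((q ^ (2 * α + 1)) ^ (-n) : ℝ) : ℂ) *
      ((((q ^ (2 * α + 1)) ^ n : ℝ) : ℂ) *
        gridFourier q (-1 / 2) (fun n => f (gridPt q n)) (q ^ n)) =
      gridFourier q (-1 / 2) (fun n => f (gridPt q n)) (q ^ n) := by
    intro n
    rw [← mul_assoc, ← Complex.ofReal_mul, ← zpow_add₀ hb.ne', neg_add_cancel, zpow_zero,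
      Complex.ofReal_one, one_mul]
  simp only [hcancel] at h
  rw [← h, riemannLiouville_gridPt hq0]
  simp only [K1_gridPt hq0 hq1 hm hα hf]
  have hpull : ∀ G : ℕ → ℂ, ∑' j : ℕ, ((kernel q α (q ^ j) * q ^ j : ℝ) : ℂ) *
      ((kConst q α : ℂ) * G j) =
      kConst q α * ∑' j : ℕ, ((kernel q α (q ^ j) * q ^ j : ℝ) : ℂ) * G j := by
    intro G
    rw [← tsum_mul_left]
    exact tsum_congr fun j => by ring
  rw [hpull]
  push_cast
  ring

/-- Write `f = F_q h` with `h = F_q f` and apply the intertwining relation for `R_{α,q}`. -/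
theorem riemannLiouville_eq_gridFourier (hq0 : 0 < q) (hq1 : q < 1) (hm : 1 - q = q ^ m)
    (hα : -1 / 2 < α) {f : Rq q → ℂ} (hf : f ∈ qSchwartzMoment q (-1 / 2)) (k : ℤ) :
    ((kConst q α * q ^ (4 * α + 2) : ℝ) : ℂ) * riemannLiouville q α f (gridPt q k) =
      gridFourier q α (fun l => (((q ^ (2 * α + 1)) ^ (-l) : ℝ) : ℂ) *
        gridFourier q (-1 / 2) (fun n => f (gridPt q n)) (q ^ l)) (q ^ k) := by
  have hfs : Summable fun n => ‖f (gridPt q n)‖ * (q ^ (2 * (-1 / 2 : ℝ) + 2)) ^ n := by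
    rw [rpow_cos_weight]
    exact summable_of_mem_qSchwartz hq0 hq1 hf.1 hq0 hq1
  have h2 := gridFourier_gridFourier hq0 hq1 hm (by norm_num) hfs
  have h3 : q ^ (4 * (-1 / 2 : ℝ) + 2) = 1 := by norm_num
  simp only [h3, Complex.ofReal_one, one_mul] at h2
  rw [riemannLiouville_gridPt hq0,
    ← riemannLiouville_gridFourier hq0 hq1 hm hα (summable_gridFourier_cos hq0 hq1 hm hf hq0)]
  simp only [h2]

theorem mul_K2_riemannLiouville (hq0 : 0 < q) (hq1 : q < 1) (hm : 1 - q = q ^ m)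
    (hα : -1 / 2 < α) {f : Rq q → ℂ} (hf : f ∈ qSchwartzMoment q (-1 / 2)) (k : ℤ) :
    ((q ^ (4 * α + 2) : ℝ) : ℂ) * K2 q α (riemannLiouville q α f) (gridPt q k) =
      gridFourier q α (fun l =>
        gridFourier q (-1 / 2) (fun n => f (gridPt q n)) (q ^ l)) (q ^ k) := by
  have hα1 : -1 < α := by linarith
  have hb : 0 < q ^ (2 * α + 1) := by positivity
  have hN : ((q ^ (4 * α + 2) : ℝ) : ℂ) ≠ 0 := Complex.ofReal_ne_zero.2 (by positivity)
  have hkc : ((kConst q α * q ^ (4 * α + 2) : ℝ) : ℂ) ≠ 0 :=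
    Complex.ofReal_ne_zero.2 (kConst_mul_ne_zero hq0 hq1 hα)
  set h : ℤ → ℂ := fun l => gridFourier q (-1 / 2) (fun n => f (gridPt q n)) (q ^ l) with hh
  -- The value of `C` is `κ⁻¹`: applying `F_{α,q}` to `R_{α,q} f` and multiplying by `|λ|^(2α+1)`
  -- gives `κ⁻¹ h`, so the constant in `K₂` cancels it.
  set C : ℂ := ((kConst q α * q ^ (4 * α + 2) : ℝ) : ℂ)⁻¹ * ((q ^ (4 * α + 2) : ℝ) : ℂ) with hC
  have hr : ∀ s : ℝ, 0 < s → Summable fun n => ‖h n‖ * s ^ n :=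
    fun s hs => summable_gridFourier_cos hq0 hq1 hm hf hs
  have hs : Summable fun l => ‖(((q ^ (2 * α + 1)) ^ (-l) : ℝ) : ℂ) * h l‖ *
      (q ^ (2 * α + 2)) ^ l := by
    refine (hr q hq0).congr fun l => ?_
    rw [norm_mul, Complex.norm_real, Real.norm_of_nonneg (zpow_pos hb _).le, rpow_weight_mul hq0,
      zpow_neg]
    have := (zpow_pos hb l).ne'
    field_simp
  have hR : ∀ l : ℤ, riemannLiouville q α f (gridPt q l) =
      ((kConst q α * q ^ (4 * α + 2) : ℝ) : ℂ)⁻¹ * gridFourier q α (fun l =>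
        (((q ^ (2 * α + 1)) ^ (-l) : ℝ) : ℂ) * h l) (q ^ l) := by
    intro l
    rw [← riemannLiouville_eq_gridFourier hq0 hq1 hm hα hf, inv_mul_cancel_left₀ hkc]
  rw [K2, gridFourier_inverse hq0 hq1 hm hα1 (h := fun l => C * h l)]
  · rw [gridFourier_const_mul, hC]
    have hk : (kConst q α : ℂ) ≠ 0 := by
      rw [Complex.ofReal_mul] at hkc
      exact left_ne_zero_of_mul hkc
    push_cast at hN ⊢
    field_simp
  · intro s hs
    simp only [norm_mul, mul_assoc]
    simpa only [norm_mul, mul_assoc] using (hr s hs).mul_left ‖C‖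
  · intro x n hx
    rw [qBesselFourier_eq_gridFourier hq0, ← gridFourier_abs, abs_rpow_weight hq0 hx, hx]
    simp only [hR]
    rw [gridFourier_const_mul, gridFourier_gridFourier hq0 hq1 hm hα1 hs, hC, zpow_neg]
    have : (((q ^ (2 * α + 1)) ^ n : ℝ) : ℂ) ≠ 0 := Complex.ofReal_ne_zero.2 (zpow_pos hb n).ne'
    rw [Complex.ofReal_inv]
    field_simp
  · intro x hx
    rw [hx, abs_zero, Real.zero_rpow (by linarith), Complex.ofReal_zero, zero_mul]

end Inversion

end QBessel

end

theorem mainTheorem6 (q α : ℝ) (hq0 : 0 < q) (hq1 : q < 1)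
    (hq : ∃ m : ℤ, Real.log (1 - q) / Real.log q = m) (hα : -1 / 2 < α)
    (f : QBessel.Rq q → ℂ) (hf : f ∈ QBessel.qSchwartzMoment q (-1 / 2)) :
    f = (QBessel.weyl q α ∘ QBessel.riemannLiouville q α ∘ QBessel.K1 q α) f ∧
      f = (QBessel.weyl q α ∘ QBessel.K2 q α ∘ QBessel.riemannLiouville q α) f := by
  obtain ⟨m, hm⟩ := hq
  have hm' := QBessel.one_sub_eq_zpow hq0 hq1 hm
  exact ⟨QBessel.weyl_eq_of_grid hq0 hq1 hm' hα hf
      (QBessel.mul_riemannLiouville_K1 hq0 hq1 hm' hα hf),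
    QBessel.weyl_eq_of_grid hq0 hq1 hm' hα hf
      (QBessel.mul_K2_riemannLiouville hq0 hq1 hm' hα hf)⟩
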